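/- Let $\varphi\colon R\to S$ be a homomorphism of commutative rings with $S$ noetherian. For a ring $R$ let $D(R)$ be the derived category of $R$-modules and $D_b(R)$ the full subcategory of complexes with bounded homology. Let $\mathcal F(R)$, $\mathcal P(R)$, $\mathcal I(R)$ be the classes of complexes that are isomorphic in $D(R)$ to a bounded complex of flat, projective, injective $R$-modules, respectively. Let $\widetilde C$ be a semi-dualizing complex for $S$, that is, $\widetilde C\in D_b(S)$ has finitely generated homology modules and the homothety morphism $S\to \mathbf{R}\mathrm{Hom}_S(\widetilde C,\widetilde C)$ is an isomorphism in $D(S)$. The Auslander class $\mathcal A_{\widetilde C}(S)$ consists of the $X\in D_b(S)$ such that $\widetilde C\otimes^{\mathbf L}_S X\in D_b(S)$ and the unit $X\to\mathbf{R}\mathrm{Hom}_S(\widetilde C,\widetilde C\otimes^{\mathbf L}_S X)$ is an isomorphism in $D(S)$; the class $\mathcal B_{\widetilde C}(S)$ consists of the $Y\in D_b(S)$ such that $\mathbf{R}\mathrm{Hom}_S(\widetilde C,Y)\in D_b(S)$ and the counit $\widetilde C\otimes^{\mathbf L}_S\mathbf{R}\mathrm{Hom}_S(\widetilde C,Y)\to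 Y$ is an isomorphism in $D(S)$. Complexes over $S$ are regarded as complexes over $R$ through $\varphi$, and the derived functors over $R$ below take values in $D(S)$ through the action of $S$ on the $S$-complex argument. Then the following hold. (a) If $\widetilde A\in\mathcal A_{\widetilde C}(S)$ and $F\in\mathcal F(R)$, then $\widetilde A\otimes^{\mathbf L}_R F\in\mathcal A_{\widetilde C}(S)$. (b) If $\widetilde B\in\mathcal B_{\widetilde C}(S)$ and $F\in\mathcal F(R)$, then $\widetilde B\otimes^{\mathbf L}_R F\in\mathcal B_{\widetilde C}(S)$. (c) If $P\in\mathcal P(R)$ and $\widetilde A\in\mathcal A_{\widetilde C}(S)$, then $\mathbf{R}\mathrm{Hom}_R(P,\widetilde A)\in\mathcal A_{\widetilde C}(S)$. (d) If $P\in\mathcal P(R)$ and $\widetilde B\in\mathcal B_{\widetilde C}(S)$, then $\mathbf{R}\mathrm{Hom}_R(P,\widetilde B)\in\mathcal B_{\widetilde C}(S)$. (e) If $\widetilde A\in\mathcal A_{\widetilde C}(S)$ and $I\in\mathcal I(R)$, then $\mathbf{R}\mathrm{Hom}_R(\widetilde A,I)\in\mathcal B_{\widetilde C}(S)$. (f)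 If $\widetilde B\in\mathcal B_{\widetilde C}(S)$ and $I\in\mathcal I(R)$, then $\mathbf{R}\mathrm{Hom}_R(\widetilde B,I)\in\mathcal A_{\widetilde C}(S)$. -/

import Mathlib

open CategoryTheory CochainComplex CochainComplex.HomComplex

universe u

namespace AuslanderAscent

noncomputable section

/-! Complexes of modules are cochain complexes indexed by `ℤ`, that is, `X_n` of a chain complex
is placed in cohomological degree `-n`.  They are the objects of the derived category. -/

/-- Complexes of `R`-modules (unbounded). -/
abbrev Cplx (R : Type u) [CommRing R] : Type (u + 1) := CochainComplex (ModuleCat.{u} R) ℤ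

section Existence

theorem quasiIso_of_op {C : Type*} [Category C] [Abelian C] {X Y : CochainComplex C ℤ} (f : X ⟶ Y)
    (h : QuasiIso ((CochainComplex.opEquivalence C).functor.map f.op)) : QuasiIso f := by
  refine ⟨fun n => ?_⟩
  obtain ⟨m, rfl⟩ : ∃ m, n = -m := ⟨-n, by simp⟩
  have h1 := h.quasiIsoAt m
  rw [quasiIsoAt_iff' _ (m - 1) m (m + 1) (by simp) (by simp)] at h1
  rw [quasiIsoAt_iff' _ (-(m + 1)) (-m) (-(m - 1)) (by simp; lia) (by simp; lia)]
  rw [← ShortComplex.quasiIso_opMap_iff]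
  exact h1
theorem exists_kInjective {C : Type*} [Category C] [Abelian C] [EnoughInjectives C] (X : CochainComplex C ℤ)
    (n : ℤ) (h : ∀ i, i < n → X.ExactAt i) :
    ∃ (L : CochainComplex C ℤ) (i : X ⟶ L),
      QuasiIso i ∧ (∀ n, Injective (L.X n)) ∧ L.IsStrictlyGE n := by
  have : X.IsGE n := by
    rw [CochainComplex.isGE_iff]; exact h
  obtain ⟨L, i, hi, hL, hL'⟩ :=
    CochainComplex.Plus.modelCategoryQuillen.exists_quasiIso_injective (X.truncGE n) n
  have := (X.quasiIso_πTruncGE_iff n).mpr inferInstance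
  exact ⟨L, X.πTruncGE n ≫ i, inferInstance, hL, hL'⟩

theorem exists_kProjective {C : Type*} [Category C] [Abelian C] [EnoughProjectives C] (X : CochainComplex C ℤ)
    (n : ℤ) (h : ∀ i, n < i → X.ExactAt i) :
    ∃ (L : CochainComplex C ℤ) (i : L ⟶ X), QuasiIso i ∧ L.IsKProjective := by
  obtain ⟨L, i, hi, hL, hL'⟩ := exists_kInjective ((CochainComplex.opEquivalence C).functor.obj (Opposite.op X)) (-n)
    (fun i hi => CochainComplex.exactAt_op (h (-i) (by lia)) i)
  have hL2 := CochainComplex.isKInjective_of_injective L (-n)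
  let E := CochainComplex.opEquivalence C
  let π : (E.inverse.obj L).unop ⟶ X := (E.unit.app (Opposite.op X) ≫ E.inverse.map i).unop
  refine ⟨(E.inverse.obj L).unop, π, quasiIso_of_op _ ?_, CochainComplex.isKProjective_of_op ?_⟩
  · have : E.functor.map π.op = i ≫ E.counitInv.app L := by
      simp [π]
    change QuasiIso (E.functor.map π.op)
    rw [this]
    infer_instance
  · have : ((𝟭 (CochainComplex Cᵒᵖ ℤ)).obj L).IsKInjective := hL2
    exact CochainComplex.isKInjective_of_iso (E.counitIso.app L).symm

end Existence

section Absolute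

variable {R : Type u} [CommRing R]

/-- The complex has bounded (co)homology, i.e. it is an object of `D_b(R)`. -/
def HomologyBounded (X : Cplx R) : Prop :=
  ∃ a b : ℤ, ∀ n : ℤ, (n < a ∨ b < n) → X.ExactAt n

/-- All (co)homology modules are finitely generated. -/
def HomologyFinite (X : Cplx R) : Prop :=
  ∀ n : ℤ, Module.Finite R (X.homology n)

/-- A K-projective (Spaltenstein) resolution of a complex. -/
structure KProjRes (X : Cplx R) where
  /-- the resolving complex -/
  P : Cplx R
  /-- the augmentation -/
  π : P ⟶ X
  kProjective : P.IsKProjective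
  quasiIso : QuasiIso π

/-- A K-injective (Spaltenstein) resolution of a complex. -/
structure KInjRes (X : Cplx R) where
  /-- the resolving complex -/
  I : Cplx R
  /-- the coaugmentation -/
  ι : X ⟶ I
  kInjective : I.IsKInjective
  quasiIso : QuasiIso ι

theorem KProjRes.nonempty (X : Cplx R) (hX : HomologyBounded X) : Nonempty (KProjRes X) := by
  obtain ⟨_, b, h⟩ := hX
  obtain ⟨P, π, hπ, hP⟩ := exists_kProjective X b fun n hn => h n (Or.inr hn)
  exact ⟨⟨P, π, hP, hπ⟩⟩

theorem KInjRes.nonempty (X : Cplx R) (hX : HomologyBounded X) : Nonempty (KInjRes X) := by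
  obtain ⟨a, _, h⟩ := hX
  obtain ⟨I, ι, hι, hI, hI'⟩ := exists_kInjective X a fun n hn => h n (Or.inl hn)
  exact ⟨⟨I, ι, CochainComplex.isKInjective_of_injective I a, hι⟩⟩

/-- Two complexes are isomorphic in the derived category `D(R)`. -/
def DerivedIso (X Y : Cplx R) : Prop :=
  letI := HasDerivedCategory.standard (ModuleCat.{u} R)
  Nonempty (DerivedCategory.Q.obj X ≅ DerivedCategory.Q.obj Y)

/-- The complex is zero outside of a finite range of degrees. -/
def StrictlyBounded (X : Cplx R) : Prop :=
  ∃ a b : ℤ, ∀ n : ℤ, (n < a ∨ b < n) → Limits.IsZero (X.X n)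

/-- Finite flat dimension: isomorphic in `D(R)` to a bounded complex of flat modules. -/
def FiniteFlatDim (X : Cplx R) : Prop :=
  ∃ L : Cplx R, StrictlyBounded L ∧ (∀ n, Module.Flat R (L.X n)) ∧ DerivedIso L X

/-- Finite projective dimension: isomorphic in `D(R)` to a bounded complex of projective
modules. -/
def FiniteProjDim (X : Cplx R) : Prop :=
  ∃ L : Cplx R, StrictlyBounded L ∧ (∀ n, Module.Projective R (L.X n)) ∧ DerivedIso L X

/-- Finite injective dimension: isomorphic in `D(R)` to a bounded complex of injective
modules. -/
def FiniteInjDim (X : Cplx R) : Prop :=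
  ∃ L : Cplx R, StrictlyBounded L ∧ (∀ n, Module.Injective R (L.X n)) ∧ DerivedIso L X

/-! Complexes of finite flat, projective or injective dimension have bounded homology, hence
have K-projective and K-injective resolutions. -/

theorem DerivedIso.homologyBounded {X Y : Cplx R} (h : DerivedIso X Y) (hX : HomologyBounded X) :
    HomologyBounded Y := by
  let := HasDerivedCategory.standard (ModuleCat.{u} R)
  obtain ⟨e⟩ := h
  obtain ⟨a, b, hab⟩ := hX
  refine ⟨a, b, fun n hn => ?_⟩
  have h1 := hab n hn
  rw [HomologicalComplex.exactAt_iff_isZero_homology] at h1 ⊢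
  exact h1.of_iso (((DerivedCategory.homologyFunctorFactors _ n).app X).symm ≪≫
    (DerivedCategory.homologyFunctor _ n).mapIso e ≪≫
    (DerivedCategory.homologyFunctorFactors _ n).app Y).symm

theorem StrictlyBounded.homologyBounded {X : Cplx R} (hX : StrictlyBounded X) :
    HomologyBounded X := by
  obtain ⟨a, b, hab⟩ := hX
  exact ⟨a, b, fun n hn => HomologicalComplex.ExactAt.of_isZero (hab n hn)⟩

theorem FiniteFlatDim.homologyBounded {X : Cplx R} (h : FiniteFlatDim X) : HomologyBounded X :=
  let ⟨_, hL, _, e⟩ := h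
  e.homologyBounded hL.homologyBounded

theorem FiniteProjDim.homologyBounded {X : Cplx R} (h : FiniteProjDim X) : HomologyBounded X :=
  let ⟨_, hL, _, e⟩ := h
  e.homologyBounded hL.homologyBounded

theorem FiniteInjDim.homologyBounded {X : Cplx R} (h : FiniteInjDim X) : HomologyBounded X :=
  let ⟨_, hL, _, e⟩ := h
  e.homologyBounded hL.homologyBounded

/-- The complex of `R`-modules `Hom_R(X, Y)`: in degree `n` it is `∏_p Hom_R(X^p, Y^{p+n})`, with
differential `f ↦ d ∘ f - (-1)^n f ∘ d`. -/
@[simps]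
def homCplx (X Y : Cplx R) : Cplx R where
  X n := ModuleCat.of R (Cochain X Y n)
  d i j := ModuleCat.ofHom (δ_hom R X Y i j)
  shape i j hij := ModuleCat.hom_ext (LinearMap.ext fun z => δ_shape i j hij z)
  d_comp_d' i j k _ _ := ModuleCat.hom_ext (LinearMap.ext fun z => δ_δ i j k z)

/-- The total tensor product complex `X ⊗_R Y`, with `d(x ⊗ y) = dx ⊗ y + (-1)^{|x|} x ⊗ dy`. -/
abbrev tensorCplx (X Y : Cplx R) : Cplx R := HomologicalComplex.tensorObj X Y

open MonoidalCategory in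
theorem ι_tensorCplx_d (X Y : Cplx R) (p q n p' q' m : ℤ) (h : p + q = n) (hp : p + 1 = p')
    (hq : q + 1 = q') (hm : n + 1 = m) :
    HomologicalComplex.ιTensorObj X Y p q n h ≫ (tensorCplx X Y).d n m =
      (X.d p p' ▷ Y.X q) ≫ HomologicalComplex.ιTensorObj X Y p' q m (by lia) +
        p.negOnePow • ((X.X p ◁ Y.d q q') ≫
          HomologicalComplex.ιTensorObj X Y p q' m (by lia)) := by
  rw [HomologicalComplex.mapBifunctor.d_eq, Preadditive.comp_add,
    HomologicalComplex.mapBifunctor.ι_D₁, HomologicalComplex.mapBifunctor.ι_D₂,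
    HomologicalComplex.mapBifunctor.d₁_eq _ _ _ _ (show (ComplexShape.up ℤ).Rel p p' from hp) _ _
      (show p' + q = m by lia),
    HomologicalComplex.mapBifunctor.d₂_eq _ _ _ _ _ (show (ComplexShape.up ℤ).Rel q q' from hq) _
      (show p + q' = m by lia)]
  simp [ComplexShape.ε₁_def, ComplexShape.ε₂_def]

/-- The map `X^n → Hom_R(P, X ⊗_R P)^n`, `x ↦ (y ↦ x ⊗ y)`. -/
def unitLinear (P X : Cplx R) (n : ℤ) : X.X n →ₗ[R] Cochain P (tensorCplx X P) n where
  toFun x := Cochain.mk fun p q hpq =>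
    ModuleCat.ofHom (TensorProduct.mk R (X.X n) (P.X p) x) ≫
      HomologicalComplex.ιTensorObj X P n p q (by lia)
  map_add' x y := by
    ext p q hpq z
    simp
  map_smul' r x := by
    ext p q hpq z
    exact map_smul (HomologicalComplex.ιTensorObj X P n p q (by lia)).hom r
      (TensorProduct.mk R (X.X n) (P.X p) x z)

/-- The unit `X → Hom_R(P, X ⊗_R P)`, `x ↦ (y ↦ x ⊗ y)`, of the tensor-Hom adjunction. -/
def unitMap (P X : Cplx R) : X ⟶ homCplx P (tensorCplx X P) where
  f n := ModuleCat.ofHom (unitLinear P X n)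
  comm' n m hnm := by
    obtain rfl : n + 1 = m := hnm
    refine ModuleCat.hom_ext (LinearMap.ext fun x => Cochain.ext _ _ fun p q hpq => ?_)
    refine ModuleCat.hom_ext (LinearMap.ext fun y => ?_)
    have h := ι_tensorCplx_d X P n p (n + p) (n + 1) (p + 1) q rfl rfl rfl (by lia)
    have h' := congr($(h).hom (x ⊗ₜ[R] y))
    change (((δ n (n + 1) (unitLinear P X n x)).v p q hpq).hom y) =
      ((unitLinear P X (n + 1) (X.d n (n + 1) x)).v p q hpq).hom y
    rw [δ_v n (n+1) rfl _ p q hpq (n + p) (p + 1) (by lia) rfl]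
    simp [unitLinear, Int.negOnePow_succ] at h' ⊢
    rw [h']
    exact add_neg_cancel_right _ _

/-- The counit `Hom_R(P, Y) ⊗_R P → Y`, `f ⊗ y ↦ f(y)`, of the tensor-Hom adjunction. -/
def counitMap (P Y : Cplx R) : tensorCplx (homCplx P Y) P ⟶ Y where
  f j := HomologicalComplex.mapBifunctorDesc fun n p h =>
    ModuleCat.ofHom (TensorProduct.lift
      { toFun := fun z : Cochain P Y n => (z.v p j (by have : n + p = j := h; lia)).hom
        map_add' := fun _ _ => rfl
        map_smul' := fun _ _ => rfl })
  comm' j k hjk := by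
    obtain rfl : j + 1 = k := hjk
    refine HomologicalComplex.mapBifunctor.hom_ext fun n p h => ?_
    have hnp : n + p = j := h
    refine ModuleCat.hom_ext (TensorProduct.ext' fun (z : Cochain P Y n) y => ?_)
    rw [HomologicalComplex.ι_mapBifunctorDesc_assoc]
    have h1 := ι_tensorCplx_d (homCplx P Y) P n p j (n + 1) (p + 1) (j + 1) hnp rfl rfl rfl
    rw [reassoc_of% h1]
    simp only [Preadditive.add_comp, Linear.units_smul_comp, Category.assoc,
      HomologicalComplex.ι_mapBifunctorDesc]
    change (Y.d j (j + 1)).hom ((z.v p j (by lia)).hom y) =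
      ((δ n (n + 1) z).v p (j + 1) (by lia)).hom y +
        n.negOnePow • (z.v (p + 1) (j + 1) (by lia)).hom ((P.d p (p + 1)).hom y)
    rw [δ_v n (n + 1) rfl z p (j + 1) (by lia) j (p + 1) (by lia) rfl]
    simp [Int.negOnePow_succ]

/-- The homothety map `R → Hom_R(P, P)`, `r ↦ r • id`, with `R` in degree zero. -/
def homothety (P : Cplx R) :
    (HomologicalComplex.single (ModuleCat.{u} R) (ComplexShape.up ℤ) 0).obj (ModuleCat.of R R) ⟶
      homCplx P P :=
  HomologicalComplex.mkHomFromSingle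
    (ModuleCat.ofHom (LinearMap.toSpanSingleton R (Cochain P P 0) (Cochain.ofHom (𝟙 P))))
    (fun k _ => by
      refine ModuleCat.hom_ext (LinearMap.ext fun r => ?_)
      change δ 0 k (r • Cochain.ofHom (𝟙 P)) = 0
      simp)

/-! For `P → C` a K-projective resolution, `X ⊗_R P` is `C ⊗^L_R X` and `Hom_R(P, Y)` is
`RHom_R(C, Y)`.  Any two resolutions are homotopy equivalent over `C`, so that the conditions below
hold for one resolution if and only if they hold for all; complexes with bounded homology have
such resolutions. -/

/-- `C` is a semi-dualizing complex for `R`: its homology is bounded and degreewise finitely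
generated, and the homothety morphism `R → RHom_R(C, C)` is an isomorphism in `D(R)`. -/
structure IsSemidualizing (C : Cplx R) : Prop where
  bounded : HomologyBounded C
  finite : HomologyFinite C
  quasiIso_homothety : ∀ P : KProjRes C, QuasiIso (homothety P.P)

/-- The Auslander class `A_C(R)`: complexes `X` in `D_b(R)` such that `C ⊗^L_R X` is in `D_b(R)`
and the unit `X → RHom_R(C, C ⊗^L_R X)` is an isomorphism in `D(R)`. -/
def AuslanderA (C X : Cplx R) : Prop :=
  HomologyBounded X ∧ ∀ P : KProjRes C,
    HomologyBounded (tensorCplx X P.P) ∧ QuasiIso (unitMap P.P X)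

/-- The Auslander class `B_C(R)`: complexes `Y` in `D_b(R)` such that `RHom_R(C, Y)` is in `D_b(R)`
and the counit `C ⊗^L_R RHom_R(C, Y) → Y` is an isomorphism in `D(R)`. -/
def AuslanderB (C Y : Cplx R) : Prop :=
  HomologyBounded Y ∧ ∀ P : KProjRes C,
    HomologyBounded (homCplx P.P Y) ∧ QuasiIso (counitMap P.P Y)

end Absolute

section Relative

variable (R : Type u) {S : Type u} [CommRing R] [CommRing S] [Algebra R S]

/-- A complex of `S`-modules considered as a complex of `R`-modules through `R → S`. -/
abbrev resCplx (A : Cplx S) : Cplx R :=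
  ((ModuleCat.restrictScalars.{u} (algebraMap R S)).mapHomologicalComplex _).obj A

/-- Multiplication by `s : S` on the underlying `R`-complex of an `S`-complex. -/
def scalar (A : Cplx S) (s : S) : resCplx R A ⟶ resCplx R A :=
  ((ModuleCat.restrictScalars.{u} (algebraMap R S)).mapHomologicalComplex _).map (s • 𝟙 A)

theorem scalar_one (A : Cplx S) : scalar R A 1 = 𝟙 _ := by
  simp [scalar]

theorem scalar_zero (A : Cplx S) : scalar R A 0 = 0 := by
  simp [scalar]

theorem scalar_add (A : Cplx S) (s t : S) :
    scalar R A (s + t) = scalar R A s + scalar R A t := by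
  simp [scalar, add_smul, Functor.map_add]

theorem scalar_mul (A : Cplx S) (s t : S) :
    scalar R A (s * t) = scalar R A s ≫ scalar R A t := by
  rw [scalar, scalar, scalar, ← Functor.map_comp]
  simp [smul_smul, mul_comm]

variable {R}

/-- `∏_p Hom_R(Q^p, A^{p+n})` for an `R`-complex `Q` and an `S`-complex `A`. -/
def HomTo (Q : Cplx R) (A : Cplx S) (n : ℤ) : Type u := Cochain Q (resCplx R A) n

instance homToAddCommGroup (Q : Cplx R) (A : Cplx S) (n : ℤ) : AddCommGroup (HomTo Q A n) :=
  inferInstanceAs (AddCommGroup (Cochain Q (resCplx R A) n))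

/-- The action of `S` through the target: `(s • f)(x) = s • f(x)`. -/
instance homToModule (Q : Cplx R) (A : Cplx S) (n : ℤ) : Module S (HomTo Q A n) where
  smul s z := Cochain.comp (K := resCplx R A) z (Cochain.ofHom (scalar R A s)) (add_zero n)
  one_smul z := by
    revert z
    change ∀ z : Cochain Q (resCplx R A) n,
      Cochain.comp (K := resCplx R A) z (Cochain.ofHom (scalar R A 1)) (add_zero n) = z
    intro z
    rw [scalar_one, Cochain.comp_id]
  mul_smul s t z := by
    revert z
    change ∀ z : Cochain Q (resCplx R A) n,
      Cochain.comp (K := resCplx R A) z (Cochain.ofHom (scalar R A (s * t))) (add_zero n) =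
      Cochain.comp (Cochain.comp (K := resCplx R A) z (Cochain.ofHom (scalar R A t)) (add_zero n))
        (Cochain.ofHom (scalar R A s)) (add_zero n)
    intro z
    rw [Cochain.comp_assoc_of_third_is_zero_cochain, mul_comm, scalar_mul, Cochain.ofHom_comp]
  smul_zero s := Cochain.zero_comp _ _
  smul_add s z w := Cochain.add_comp _ _ _ _
  add_smul s t z := by
    revert z
    change ∀ z : Cochain Q (resCplx R A) n,
      Cochain.comp (K := resCplx R A) z (Cochain.ofHom (scalar R A (s + t))) (add_zero n) =
      Cochain.comp (K := resCplx R A) z (Cochain.ofHom (scalar R A s)) (add_zero n) +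
        Cochain.comp (K := resCplx R A) z (Cochain.ofHom (scalar R A t)) (add_zero n)
    intro z
    rw [scalar_add, Cochain.ofHom_add, Cochain.comp_add]
  zero_smul z := by
    revert z
    change ∀ z : Cochain Q (resCplx R A) n,
      Cochain.comp (K := resCplx R A) z (Cochain.ofHom (scalar R A 0)) (add_zero n) = 0
    intro z
    rw [scalar_zero, Cochain.ofHom_zero, Cochain.comp_zero]

/-- `Hom_R(Q, A)` for an `R`-complex `Q` and an `S`-complex `A`, as a complex of `S`-modules,
with differential `f ↦ d ∘ f - (-1)^n f ∘ d`. -/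
def homToCplx (Q : Cplx R) (A : Cplx S) : Cplx S where
  X n := ModuleCat.of S (HomTo Q A n)
  d i j := ModuleCat.ofHom
    { toFun := fun z : Cochain Q (resCplx R A) i => (δ i j z : Cochain Q (resCplx R A) j)
      map_add' := fun z w => δ_add (n := i) (m := j) z w
      map_smul' := fun s z => δ_comp_ofHom z (scalar R A s) j }
  shape i j hij := ModuleCat.hom_ext (LinearMap.ext fun z => δ_shape i j hij z)
  d_comp_d' i j k _ _ := ModuleCat.hom_ext (LinearMap.ext fun z => δ_δ i j k z)

/-- `∏_p Hom_R(A^p, J^{p+n})` for an `S`-complex `A` and an `R`-complex `J`. -/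
def HomFrom (A : Cplx S) (J : Cplx R) (n : ℤ) : Type u := Cochain (resCplx R A) J n

instance homFromAddCommGroup (A : Cplx S) (J : Cplx R) (n : ℤ) : AddCommGroup (HomFrom A J n) :=
  inferInstanceAs (AddCommGroup (Cochain (resCplx R A) J n))

/-- The action of `S` through the source: `(s • f)(a) = f(s • a)`. -/
instance homFromModule (A : Cplx S) (J : Cplx R) (n : ℤ) : Module S (HomFrom A J n) where
  smul s z := Cochain.comp (G := resCplx R A) (Cochain.ofHom (scalar R A s)) z (zero_add n)
  one_smul z := by
    revert z
    change ∀ z : Cochain (resCplx R A) J n,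
      Cochain.comp (G := resCplx R A) (Cochain.ofHom (scalar R A 1)) z (zero_add n) = z
    intro z
    rw [scalar_one, Cochain.id_comp]
  mul_smul s t z := by
    revert z
    change ∀ z : Cochain (resCplx R A) J n,
      Cochain.comp (G := resCplx R A) (Cochain.ofHom (scalar R A (s * t))) z (zero_add n) =
      Cochain.comp (Cochain.ofHom (scalar R A s))
        (Cochain.comp (G := resCplx R A) (Cochain.ofHom (scalar R A t)) z (zero_add n)) (zero_add n)
    intro z
    rw [scalar_mul, Cochain.ofHom_comp, Cochain.comp_assoc_of_first_is_zero_cochain]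
  smul_zero s := Cochain.comp_zero _ _
  smul_add s z w := Cochain.comp_add _ _ _ _
  add_smul s t z := by
    revert z
    change ∀ z : Cochain (resCplx R A) J n,
      Cochain.comp (G := resCplx R A) (Cochain.ofHom (scalar R A (s + t))) z (zero_add n) =
      Cochain.comp (G := resCplx R A) (Cochain.ofHom (scalar R A s)) z (zero_add n) +
        Cochain.comp (G := resCplx R A) (Cochain.ofHom (scalar R A t)) z (zero_add n)
    intro z
    rw [scalar_add, Cochain.ofHom_add, Cochain.add_comp]
  zero_smul z := by
    revert z
    change ∀ z : Cochain (resCplx R A) J n,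
      Cochain.comp (G := resCplx R A) (Cochain.ofHom (scalar R A 0)) z (zero_add n) = 0
    intro z
    rw [scalar_zero, Cochain.ofHom_zero, Cochain.zero_comp]

/-- `Hom_R(A, J)` for an `S`-complex `A` and an `R`-complex `J`, as a complex of `S`-modules,
with differential `f ↦ d ∘ f - (-1)^n f ∘ d`. -/
def homFromCplx (A : Cplx S) (J : Cplx R) : Cplx S where
  X n := ModuleCat.of S (HomFrom A J n)
  d i j := ModuleCat.ofHom
    { toFun := fun z : Cochain (resCplx R A) J i => (δ i j z : Cochain (resCplx R A) J j)
      map_add' := fun z w => δ_add (n := i) (m := j) z w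
      map_smul' := fun s z => δ_ofHom_comp (scalar R A s) z j }
  shape i j hij := ModuleCat.hom_ext (LinearMap.ext fun z => δ_shape i j hij z)
  d_comp_d' i j k _ _ := ModuleCat.hom_ext (LinearMap.ext fun z => δ_δ i j k z)

instance restrictScalarsIsScalarTower (A : ModuleCat.{u} S) :
    IsScalarTower R S ((ModuleCat.restrictScalars (algebraMap R S)).obj A) where
  smul_assoc r s a := by
    change (r • s) • (show A from a) = algebraMap R S r • s • (show A from a)
    rw [Algebra.smul_def, mul_smul]

/-- The bifunctor `(A, Q) ↦ A ⊗_R Q` from `S`-modules and `R`-modules to `S`-modules, with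
`s • (a ⊗ q) = (s • a) ⊗ q`. -/
def tensorBifunctor : ModuleCat.{u} S ⥤ ModuleCat.{u} R ⥤ ModuleCat.{u} S where
  obj A :=
    { obj := fun Q => ModuleCat.of S
        (TensorProduct R ((ModuleCat.restrictScalars (algebraMap R S)).obj A) Q)
      map := fun g => ModuleCat.ofHom (TensorProduct.AlgebraTensorModule.map LinearMap.id g.hom)
      map_id := fun Q => by
        refine ModuleCat.hom_ext (TensorProduct.AlgebraTensorModule.ext fun a q => rfl)
      map_comp := fun f g => by
        refine ModuleCat.hom_ext (TensorProduct.AlgebraTensorModule.ext fun a q => rfl) }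
  map {A B} f :=
    { app := fun Q => ModuleCat.ofHom
        (TensorProduct.AlgebraTensorModule.map
          (M := (ModuleCat.restrictScalars (algebraMap R S)).obj A)
          (P := (ModuleCat.restrictScalars (algebraMap R S)).obj B) f.hom LinearMap.id)
      naturality := fun Q Q' g => by
        refine ModuleCat.hom_ext (TensorProduct.AlgebraTensorModule.ext fun a q => rfl) }
  map_id A := by
    ext Q : 2
    refine ModuleCat.hom_ext (TensorProduct.AlgebraTensorModule.ext fun a q => rfl)
  map_comp f g := by
    ext Q : 2
    refine ModuleCat.hom_ext (TensorProduct.AlgebraTensorModule.ext fun a q => rfl)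

instance tensorBifunctorAdditive : (tensorBifunctor (R := R) (S := S)).Additive where
  map_add {A B f g} := by
    ext Q : 2
    refine ModuleCat.hom_ext (LinearMap.ext fun x => ?_)
    refine TensorProduct.induction_on x ?_ (fun a q => ?_) (fun x y hx hy => ?_)
    · exact (map_zero _).trans (map_zero _).symm
    · exact TensorProduct.add_tmul (R := R)
        (M := (ModuleCat.restrictScalars (algebraMap R S)).obj B) _ _ _
    · exact (map_add _ x y).trans ((congrArg₂ _ hx hy).trans (map_add _ x y).symm)

instance tensorBifunctorObjAdditive (A : ModuleCat.{u} S) :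
    ((tensorBifunctor (R := R)).obj A).Additive where
  map_add {Q Q' f g} := by
    refine ModuleCat.hom_ext (LinearMap.ext fun x => ?_)
    refine TensorProduct.induction_on x ?_ (fun a q => ?_) (fun x y hx hy => ?_)
    · exact (map_zero _).trans (map_zero _).symm
    · exact TensorProduct.tmul_add _ _ _
    · exact (map_add _ x y).trans ((congrArg₂ _ hx hy).trans (map_add _ x y).symm)

/-- `A ⊗_R Q` for an `S`-complex `A` and an `R`-complex `Q`, as a complex of `S`-modules, with
differential `d(a ⊗ q) = da ⊗ q + (-1)^{|a|} a ⊗ dq`. -/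
abbrev tensorRelCplx (A : Cplx S) (Q : Cplx R) : Cplx S :=
  HomologicalComplex.mapBifunctor A Q (tensorBifunctor (R := R)) (ComplexShape.up ℤ)

end Relative

end

end AuslanderAscent

namespace AuslanderAscent

set_option linter.unusedSimpArgs false

noncomputable section

/-! ### Quasi-isomorphisms and bounded homology in terms of elements -/

section ElementwiseCriteria

variable {R : Type u} [CommRing R]

/-! Since `S` is noetherian and `C` has bounded, finitely generated homology, `C` has a resolution
`P` by finitely generated free modules, bounded above in cohomological degree
(`exists_finiteFree_resolution`). Membership in either class can be tested on this one `P`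
(`auslanderA_iff`, `auslanderB_iff`) and is invariant under quasi-isomorphisms of the other
argument. Everything thus concerns the explicit complexes `X ⊗ P` and `Hom_S(P, Y)`.

Let `J` be a bounded K-injective complex over `R` and put `D = Hom_R(-, J)`. Adjunction gives an
isomorphism `D(X ⊗ P) ≅ Hom_S(P, DX)` (`curryMap`), and Hom evaluation gives a map `DY ⊗ P → D
Hom_S(P, Y)` (`evalMap`). The latter is bijective for bounded `Y` because `P` is degreewise finite
free, and it is a quasi-isomorphism as soon as `Y` has bounded homology. Through these maps the
counit of `DX` is the dual of the unit of `X`, and the unit of `DY` is the dual of the counit of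
`Y`. Hence `D` exchanges the two classes, which is (e) and (f).

For a bounded complex `L` of projectives, `swapMap` and `tensorEvalMap` show in the same way that
`Hom_R(L, -)` commutes with `Hom_S(P, -)` and with `- ⊗ P`, and that it carries units to units and
counits to counits. This is (c) and (d).

For (a) and (b) take `J` to be the character module of `R` in degree zero. Then `D` is the usual
character dual, which detects exactness and quasi-isomorphisms, so the duality argument can be
reversed: `X` lies in one class if `DX` lies in the other (`InAuslanderA.of_homFromCplx`,
`InAuslanderB.of_homFromCplx`). Moreover `D(A ⊗_R F) ≅ Hom_R(A, DF)` by adjunction, and for `F` of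
finite flat dimension `DF` is a bounded complex of injectives up to quasi-isomorphism, because
character modules of flat modules are injective. So (a) and (b) follow from (e) and (f). -/

theorem shortComplex_quasiIso_iff {S T : ShortComplex (ModuleCat.{u} R)} (φ : S ⟶ T) :
    ShortComplex.QuasiIso φ ↔
      (∀ x : S.X₂, S.g x = 0 → (∃ y : T.X₁, T.f y = φ.τ₂ x) → ∃ y : S.X₁, S.f y = x) ∧
      (∀ x' : T.X₂, T.g x' = 0 → ∃ (x : S.X₂) (y : T.X₁), S.g x = 0 ∧ φ.τ₂ x + T.f y = x') := by
  have hker : ∀ x ∈ LinearMap.ker S.g.hom, φ.τ₂.hom x ∈ LinearMap.ker T.g.hom := fun x hx => by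
    have h := congr($(φ.comm₂₃).hom x)
    have hx' : S.g.hom x = 0 := hx
    simpa [hx'] using h
  let k : LinearMap.ker S.g.hom →ₗ[R] LinearMap.ker T.g.hom := φ.τ₂.hom.restrict hker
  have hle : LinearMap.range S.moduleCatToCycles ≤
      (LinearMap.range T.moduleCatToCycles).comap k := by
    rintro _ ⟨y, rfl⟩
    refine ⟨φ.τ₁ y, Subtype.ext ?_⟩
    exact congr($(φ.comm₁₂).hom y)
  -- Homology is taken in the model `ker g / im f`, where the induced map is `Submodule.mapQ`. The
  -- two conjuncts are its injectivity and its surjectivity, spelled out on representatives.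
  let γ : ShortComplex.LeftHomologyMapData φ S.moduleCatLeftHomologyData
      T.moduleCatLeftHomologyData :=
    { φK := ModuleCat.ofHom k
      φH := ModuleCat.ofHom (Submodule.mapQ _ _ k hle)
      commi := rfl
      commf' := by
        refine ModuleCat.hom_ext (LinearMap.ext fun y => Subtype.ext ?_)
        exact congr($(φ.comm₁₂).hom y).symm
      commπ := rfl }
  rw [γ.quasiIso_iff, ConcreteCategory.isIso_iff_bijective]
  refine and_congr ?_ ?_
  · change Function.Injective (Submodule.mapQ _ _ k hle) ↔ _
    rw [← LinearMap.ker_eq_bot, LinearMap.ker_eq_bot']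
    constructor
    · rintro h x hx ⟨y, hy⟩
      have := h (Submodule.Quotient.mk ⟨x, hx⟩) (by
        rw [Submodule.mapQ_apply, Submodule.Quotient.mk_eq_zero]
        exact ⟨y, Subtype.ext hy⟩)
      rw [Submodule.Quotient.mk_eq_zero] at this
      obtain ⟨y, hy⟩ := this
      exact ⟨y, congr_arg Subtype.val hy⟩
    · intro h m hm
      obtain ⟨⟨x, hx⟩, rfl⟩ := Submodule.Quotient.mk_surjective _ m
      rw [Submodule.mapQ_apply, Submodule.Quotient.mk_eq_zero] at hm
      obtain ⟨y, hy⟩ := hm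
      obtain ⟨z, hz⟩ := h x hx ⟨y, congr_arg Subtype.val hy⟩
      rw [Submodule.Quotient.mk_eq_zero]
      exact ⟨z, Subtype.ext hz⟩
  · change Function.Surjective (Submodule.mapQ _ _ k hle) ↔ _
    constructor
    · intro h x' hx'
      obtain ⟨m, hm⟩ := h (Submodule.Quotient.mk ⟨x', hx'⟩)
      obtain ⟨⟨x, hx⟩, rfl⟩ := Submodule.Quotient.mk_surjective _ m
      rw [Submodule.mapQ_apply, eq_comm, Submodule.Quotient.eq] at hm
      obtain ⟨y, hy⟩ := hm
      refine ⟨x, y, hx, ?_⟩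
      have : T.f.hom y = x' - φ.τ₂.hom x := congr_arg Subtype.val hy
      change φ.τ₂.hom x + T.f.hom y = x'
      rw [this]; abel
    · intro h m
      obtain ⟨⟨x', hx'⟩, rfl⟩ := Submodule.Quotient.mk_surjective _ m
      obtain ⟨x, y, hx, hy⟩ := h x' hx'
      refine ⟨Submodule.Quotient.mk ⟨x, hx⟩, ?_⟩
      rw [Submodule.mapQ_apply, eq_comm, Submodule.Quotient.eq]
      refine ⟨y, Subtype.ext ?_⟩
      change T.f.hom y = x' - φ.τ₂.hom x
      rw [← hy]
      exact (add_sub_cancel_left _ _).symm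

variable {K L : Cplx R}

theorem exactAt_iff_forall {l m n : ℤ} (h : l + 1 = m) (h' : m + 1 = n) :
    K.ExactAt m ↔ ∀ x : K.X m, K.d m n x = 0 → ∃ y : K.X l, K.d l m y = x := by
  rw [HomologicalComplex.exactAt_iff' K l m n (by simp; lia) (by simp; lia),
    ShortComplex.moduleCat_exact_iff]
  rfl

theorem quasiIsoAt_iff_forall (f : K ⟶ L) {l m n : ℤ} (h : l + 1 = m) (h' : m + 1 = n) :
    QuasiIsoAt f m ↔
      (∀ x : K.X m, K.d m n x = 0 → (∃ y : L.X l, L.d l m y = f.f m x) →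
        ∃ y : K.X l, K.d l m y = x) ∧
      (∀ x' : L.X m, L.d m n x' = 0 → ∃ (x : K.X m) (y : L.X l), K.d m n x = 0 ∧
        f.f m x + L.d l m y = x') := by
  rw [quasiIsoAt_iff' f l m n (by simp; lia) (by simp; lia), shortComplex_quasiIso_iff]
  rfl

theorem quasiIso_of_forall (f : K ⟶ L)
    (hi : ∀ l m n : ℤ, l + 1 = m → m + 1 = n → ∀ x : K.X m, K.d m n x = 0 →
      (∃ y : L.X l, L.d l m y = f.f m x) → ∃ y : K.X l, K.d l m y = x)
    (hs : ∀ l m n : ℤ, l + 1 = m → m + 1 = n → ∀ x' : L.X m, L.d m n x' = 0 →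
      ∃ (x : K.X m) (y : L.X l), K.d m n x = 0 ∧ f.f m x + L.d l m y = x') : QuasiIso f :=
  ⟨fun m => (quasiIsoAt_iff_forall f (sub_add_cancel m 1) rfl).2
    ⟨hi _ _ _ (sub_add_cancel m 1) rfl, hs _ _ _ (sub_add_cancel m 1) rfl⟩⟩

theorem quasiIso_of_bijective (f : K ⟶ L) (h : ∀ n, Function.Bijective (f.f n)) : QuasiIso f := by
  have (n : ℤ) : IsIso (f.f n) := (ConcreteCategory.isIso_iff_bijective _).2 (h n)
  have : IsIso f := HomologicalComplex.Hom.isIso_of_components f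
  infer_instance

theorem HomologyBounded.of_quasiIso (f : K ⟶ L) [QuasiIso f] (h : HomologyBounded K) :
    HomologyBounded L :=
  let ⟨a, b, hab⟩ := h
  ⟨a, b, fun n hn => (exactAt_iff_of_quasiIsoAt f n).1 (hab n hn)⟩

theorem HomologyBounded.of_quasiIso' (f : K ⟶ L) [QuasiIso f] (h : HomologyBounded L) :
    HomologyBounded K :=
  let ⟨a, b, hab⟩ := h
  ⟨a, b, fun n hn => (exactAt_iff_of_quasiIsoAt f n).2 (hab n hn)⟩

/-- A complex with bounded homology is linked by quasi-isomorphisms to a bounded complex. -/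
theorem HomologyBounded.exists_strictlyBounded (h : HomologyBounded K) :
    ∃ (M N : Cplx R) (f : M ⟶ K) (g : M ⟶ N), QuasiIso f ∧ QuasiIso g ∧ StrictlyBounded N := by
  obtain ⟨a, b, hab⟩ := h
  have hLE : K.IsLE b := (K.isLE_iff b).2 fun i hi => hab i (Or.inr hi)
  have hGE : K.IsGE a := (K.isGE_iff a).2 fun i hi => hab i (Or.inl hi)
  -- Truncating above `b` does not change the homology below `a`, so the second truncation map is
  -- again a quasi-isomorphism.
  have hGE' : (K.truncLE b).IsGE a := ((K.truncLE b).isGE_iff a).2 fun i hi =>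
    (exactAt_iff_of_quasiIsoAt (K.ιTruncLE b) i).2 (hab i (Or.inl hi))
  refine ⟨K.truncLE b, (K.truncLE b).truncGE a, K.ιTruncLE b, (K.truncLE b).πTruncGE a,
    inferInstance, inferInstance, a, b, ?_⟩
  rintro n (hn | hn)
  · exact ((K.truncLE b).truncGE a).isZero_of_isStrictlyGE a n hn
  · exact ((K.truncLE b).truncGE a).isZero_of_isStrictlyLE b n hn

end ElementwiseCriteria

/-! ### Cohomology of Hom complexes and K-projective or K-injective complexes -/

section CochainLemmas

variable {C : Type*} [Category* C] [Abelian C]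

/-- The maps on cohomology of the complexes of cochains induced by an additive operation
commuting with `δ` are bijective. -/
structure CohomologyBijective {K L K' L' : CochainComplex C ℤ}
    (φ : ∀ n, Cochain K L n → Cochain K' L' n) : Prop where
  injective (l m n : ℤ) (_ : l + 1 = m) (_ : m + 1 = n) (z : Cochain K L m) (_ : δ m n z = 0)
    (w : Cochain K' L' l) (_ : δ l m w = φ m z) : ∃ v : Cochain K L l, δ l m v = z
  surjective (l m n : ℤ) (_ : l + 1 = m) (_ : m + 1 = n) (z' : Cochain K' L' m)
    (_ : δ m n z' = 0) : ∃ (z : Cochain K L m) (w : Cochain K' L' l),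
      δ m n z = 0 ∧ φ m z + δ l m w = z'

/-- Degree `n` classes of the Hom complex are morphisms `K ⟶ L⟦n⟧` in the homotopy category. An
operation on cochains that becomes a bijection `Φ` between such morphisms is therefore bijective on
cohomology. -/
theorem CohomologyBijective.of_toHom {K L K' L' : CochainComplex C ℤ}
    (φ : ∀ n, Cochain K L n → Cochain K' L' n) (ψ : ∀ n, Cocycle K L n → Cocycle K' L' n)
    (hψ : ∀ n (z : Cocycle K L n), (ψ n z).1 = φ n z.1)
    (Φ : ∀ n : ℤ, ((HomotopyCategory.quotient C (.up ℤ)).obj K ⟶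
        (HomotopyCategory.quotient C (.up ℤ)).obj (L⟦n⟧)) →+
      ((HomotopyCategory.quotient C (.up ℤ)).obj K' ⟶
        (HomotopyCategory.quotient C (.up ℤ)).obj (L'⟦n⟧)))
    (h : ∀ n (z : Cocycle K L n), CohomologyClass.toHom (.mk (ψ n z)) =
      Φ n (CohomologyClass.toHom (.mk z)))
    (hΦ : ∀ n, Function.Bijective (Φ n)) : CohomologyBijective φ where
  injective l m n hl hm z hz w hw := by
    let z₀ : Cocycle K L m := Cocycle.mk z n hm hz
    have h0 : CohomologyClass.toHom (.mk (ψ m z₀)) = 0 := by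
      rw [CohomologyClass.toHom_mk_eq_zero_iff, mem_coboundaries_iff _ l hl]
      exact ⟨w, by rw [hw, hψ]; rfl⟩
    have h1 : CohomologyClass.toHom (.mk z₀) = 0 := by
      rw [h] at h0
      exact (hΦ m).1 (by rw [h0, map_zero])
    rw [CohomologyClass.toHom_mk_eq_zero_iff, mem_coboundaries_iff _ l hl] at h1
    exact h1
  surjective l m n hl hm z' hz' := by
    let z₀ : Cocycle K' L' m := Cocycle.mk z' n hm hz'
    obtain ⟨a, ha⟩ := (hΦ m).2 (CohomologyClass.toHom (.mk z₀))
    obtain ⟨c, rfl⟩ := (CohomologyClass.toHom_bijective K L m).2 a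
    obtain ⟨z, rfl⟩ := c.mk_surjective
    rw [← h] at ha
    have h1 := (CohomologyClass.toHom_bijective K' L' m).1 ha.symm
    rw [← sub_eq_zero, ← CohomologyClass.mk_sub, CohomologyClass.mk_eq_zero_iff,
      mem_coboundaries_iff _ l hl] at h1
    obtain ⟨w, hw⟩ := h1
    refine ⟨z.1, w, z.δ_eq_zero n, ?_⟩
    rw [hw, ← hψ]
    exact add_sub_cancel _ _

variable {K K' L L' : CochainComplex C ℤ}

theorem CohomologyBijective.comp_of_bijective (f : L ⟶ L')
    (hf : ∀ n : ℤ, Function.Bijective (fun g : (HomotopyCategory.quotient C (.up ℤ)).obj K ⟶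
      (HomotopyCategory.quotient C (.up ℤ)).obj (L⟦n⟧) =>
        g ≫ (HomotopyCategory.quotient C (.up ℤ)).map (f⟦n⟧'))) :
    CohomologyBijective (K := K) (K' := K)
      fun n z => Cochain.comp z (Cochain.ofHom f) (add_zero n) :=
  .of_toHom _ (fun n z => z.postcomp f) (fun n z => rfl)
    (fun n => Preadditive.rightComp _ ((HomotopyCategory.quotient C (.up ℤ)).map (f⟦n⟧')))
    (fun n z => by
      simp only [CohomologyClass.toHom_mk, Cocycle.equivHomShift_symm_postcomp, Functor.map_comp]
      rfl) hf

theorem CohomologyBijective.precomp_of_bijective (f : K ⟶ K')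
    (hf : ∀ n : ℤ, Function.Bijective (fun g : (HomotopyCategory.quotient C (.up ℤ)).obj K' ⟶
      (HomotopyCategory.quotient C (.up ℤ)).obj (L⟦n⟧) =>
        (HomotopyCategory.quotient C (.up ℤ)).map f ≫ g)) :
    CohomologyBijective (L := L) (L' := L)
      fun n z => Cochain.comp (Cochain.ofHom f) z (zero_add n) :=
  .of_toHom _ (fun n z => z.precomp f) (fun n z => rfl)
    (fun n => Preadditive.leftComp _ ((HomotopyCategory.quotient C (.up ℤ)).map f))
    (fun n z => by
      simp only [CohomologyClass.toHom_mk, Cocycle.equivHomShift_symm_precomp, Functor.map_comp]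
      rfl) hf

/-- Morphisms out of a K-projective complex are the same in the homotopy category and in the derived
category, and in the latter `f⟦n⟧'` is invertible. -/
theorem CohomologyBijective.comp_of_isKProjective [K.IsKProjective] (f : L ⟶ L') [QuasiIso f] :
    CohomologyBijective (K := K) (K' := K)
      fun n z => Cochain.comp z (Cochain.ofHom f) (add_zero n) :=
  .comp_of_bijective f fun n => by
    let := HasDerivedCategory.standard C
    have h1 : IsIso (DerivedCategory.Qh.map
        ((HomotopyCategory.quotient C (.up ℤ)).map (f⟦n⟧'))) := by
      have : QuasiIso (f⟦n⟧') := by infer_instance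
      have : IsIso (DerivedCategory.Q.map (f⟦n⟧')) := inferInstance
      exact this
    rw [← Function.Bijective.of_comp_iff'
      (IsKProjective.Qh_map_bijective K ((HomotopyCategory.quotient C (.up ℤ)).obj (L'⟦n⟧)))]
    convert (((asIso (DerivedCategory.Qh.map
        ((HomotopyCategory.quotient C (.up ℤ)).map (f⟦n⟧')))).homToEquiv).bijective).comp
      (IsKProjective.Qh_map_bijective K ((HomotopyCategory.quotient C (.up ℤ)).obj (L⟦n⟧)))
      using 1
    ext g
    simp

theorem CohomologyBijective.precomp_of_isKInjective [L.IsKInjective] (f : K ⟶ K') [QuasiIso f] :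
    CohomologyBijective (L := L) (L' := L)
      fun n z => Cochain.comp (Cochain.ofHom f) z (zero_add n) :=
  .precomp_of_bijective f fun n => by
    let := HasDerivedCategory.standard C
    have h1 : IsIso (DerivedCategory.Qh.map ((HomotopyCategory.quotient C (.up ℤ)).map f)) := by
      have : IsIso (DerivedCategory.Q.map f) := inferInstance
      exact this
    rw [← Function.Bijective.of_comp_iff'
      (IsKInjective.Qh_map_bijective ((HomotopyCategory.quotient C (.up ℤ)).obj K) (L⟦n⟧))]
    convert (((asIso (DerivedCategory.Qh.map
        ((HomotopyCategory.quotient C (.up ℤ)).map f))).symm.homFromEquiv).bijective).comp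
      (IsKInjective.Qh_map_bijective ((HomotopyCategory.quotient C (.up ℤ)).obj K') (L⟦n⟧))
      using 1
    ext g
    simp

theorem CohomologyBijective.precomp_of_homotopyEquivalence (f : K ⟶ K')
    (hf : HomologicalComplex.homotopyEquivalences C (.up ℤ) f) :
    CohomologyBijective (L := L) (L' := L)
      fun n z => Cochain.comp (Cochain.ofHom f) z (zero_add n) :=
  .precomp_of_bijective f fun n => by
    rw [← HomotopyCategory.inverseImage_quotient_isomorphisms,
      MorphismProperty.inverseImage_iff, MorphismProperty.isomorphisms.iff] at hf
    convert ((asIso ((HomotopyCategory.quotient C (.up ℤ)).map f)).symm.homFromEquiv).bijective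
    simp

/-- A quasi-isomorphism between K-projective complexes is a homotopy equivalence, so nothing is
asked of the target `L`. -/
theorem CohomologyBijective.precomp_of_isKProjective [K.IsKProjective] [K'.IsKProjective]
    (f : K ⟶ K') [QuasiIso f] :
    CohomologyBijective (L := L) (L' := L)
      fun n z => Cochain.comp (Cochain.ofHom f) z (zero_add n) :=
  .precomp_of_homotopyEquivalence f ((IsKProjective.quasiIso_iff f).1 inferInstance)

theorem CohomologyBijective.comp_of_isKInjective [L.IsKInjective] [L'.IsKInjective]
    (f : L ⟶ L') [QuasiIso f] :
    CohomologyBijective (K := K) (K' := K)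
      fun n z => Cochain.comp z (Cochain.ofHom f) (add_zero n) :=
  .comp_of_bijective f fun n => by
    have hf : HomologicalComplex.homotopyEquivalences C (.up ℤ) (f⟦n⟧') :=
      (IsKInjective.quasiIso_iff _).1 inferInstance
    rw [← HomotopyCategory.inverseImage_quotient_isomorphisms,
      MorphismProperty.inverseImage_iff, MorphismProperty.isomorphisms.iff] at hf
    convert ((asIso ((HomotopyCategory.quotient C (.up ℤ)).map (f⟦n⟧'))).homToEquiv).bijective
    simp

/-- The class of `z` is a morphism from a K-projective complex to a shift of an acyclic one, hence
zero. -/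
theorem exists_cochain_of_isKProjective [K.IsKProjective] (hL : L.Acyclic) {l m n : ℤ}
    (hl : l + 1 = m) (hm : m + 1 = n) (z : Cochain K L m) (hz : δ m n z = 0) :
    ∃ w : Cochain K L l, δ l m w = z := by
  let z₀ : Cocycle K L m := Cocycle.mk z n hm hz
  have h1 : CohomologyClass.toHom (.mk z₀) = 0 := by
    refine IsKProjective.leftOrthogonal K _ ?_
    exact ObjectProperty.prop_of_iso _
      (((HomotopyCategory.quotient C (.up ℤ)).commShiftIso m).symm.app L)
      ((HomotopyCategory.subcategoryAcyclic C).le_shift m _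
        ((HomotopyCategory.quotient_obj_mem_subcategoryAcyclic_iff_acyclic L).2 hL))
  rw [CohomologyClass.toHom_mk_eq_zero_iff, mem_coboundaries_iff _ l hl] at h1
  exact h1

/-- A morphism in the derived category out of a K-projective complex is represented by a
morphism of complexes. -/
theorem exists_quasiIso_of_isKProjective [HasDerivedCategory C] [K.IsKProjective]
    (e : DerivedCategory.Q.obj K ≅ DerivedCategory.Q.obj L) : ∃ f : K ⟶ L, QuasiIso f := by
  obtain ⟨g, hg⟩ := (IsKProjective.Qh_map_bijective K
    ((HomotopyCategory.quotient C (.up ℤ)).obj L)).2 e.hom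
  obtain ⟨f, rfl⟩ := (HomotopyCategory.quotient C (.up ℤ)).map_surjective g
  refine ⟨f, ?_⟩
  rw [← DerivedCategory.isIso_Q_map_iff_quasiIso]
  have : DerivedCategory.Q.map f = e.hom := hg
  rw [this]
  infer_instance

/-- A morphism in the derived category into a K-injective complex is represented by a
morphism of complexes. -/
theorem exists_quasiIso_of_isKInjective [HasDerivedCategory C] [L.IsKInjective]
    (e : DerivedCategory.Q.obj K ≅ DerivedCategory.Q.obj L) : ∃ f : K ⟶ L, QuasiIso f := by
  obtain ⟨g, hg⟩ := (IsKInjective.Qh_map_bijective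
    ((HomotopyCategory.quotient C (.up ℤ)).obj K) L).2 e.hom
  obtain ⟨f, rfl⟩ := (HomotopyCategory.quotient C (.up ℤ)).map_surjective g
  refine ⟨f, ?_⟩
  rw [← DerivedCategory.isIso_Q_map_iff_quasiIso]
  have : DerivedCategory.Q.map f = e.hom := hg
  rw [this]
  infer_instance

end CochainLemmas

/-! ### Functoriality of the Hom complex over one ring -/

section HomFunctoriality

variable {R : Type u} [CommRing R]

/-- Functoriality of `Hom_R(P, -)`. -/
def homMap (P : Cplx R) {Y Y' : Cplx R} (f : Y ⟶ Y') : homCplx P Y ⟶ homCplx P Y' where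
  f n := ModuleCat.ofHom
    { toFun := fun z : Cochain P Y n => (z.comp (Cochain.ofHom f) (add_zero n) : Cochain P Y' n)
      map_add' := fun z w => Cochain.add_comp z w _ _
      map_smul' := fun r z => Cochain.smul_comp r z _ _ }
  comm' n m _ := ModuleCat.hom_ext (LinearMap.ext fun z => δ_comp_ofHom z f m)

/-- Functoriality of `Hom_R(-, Y)`. -/
def homPremap {P P' : Cplx R} (h : P ⟶ P') (Y : Cplx R) : homCplx P' Y ⟶ homCplx P Y where
  f n := ModuleCat.ofHom
    { toFun := fun z : Cochain P' Y n => ((Cochain.ofHom h).comp z (zero_add n) : Cochain P Y n)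
      map_add' := fun z w => Cochain.comp_add _ z w _
      map_smul' := fun r z => Cochain.comp_smul _ r z _ }
  comm' n m _ := ModuleCat.hom_ext (LinearMap.ext fun z => δ_ofHom_comp h z m)

theorem CohomologyBijective.quasiIso_of_homCplx {P Y P' Y' : Cplx R}
    (f : homCplx P Y ⟶ homCplx P' Y') {φ : ∀ n, Cochain P Y n → Cochain P' Y' n}
    (h : CohomologyBijective φ) (hφ : ∀ n (z : Cochain P Y n), (f.f n).hom z = φ n z) :
    QuasiIso f :=
  quasiIso_of_forall f
    (fun l m n hl hm x hx ⟨y, hy⟩ => h.injective l m n hl hm x hx y (hy.trans (hφ m x)))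
    (fun l m n hl hm x' hx' => by
      obtain ⟨z, w, hz, hw⟩ := h.surjective l m n hl hm x' hx'
      refine ⟨z, w, hz, ?_⟩
      rw [← hw, ← hφ]
      rfl)

theorem quasiIso_homMap (P : Cplx R) [P.IsKProjective] {Y Y' : Cplx R} (f : Y ⟶ Y') [QuasiIso f] :
    QuasiIso (homMap P f) :=
  (CohomologyBijective.comp_of_isKProjective f).quasiIso_of_homCplx _ fun _ _ => rfl

theorem quasiIso_homPremap {P P' : Cplx R} [P.IsKProjective] [P'.IsKProjective] (h : P ⟶ P')
    [QuasiIso h] (Y : Cplx R) : QuasiIso (homPremap h Y) :=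
  (CohomologyBijective.precomp_of_isKProjective h).quasiIso_of_homCplx _ fun _ _ => rfl

end HomFunctoriality

/-! ### Functoriality of Hom complexes between complexes over two rings -/

section RelativeHomFunctoriality

variable {R S : Type u} [CommRing R] [CommRing S] [Algebra R S]

variable (R) in
/-- Restriction of scalars of a morphism of complexes. -/
abbrev resMap {A A' : Cplx S} (f : A ⟶ A') : resCplx R A ⟶ resCplx R A' :=
  ((ModuleCat.restrictScalars.{u} (algebraMap R S)).mapHomologicalComplex _).map f

/-- The elementwise criterion does not mention scalars, so its two halves carry over verbatim from
`S` to `R`. -/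
instance quasiIso_resMap {A A' : Cplx S} (f : A ⟶ A') [h : QuasiIso f] : QuasiIso (resMap R f) :=
  quasiIso_of_forall _
    (fun _ m _ hl hm => ((quasiIsoAt_iff_forall f hl hm).1 (h.quasiIsoAt m)).1)
    (fun _ m _ hl hm => ((quasiIsoAt_iff_forall f hl hm).1 (h.quasiIsoAt m)).2)

theorem resMap_scalar {A A' : Cplx S} (f : A ⟶ A') (s : S) :
    scalar R A s ≫ resMap R f = resMap R f ≫ scalar R A' s := by
  rw [scalar, scalar, ← Functor.map_comp, ← Functor.map_comp]
  simp

/-- Functoriality of `Hom_R(Q, -)` on complexes of `S`-modules. -/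
def homToMap (Q : Cplx R) {A A' : Cplx S} (f : A ⟶ A') : homToCplx Q A ⟶ homToCplx Q A' where
  f n := ModuleCat.ofHom
    { toFun := fun z : Cochain Q (resCplx R A) n =>
        (z.comp (Cochain.ofHom (resMap R f)) (add_zero n) : Cochain Q (resCplx R A') n)
      map_add' := fun z w => Cochain.add_comp (n₁ := n) z w _ _
      map_smul' := fun s z => by
        change Cochain Q (resCplx R A) n at z
        change ((z.comp (Cochain.ofHom (scalar R A s)) (add_zero n)).comp
          (Cochain.ofHom (resMap R f)) (add_zero n)) =
          ((z.comp (Cochain.ofHom (resMap R f)) (add_zero n)).comp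
            (Cochain.ofHom (scalar R A' s)) (add_zero n))
        rw [Cochain.comp_assoc_of_third_is_zero_cochain, ← Cochain.ofHom_comp, resMap_scalar,
          Cochain.comp_assoc_of_third_is_zero_cochain, Cochain.ofHom_comp] }
  comm' n m _ := ModuleCat.hom_ext (LinearMap.ext fun z =>
    δ_comp_ofHom (n := n) z (resMap R f) m)

/-- Functoriality of `Hom_R(-, A)` on complexes of `R`-modules. -/
def homToPremap {Q Q' : Cplx R} (h : Q ⟶ Q') (A : Cplx S) :
    homToCplx Q' A ⟶ homToCplx Q A where
  f n := ModuleCat.ofHom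
    { toFun := fun z : Cochain Q' (resCplx R A) n =>
        ((Cochain.ofHom h).comp z (zero_add n) : Cochain Q (resCplx R A) n)
      map_add' := fun z w => Cochain.comp_add (n₂ := n) _ z w _
      map_smul' := fun s z =>
        (Cochain.comp_assoc_of_third_is_zero_cochain (n₂ := n) (Cochain.ofHom h) z _ _).symm }
  comm' n m _ := ModuleCat.hom_ext (LinearMap.ext fun z => δ_ofHom_comp (n := n) h z m)

/-- Functoriality of `Hom_R(A, -)` on complexes of `R`-modules. -/
def homFromMap (A : Cplx S) {J J' : Cplx R} (f : J ⟶ J') :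
    homFromCplx A J ⟶ homFromCplx A J' where
  f n := ModuleCat.ofHom
    { toFun := fun z : Cochain (resCplx R A) J n =>
        (z.comp (Cochain.ofHom f) (add_zero n) : Cochain (resCplx R A) J' n)
      map_add' := fun z w => Cochain.add_comp (n₁ := n) z w _ _
      map_smul' := fun s z =>
        Cochain.comp_assoc_of_first_is_zero_cochain (n₂ := n) _ z (Cochain.ofHom f) _ }
  comm' n m _ := ModuleCat.hom_ext (LinearMap.ext fun z => δ_comp_ofHom (n := n) z f m)

/-- Functoriality of `Hom_R(-, J)` on complexes of `S`-modules. -/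
def homFromPremap {A A' : Cplx S} (f : A ⟶ A') (J : Cplx R) :
    homFromCplx A' J ⟶ homFromCplx A J where
  f n := ModuleCat.ofHom
    { toFun := fun z : Cochain (resCplx R A') J n =>
        ((Cochain.ofHom (resMap R f)).comp z (zero_add n) : Cochain (resCplx R A) J n)
      map_add' := fun z w => Cochain.comp_add (n₂ := n) _ z w _
      map_smul' := fun s z => by
        change Cochain (resCplx R A') J n at z
        change (Cochain.ofHom (resMap R f)).comp
          ((Cochain.ofHom (scalar R A' s)).comp z (zero_add n)) (zero_add n) =
          (Cochain.ofHom (scalar R A s)).comp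
            ((Cochain.ofHom (resMap R f)).comp z (zero_add n)) (zero_add n)
        rw [← Cochain.comp_assoc_of_first_is_zero_cochain, ← Cochain.ofHom_comp, ← resMap_scalar,
          ← Cochain.comp_assoc_of_first_is_zero_cochain, Cochain.ofHom_comp] }
  comm' n m _ := ModuleCat.hom_ext (LinearMap.ext fun z =>
    δ_ofHom_comp (n := n) (resMap R f) z m)

theorem quasiIso_homToMap (Q : Cplx R) [Q.IsKProjective] {A A' : Cplx S} (f : A ⟶ A')
    [QuasiIso f] : QuasiIso (homToMap Q f) :=
  have h := CohomologyBijective.comp_of_isKProjective (K := Q) (resMap R f)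
  quasiIso_of_forall _
    (fun l m n hl hm x hx ⟨y, hy⟩ => h.injective l m n hl hm x hx y hy) h.surjective

theorem quasiIso_homToPremap {Q Q' : Cplx R} [Q.IsKProjective] [Q'.IsKProjective] (h : Q ⟶ Q')
    [QuasiIso h] (A : Cplx S) : QuasiIso (homToPremap h A) :=
  have h := CohomologyBijective.precomp_of_isKProjective (L := resCplx R A) h
  quasiIso_of_forall _
    (fun l m n hl hm x hx ⟨y, hy⟩ => h.injective l m n hl hm x hx y hy) h.surjective

/-- The source `A` is arbitrary, so both targets must be K-injective: `f` is then a homotopy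
equivalence. -/
theorem quasiIso_homFromMap (A : Cplx S) {J J' : Cplx R} [J.IsKInjective] [J'.IsKInjective]
    (f : J ⟶ J') [QuasiIso f] : QuasiIso (homFromMap A f) :=
  have h := CohomologyBijective.comp_of_isKInjective (K := resCplx R A) f
  quasiIso_of_forall _
    (fun l m n hl hm x hx ⟨y, hy⟩ => h.injective l m n hl hm x hx y hy) h.surjective

theorem quasiIso_homFromPremap {A A' : Cplx S} (f : A ⟶ A') [QuasiIso f] (J : Cplx R)
    [J.IsKInjective] : QuasiIso (homFromPremap f J) :=
  have h := CohomologyBijective.precomp_of_isKInjective (L := J) (resMap R f)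
  quasiIso_of_forall _
    (fun l m n hl hm x hx ⟨y, hy⟩ => h.injective l m n hl hm x hx y hy) h.surjective

end RelativeHomFunctoriality

/-! ### Elements of Hom complexes -/

section HomElements

variable {R : Type u} [CommRing R] {P Y : Cplx R} {n : ℤ}

/-- The components of an element of `Hom_R(P, Y)`. -/
def homEval (z : (homCplx P Y).X n) (p q : ℤ) (h : p + n = q) : P.X p →ₗ[R] Y.X q :=
  (Cochain.v (show Cochain P Y n from z) p q h).hom

/-- The element of `Hom_R(P, Y)` with given components. -/
def homMk (f : ∀ p q : ℤ, p + n = q → P.X p →ₗ[R] Y.X q) : (homCplx P Y).X n :=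
  Cochain.mk fun p q h => ModuleCat.ofHom (f p q h)

@[simp]
theorem homEval_homMk (f : ∀ p q : ℤ, p + n = q → P.X p →ₗ[R] Y.X q) (p q : ℤ) (h : p + n = q) :
    homEval (homMk f) p q h = f p q h := by
  simp [homEval, homMk]

theorem hom_ext {z w : (homCplx P Y).X n}
    (h : ∀ p q h x, homEval z p q h x = homEval w p q h x) : z = w :=
  Cochain.ext (show Cochain P Y n from z) w fun p q hpq =>
    ModuleCat.hom_ext (LinearMap.ext (h p q hpq))

@[simp]
theorem homEval_zero (p q : ℤ) (h : p + n = q) : homEval (0 : (homCplx P Y).X n) p q h = 0 := rfl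

@[simp]
theorem homEval_add (z w : (homCplx P Y).X n) (p q : ℤ) (h : p + n = q) (x : P.X p) :
    homEval (z + w) p q h x = homEval z p q h x + homEval w p q h x := rfl

@[simp]
theorem homEval_smul (r : R) (z : (homCplx P Y).X n) (p q : ℤ) (h : p + n = q) (x : P.X p) :
    homEval (r • z) p q h x = r • homEval z p q h x := rfl

@[simp]
theorem homEval_units_smul (e : ℤˣ) (z : (homCplx P Y).X n) (p q : ℤ) (h : p + n = q)
    (x : P.X p) : homEval (e • z) p q h x = e • homEval z p q h x := by
  obtain rfl | rfl := Int.units_eq_one_or e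
  · rw [one_smul, one_smul]
  · rw [Units.neg_smul, Units.neg_smul, one_smul, one_smul]
    rfl

/-- The sign is `(-1)^(n+1)`, as in `δ`. All degrees are free variables tied by equations, so that
the formula rewrites without transport between equal degrees. -/
theorem homEval_d {m : ℤ} (hm : n + 1 = m) (z : (homCplx P Y).X n) {p q p' q' : ℤ} (h : p + m = q)
    (hp : p + 1 = p') (hq : q' + 1 = q) (x : P.X p) :
    homEval ((homCplx P Y).d n m z) p q h x = Y.d q' q (homEval z p q' (by lia) x) +
      m.negOnePow • homEval z p' q (by lia) (P.d p p' x) := by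
  refine congr($(δ_v n m hm (show Cochain P Y n from z) p q h q' p' (by lia) hp).hom x).trans ?_
  simp [homEval]

@[simp]
theorem homEval_homMap {Y' : Cplx R} (f : Y ⟶ Y') (z : (homCplx P Y).X n) (p q : ℤ)
    (h : p + n = q) (x : P.X p) :
    homEval ((homMap P f).f n z) p q h x = f.f q (homEval z p q h x) :=
  congr($(Cochain.comp_zero_cochain_v (show Cochain P Y n from z) (Cochain.ofHom f) p q h).hom x).trans
    (by simp [homEval])

@[simp]
theorem homEval_homPremap {P' : Cplx R} (f : P' ⟶ P) (z : (homCplx P Y).X n) (p q : ℤ)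
    (h : p + n = q) (x : P'.X p) :
    homEval ((homPremap f Y).f n z) p q h x = homEval z p q h (f.f p x) :=
  congr($(Cochain.zero_cochain_comp_v (Cochain.ofHom f) (show Cochain P Y n from z) p q h).hom x).trans
    (by simp [homEval])

end HomElements

/-! ### Elements of relative Hom complexes -/

section RelativeHomElements

variable {R S : Type u} [CommRing R] [CommRing S] [Algebra R S] {n : ℤ}

variable {Q : Cplx R} {A : Cplx S}

/-- The components of an element of `Hom_R(Q, A)`. -/
def homToEval (z : (homToCplx Q A).X n) (p q : ℤ) (h : p + n = q) : Q.X p →+ A.X q :=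
  (Cochain.v (show Cochain Q (resCplx R A) n from z) p q h).hom.toAddMonoidHom

/-- Source and target are modules over different rings, so components are bundled as additive maps
and `R`-linearity is recorded separately, through the structure map. -/
theorem homToEval_map_smul (z : (homToCplx Q A).X n) (p q : ℤ) (h : p + n = q) (r : R)
    (x : Q.X p) : homToEval z p q h (r • x) = algebraMap R S r • homToEval z p q h x :=
  (Cochain.v (show Cochain Q (resCplx R A) n from z) p q h).hom.map_smul r x

/-- A component of an element of `Hom_R(Q, A)`. -/
def homToComponent (f : ∀ p q : ℤ, p + n = q → Q.X p →+ A.X q)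
    (hf : ∀ p q h (r : R) x, f p q h (r • x) = algebraMap R S r • f p q h x) (p q : ℤ)
    (h : p + n = q) : Q.X p ⟶ (resCplx R A).X q :=
  ModuleCat.ofHom (Y := (ModuleCat.restrictScalars (algebraMap R S)).obj (A.X q))
    { toFun := fun x => f p q h x
      map_add' := (f p q h).map_add
      map_smul' := hf p q h }

/-- The element of `Hom_R(Q, A)` with given components. -/
def homToMk (f : ∀ p q : ℤ, p + n = q → Q.X p →+ A.X q)
    (hf : ∀ p q h (r : R) x, f p q h (r • x) = algebraMap R S r • f p q h x) :
    (homToCplx Q A).X n :=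
  Cochain.mk (homToComponent f hf)

@[simp]
theorem homToEval_homToMk (f : ∀ p q : ℤ, p + n = q → Q.X p →+ A.X q)
    (hf : ∀ p q h (r : R) x, f p q h (r • x) = algebraMap R S r • f p q h x) (p q : ℤ)
    (h : p + n = q) (x : Q.X p) : homToEval (homToMk f hf) p q h x = f p q h x :=
  congr(ModuleCat.Hom.hom $(Cochain.mk_v (homToComponent f hf) p q h) x)

theorem homTo_ext {z w : (homToCplx Q A).X n}
    (h : ∀ p q h x, homToEval z p q h x = homToEval w p q h x) : z = w :=
  Cochain.ext (show Cochain Q (resCplx R A) n from z) w fun p q hpq =>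
    ModuleCat.hom_ext (LinearMap.ext (h p q hpq))

@[simp]
theorem homToEval_zero (p q : ℤ) (h : p + n = q) (x : Q.X p) :
    homToEval (0 : (homToCplx Q A).X n) p q h x = 0 := rfl

@[simp]
theorem homToEval_add (z w : (homToCplx Q A).X n) (p q : ℤ) (h : p + n = q) (x : Q.X p) :
    homToEval (z + w) p q h x = homToEval z p q h x + homToEval w p q h x := rfl

@[simp]
theorem homToEval_smul (s : S) (z : (homToCplx Q A).X n) (p q : ℤ) (h : p + n = q) (x : Q.X p) :
    homToEval (s • z) p q h x = s • homToEval z p q h x :=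
  congr($(Cochain.comp_zero_cochain_v (show Cochain Q (resCplx R A) n from z)
    (Cochain.ofHom (scalar R A s)) p q h).hom x).trans
    (congr(ModuleCat.Hom.hom $(Cochain.ofHom_v (scalar R A s) q) _).trans rfl)

@[simp]
theorem homToEval_units_smul (e : ℤˣ) (z : (homToCplx Q A).X n) (p q : ℤ) (h : p + n = q)
    (x : Q.X p) : homToEval (e • z) p q h x = e • homToEval z p q h x := by
  obtain rfl | rfl := Int.units_eq_one_or e
  · rw [one_smul, one_smul]
  · rw [Units.neg_smul, Units.neg_smul, one_smul, one_smul]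
    rfl

theorem homToEval_d {m : ℤ} (hm : n + 1 = m) (z : (homToCplx Q A).X n) {p q p' q' : ℤ}
    (h : p + m = q) (hp : p + 1 = p') (hq : q' + 1 = q) (x : Q.X p) :
    homToEval ((homToCplx Q A).d n m z) p q h x = A.d q' q (homToEval z p q' (by lia) x) +
      m.negOnePow • homToEval z p' q (by lia) (Q.d p p' x) :=
  congr($(δ_v n m hm (show Cochain Q (resCplx R A) n from z) p q h q' p' (by lia) hp).hom x)

@[simp]
theorem homToEval_homToMap {A' : Cplx S} (f : A ⟶ A') (z : (homToCplx Q A).X n) (p q : ℤ)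
    (h : p + n = q) (x : Q.X p) :
    homToEval ((homToMap Q f).f n z) p q h x = f.f q (homToEval z p q h x) :=
  congr($(Cochain.comp_zero_cochain_v (show Cochain Q (resCplx R A) n from z)
    (Cochain.ofHom (resMap R f)) p q h).hom x).trans
    (congr(ModuleCat.Hom.hom $(Cochain.ofHom_v (resMap R f) q) _).trans rfl)

variable {J : Cplx R}

/-- The components of an element of `Hom_R(A, J)`. -/
def homFromEval (z : (homFromCplx A J).X n) (p q : ℤ) (h : p + n = q) : A.X p →+ J.X q :=
  (Cochain.v (show Cochain (resCplx R A) J n from z) p q h).hom.toAddMonoidHom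

theorem homFromEval_map_smul (z : (homFromCplx A J).X n) (p q : ℤ) (h : p + n = q) (r : R)
    (x : A.X p) : homFromEval z p q h (algebraMap R S r • x) = r • homFromEval z p q h x :=
  (Cochain.v (show Cochain (resCplx R A) J n from z) p q h).hom.map_smul r x

/-- A component of an element of `Hom_R(A, J)`. -/
def homFromComponent (f : ∀ p q : ℤ, p + n = q → A.X p →+ J.X q)
    (hf : ∀ p q h (r : R) x, f p q h (algebraMap R S r • x) = r • f p q h x) (p q : ℤ)
    (h : p + n = q) : (resCplx R A).X p ⟶ J.X q :=
  ModuleCat.ofHom (X := (ModuleCat.restrictScalars (algebraMap R S)).obj (A.X p))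
    { toFun := fun x => f p q h x
      map_add' := (f p q h).map_add
      map_smul' := hf p q h }

/-- The element of `Hom_R(A, J)` with given components. -/
def homFromMk (f : ∀ p q : ℤ, p + n = q → A.X p →+ J.X q)
    (hf : ∀ p q h (r : R) x, f p q h (algebraMap R S r • x) = r • f p q h x) :
    (homFromCplx A J).X n :=
  Cochain.mk (homFromComponent f hf)

@[simp]
theorem homFromEval_homFromMk (f : ∀ p q : ℤ, p + n = q → A.X p →+ J.X q)
    (hf : ∀ p q h (r : R) x, f p q h (algebraMap R S r • x) = r • f p q h x) (p q : ℤ)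
    (h : p + n = q) (x : A.X p) : homFromEval (homFromMk f hf) p q h x = f p q h x :=
  congr(ModuleCat.Hom.hom $(Cochain.mk_v (homFromComponent f hf) p q h) x)

theorem homFrom_ext {z w : (homFromCplx A J).X n}
    (h : ∀ p q h x, homFromEval z p q h x = homFromEval w p q h x) : z = w :=
  Cochain.ext (show Cochain (resCplx R A) J n from z) w fun p q hpq =>
    ModuleCat.hom_ext (LinearMap.ext (h p q hpq))

@[simp]
theorem homFromEval_zero (p q : ℤ) (h : p + n = q) (x : A.X p) :
    homFromEval (0 : (homFromCplx A J).X n) p q h x = 0 := rfl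

@[simp]
theorem homFromEval_add (z w : (homFromCplx A J).X n) (p q : ℤ) (h : p + n = q) (x : A.X p) :
    homFromEval (z + w) p q h x = homFromEval z p q h x + homFromEval w p q h x := rfl

@[simp]
theorem homFromEval_smul (s : S) (z : (homFromCplx A J).X n) (p q : ℤ) (h : p + n = q)
    (x : A.X p) : homFromEval (s • z) p q h x = homFromEval z p q h (s • x) :=
  congr($(Cochain.zero_cochain_comp_v (Cochain.ofHom (scalar R A s))
    (show Cochain (resCplx R A) J n from z) p q h).hom x).trans
    (congr((Cochain.v (show Cochain (resCplx R A) J n from z) p q h).hom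
      (ModuleCat.Hom.hom $(Cochain.ofHom_v (scalar R A s) p) x)))

@[simp]
theorem homFromEval_units_smul (e : ℤˣ) (z : (homFromCplx A J).X n) (p q : ℤ) (h : p + n = q)
    (x : A.X p) : homFromEval (e • z) p q h x = e • homFromEval z p q h x := by
  obtain rfl | rfl := Int.units_eq_one_or e
  · rw [one_smul, one_smul]
  · rw [Units.neg_smul, Units.neg_smul, one_smul, one_smul]
    rfl

theorem homFromEval_d {m : ℤ} (hm : n + 1 = m) (z : (homFromCplx A J).X n) {p q p' q' : ℤ}
    (h : p + m = q) (hp : p + 1 = p') (hq : q' + 1 = q) (x : A.X p) :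
    homFromEval ((homFromCplx A J).d n m z) p q h x = J.d q' q (homFromEval z p q' (by lia) x) +
      m.negOnePow • homFromEval z p' q (by lia) (A.d p p' x) :=
  congr($(δ_v n m hm (show Cochain (resCplx R A) J n from z) p q h q' p' (by lia) hp).hom x)

@[simp]
theorem homFromEval_homFromPremap {A' : Cplx S} (f : A' ⟶ A) (z : (homFromCplx A J).X n)
    (p q : ℤ) (h : p + n = q) (x : A'.X p) :
    homFromEval ((homFromPremap f J).f n z) p q h x = homFromEval z p q h (f.f p x) :=
  congr($(Cochain.zero_cochain_comp_v (Cochain.ofHom (resMap R f))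
    (show Cochain (resCplx R A) J n from z) p q h).hom x).trans
    (congr((Cochain.v (show Cochain (resCplx R A) J n from z) p q h).hom
      (ModuleCat.Hom.hom $(Cochain.ofHom_v (resMap R f) p) x)))

end RelativeHomElements

/-! ### Elements of the total complex of a bifunctor -/

section BifunctorElements

variable {S : Type u} [CommRing S] {C₁ C₂ : Type*} [Category* C₁] [Category* C₂]
  [Preadditive C₁] [Preadditive C₂] (F : C₁ ⥤ C₂ ⥤ ModuleCat.{u} S) [F.PreservesZeroMorphisms]
  [∀ X, (F.obj X).PreservesZeroMorphisms] (X : CochainComplex C₁ ℤ) (Y : CochainComplex C₂ ℤ)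
  [HomologicalComplex.HasMapBifunctor X Y F (ComplexShape.up ℤ)] (n : ℤ)

open HomologicalComplex DirectSum

/-- The decomposition of the total complex of a bifunctor as a direct sum. -/
def bifunctorToDirectSum : (mapBifunctor X Y F (ComplexShape.up ℤ)).X n →ₗ[S]
    ⨁ i : { i : ℤ × ℤ // i.1 + i.2 = n }, (F.obj (X.X i.1.1)).obj (Y.X i.1.2) :=
  (mapBifunctorDesc (A := ModuleCat.of S (⨁ i : { i : ℤ × ℤ // i.1 + i.2 = n },
      (F.obj (X.X i.1.1)).obj (Y.X i.1.2))) fun p q h =>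
    ModuleCat.ofHom (DirectSum.lof S { i : ℤ × ℤ // i.1 + i.2 = n }
      (fun i => (F.obj (X.X i.1.1)).obj (Y.X i.1.2)) ⟨(p, q), h⟩)).hom

/-- The universal property of the total complex only yields `S`-linear maps into modules of the same
universe. Passing through a direct sum gives additive maps into any commutative monoid. -/
theorem bifunctorToDirectSum_ι (p q : ℤ) (h : p + q = n) (x : (F.obj (X.X p)).obj (Y.X q)) :
    bifunctorToDirectSum F X Y n ((ιMapBifunctor X Y F (ComplexShape.up ℤ) p q n h).hom x) =
      DirectSum.of (fun i : { i : ℤ × ℤ // i.1 + i.2 = n } =>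
        (F.obj (X.X i.1.1)).obj (Y.X i.1.2)) ⟨(p, q), h⟩ x :=
  congr($(ι_mapBifunctorDesc (A := ModuleCat.of S (⨁ i : { i : ℤ × ℤ // i.1 + i.2 = n },
      (F.obj (X.X i.1.1)).obj (Y.X i.1.2))) (fun p q h =>
    ModuleCat.ofHom (DirectSum.lof S { i : ℤ × ℤ // i.1 + i.2 = n }
      (fun i => (F.obj (X.X i.1.1)).obj (Y.X i.1.2)) ⟨(p, q), h⟩)) p q h).hom x)

variable {F X Y n}

/-- The projection to the quotient by the sum `N` of the images of all summands vanishes on every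
summand, hence is zero, so `N` is everything. -/
theorem bifunctor_induction {p : (mapBifunctor X Y F (ComplexShape.up ℤ)).X n → Prop}
    (hι : ∀ i j h x, p ((ιMapBifunctor X Y F (ComplexShape.up ℤ) i j n h).hom x))
    (hadd : ∀ x y, p x → p y → p (x + y))
    (x : (mapBifunctor X Y F (ComplexShape.up ℤ)).X n) (h0 : p 0) : p x := by
  let N : Submodule S ((mapBifunctor X Y F (ComplexShape.up ℤ)).X n) :=
    ⨆ i : { i : ℤ × ℤ // i.1 + i.2 = n },
      LinearMap.range (ιMapBifunctor X Y F (ComplexShape.up ℤ) i.1.1 i.1.2 n i.2).hom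
  have hN : ModuleCat.ofHom N.mkQ = 0 := by
    refine mapBifunctor.hom_ext fun i j h => ModuleCat.hom_ext (LinearMap.ext fun x => ?_)
    change N.mkQ ((ιMapBifunctor X Y F (ComplexShape.up ℤ) i j n h).hom x) = 0
    rw [Submodule.mkQ_apply, Submodule.Quotient.mk_eq_zero]
    exact Submodule.mem_iSup_of_mem (p := fun i : { i : ℤ × ℤ // i.1 + i.2 = n } =>
      LinearMap.range (ιMapBifunctor X Y F (ComplexShape.up ℤ) i.1.1 i.1.2 n i.2).hom)
      ⟨(i, j), h⟩ ⟨x, rfl⟩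
  have hx : x ∈ N := by
    rw [← Submodule.Quotient.mk_eq_zero]
    exact congr($(hN).hom x)
  refine Submodule.iSup_induction _ (motive := p) hx ?_ h0 hadd
  rintro ⟨⟨i, j⟩, h⟩ _ ⟨x, rfl⟩
  exact hι i j h x

/-- An additive map out of the total complex of a bifunctor. -/
def bifunctorLift {M : Type*} [AddCommMonoid M]
    (f : ∀ p q : ℤ, p + q = n → ((F.obj (X.X p)).obj (Y.X q) →+ M)) :
    (mapBifunctor X Y F (ComplexShape.up ℤ)).X n →+ M :=
  (DirectSum.toAddMonoid fun i : { i : ℤ × ℤ // i.1 + i.2 = n } => f i.1.1 i.1.2 i.2).comp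
    (bifunctorToDirectSum F X Y n).toAddMonoidHom

theorem bifunctorLift_ι {M : Type*} [AddCommMonoid M]
    (f : ∀ p q : ℤ, p + q = n → ((F.obj (X.X p)).obj (Y.X q) →+ M)) (p q : ℤ) (h : p + q = n)
    (x : (F.obj (X.X p)).obj (Y.X q)) :
    bifunctorLift f ((ιMapBifunctor X Y F (ComplexShape.up ℤ) p q n h).hom x) = f p q h x := by
  refine (congr_arg (DirectSum.toAddMonoid fun i : { i : ℤ × ℤ // i.1 + i.2 = n } =>
    f i.1.1 i.1.2 i.2) (bifunctorToDirectSum_ι F X Y n p q h x)).trans ?_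
  exact DirectSum.toAddMonoid_of _ _ _

end BifunctorElements

/-! ### Elementary tensors in `X ⊗ P` -/

section TensorElements

open MonoidalCategory TensorProduct

variable {R : Type u} [CommRing R] {X P : Cplx R} {n : ℤ}

/-- The element `x ⊗ y` of `X ⊗_R P`. -/
def tmul {p q : ℤ} (h : p + q = n) (x : X.X p) (y : P.X q) : (tensorCplx X P).X n :=
  (HomologicalComplex.ιTensorObj X P p q n h).hom (x ⊗ₜ[R] y)

variable {p q : ℤ} (h : p + q = n)

theorem tmul_add (x : X.X p) (y y' : P.X q) : tmul h x (y + y') = tmul h x y + tmul h x y' := by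
  simp only [tmul, TensorProduct.tmul_add]
  exact map_add _ _ _

theorem add_tmul (x x' : X.X p) (y : P.X q) : tmul h (x + x') y = tmul h x y + tmul h x' y := by
  simp only [tmul, TensorProduct.add_tmul]
  exact map_add _ _ _

theorem smul_tmul_eq (r : R) (x : X.X p) (y : P.X q) : tmul h (r • x) y = r • tmul h x y := by
  simp only [tmul, ← TensorProduct.smul_tmul']
  exact map_smul _ _ _

theorem tmul_smul_eq (r : R) (x : X.X p) (y : P.X q) : tmul h x (r • y) = r • tmul h x y := by
  simp only [tmul, TensorProduct.tmul_smul]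
  exact map_smul _ _ _

variable (X P) in
/-- The bilinear map `(x, y) ↦ x ⊗ y`. -/
def tmulHom : X.X p →ₗ[R] P.X q →ₗ[R] (tensorCplx X P).X n :=
  LinearMap.mk₂ R (tmul h) (add_tmul h) (smul_tmul_eq h) (tmul_add h) (tmul_smul_eq h)

@[simp]
theorem tmulHom_apply (x : X.X p) (y : P.X q) : tmulHom X P h x y = tmul h x y := rfl

@[simp]
theorem tmul_zero (x : X.X p) : tmul h x (0 : P.X q) = 0 := map_zero (tmulHom X P h x)

@[simp]
theorem zero_tmul (y : P.X q) : tmul h (0 : X.X p) y = 0 := map_zero ((tmulHom X P h).flip y)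

theorem tmul_sum {ι : Type*} (s : Finset ι) (x : X.X p) (y : ι → P.X q) :
    tmul h x (∑ i ∈ s, y i) = ∑ i ∈ s, tmul h x (y i) := map_sum (tmulHom X P h x) _ _

theorem units_smul_tmul (e : ℤˣ) (x : X.X p) (y : P.X q) : tmul h (e • x) y = e • tmul h x y :=
  map_zsmul ((tmulHom X P h).flip y) _ x

theorem tmul_d {m p' q' : ℤ} (hp : p + 1 = p') (hq : q + 1 = q') (hm : n + 1 = m) (x : X.X p)
    (y : P.X q) : (tensorCplx X P).d n m (tmul h x y) =
      tmul (by lia) (X.d p p' x) y + p.negOnePow • tmul (by lia) x (P.d q q' y) := by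
  refine congr($(ι_tensorCplx_d X P p q n p' q' m h hp hq hm).hom (x ⊗ₜ[R] y)).trans ?_
  simp [tmul]

theorem tensor_induction {r : (tensorCplx X P).X n → Prop} (h0 : r 0)
    (ht : ∀ p q (h : p + q = n) (x : X.X p) (y : P.X q), r (tmul h x y))
    (hadd : ∀ x y, r x → r y → r (x + y)) (x : (tensorCplx X P).X n) : r x := by
  refine bifunctor_induction (fun i j h t => ?_) hadd x h0
  refine TensorProduct.induction_on (motive := fun t => r
    ((HomologicalComplex.ιTensorObj X P i j n h).hom t)) t ?_ (fun x y => ht i j h x y) ?_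
  · rw [map_zero]; exact h0
  · intro x y hx hy
    rw [map_add]
    exact hadd _ _ hx hy

/-- The additive map out of `X ⊗_R P` induced by balanced biadditive maps. -/
def tensorLift {M : Type*} [AddCommGroup M] (f : ∀ p q : ℤ, p + q = n → X.X p →+ P.X q →+ M)
    (hf : ∀ p q h (r : R) x y, f p q h (r • x) y = f p q h x (r • y)) :
    (tensorCplx X P).X n →+ M :=
  bifunctorLift fun p q h => TensorProduct.liftAddHom (f p q h) (hf p q h)

@[simp]
theorem tensorLift_tmul {M : Type*} [AddCommGroup M]
    (f : ∀ p q : ℤ, p + q = n → X.X p →+ P.X q →+ M)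
    (hf : ∀ p q h (r : R) x y, f p q h (r • x) y = f p q h x (r • y)) (x : X.X p) (y : P.X q) :
    tensorLift f hf (tmul h x y) = f p q h x y :=
  (bifunctorLift_ι _ p q h _).trans (TensorProduct.liftAddHom_tmul _ _ _ _)

/-- Functoriality of the tensor product of complexes. -/
abbrev tensorMap {X' P' : Cplx R} (f : X ⟶ X') (g : P ⟶ P') : tensorCplx X P ⟶ tensorCplx X' P' :=
  HomologicalComplex.mapBifunctorMap f g _ _

@[simp]
theorem tensorMap_tmul {X' P' : Cplx R} (f : X ⟶ X') (g : P ⟶ P') (x : X.X p) (y : P.X q) :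
    (tensorMap f g).f n (tmul h x y) = tmul h (f.f p x) (g.f q y) :=
  congr($(HomologicalComplex.ι_mapBifunctorMap f g (curriedTensor (ModuleCat.{u} R))
    (ComplexShape.up ℤ) p q n h).hom (x ⊗ₜ[R] y))

@[simp]
theorem homEval_unitMap (x : X.X n) (q m : ℤ) (h : q + n = m) (y : P.X q) :
    homEval ((unitMap P X).f n x) q m h y = tmul (by lia) x y := by
  change (ModuleCat.Hom.hom (Cochain.v (unitLinear P X n x) q m h)) y = _
  simp [unitLinear, tmul]

@[simp]
theorem counitMap_tmul {Y : Cplx R} (z : (homCplx P Y).X p) (y : P.X q) :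
    (counitMap P Y).f n (tmul h z y) = homEval z q n (by lia) y :=
  congr(ModuleCat.Hom.hom $(HomologicalComplex.ι_mapBifunctorDesc (K₁ := homCplx P Y) (K₂ := P)
    (F := curriedTensor (ModuleCat.{u} R)) (c := ComplexShape.up ℤ) (j := n) (A := Y.X n)
    (fun m p h => ModuleCat.ofHom (TensorProduct.lift
      { toFun := fun z : Cochain P Y m => (z.v p n (by have : m + p = n := h; lia)).hom
        map_add' := fun _ _ => rfl
        map_smul' := fun _ _ => rfl })) p q h) (z ⊗ₜ[R] y))

end TensorElements

/-! ### Elementary tensors in `A ⊗_R Q` -/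

section RelativeTensorElements

open TensorProduct

variable {R S : Type u} [CommRing R] [CommRing S] [Algebra R S] {A : Cplx S} {Q : Cplx R} {n : ℤ}

/-- The element `a ⊗ x` of `A ⊗_R Q`. -/
def relTmul {p q : ℤ} (h : p + q = n) (a : A.X p) (x : Q.X q) : (tensorRelCplx A Q).X n :=
  (HomologicalComplex.ιMapBifunctor A Q (tensorBifunctor (R := R)) (ComplexShape.up ℤ) p q n h).hom
    (TensorProduct.tmul R (M := (ModuleCat.restrictScalars (algebraMap R S)).obj (A.X p)) a x)

variable {p q : ℤ} (h : p + q = n)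

theorem relTmul_add (a : A.X p) (x x' : Q.X q) :
    relTmul h a (x + x') = relTmul h a x + relTmul h a x' :=
  (congr_arg _ (TensorProduct.tmul_add
    (M := (ModuleCat.restrictScalars (algebraMap R S)).obj (A.X p)) a x x')).trans
    (map_add (HomologicalComplex.ιMapBifunctor A Q (tensorBifunctor (R := R))
    (ComplexShape.up ℤ) p q n h).hom _ _)

theorem add_relTmul (a a' : A.X p) (x : Q.X q) :
    relTmul h (a + a') x = relTmul h a x + relTmul h a' x :=
  (congr_arg _ (TensorProduct.add_tmul
    (M := (ModuleCat.restrictScalars (algebraMap R S)).obj (A.X p)) a a' x)).trans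
    (map_add (HomologicalComplex.ιMapBifunctor A Q (tensorBifunctor (R := R))
    (ComplexShape.up ℤ) p q n h).hom _ _)

@[simp]
theorem relTmul_zero (a : A.X p) : relTmul h a (0 : Q.X q) = 0 :=
  map_zero (AddMonoidHom.mk' (relTmul h a) (relTmul_add h a))

@[simp]
theorem zero_relTmul (x : Q.X q) : relTmul h (0 : A.X p) x = 0 :=
  map_zero (AddMonoidHom.mk' (fun a => relTmul h a x) fun a a' => add_relTmul h a a' x)

theorem smul_relTmul (s : S) (a : A.X p) (x : Q.X q) :
    relTmul h (s • a) x = s • relTmul h a x :=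
  (map_smul (HomologicalComplex.ιMapBifunctor A Q (tensorBifunctor (R := R))
    (ComplexShape.up ℤ) p q n h).hom s
      (TensorProduct.tmul R (M := (ModuleCat.restrictScalars (algebraMap R S)).obj (A.X p)) a x))

theorem relTmul_smul (r : R) (a : A.X p) (x : Q.X q) :
    relTmul h a (r • x) = algebraMap R S r • relTmul h a x := by
  rw [← smul_relTmul]
  exact congr_arg _ (TensorProduct.smul_tmul (R := R)
    (M := (ModuleCat.restrictScalars (algebraMap R S)).obj (A.X p)) r a x).symm

theorem relTmul_d {m p' q' : ℤ} (hp : p + 1 = p') (hq : q + 1 = q') (hm : n + 1 = m) (a : A.X p)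
    (x : Q.X q) : (tensorRelCplx A Q).d n m (relTmul h a x) =
      relTmul (by lia) (A.d p p' a) x + p.negOnePow • relTmul (by lia) a (Q.d q q' x) := by
  have h1 : HomologicalComplex.ιMapBifunctor A Q (tensorBifunctor (R := R))
        (ComplexShape.up ℤ) p q n h ≫ (tensorRelCplx A Q).d n m =
      ((tensorBifunctor (R := R)).map (A.d p p')).app (Q.X q) ≫
          HomologicalComplex.ιMapBifunctor A Q tensorBifunctor (ComplexShape.up ℤ) p' q m
            (show p' + q = m by lia) +
        p.negOnePow • (((tensorBifunctor (R := R)).obj (A.X p)).map (Q.d q q') ≫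
          HomologicalComplex.ιMapBifunctor A Q tensorBifunctor (ComplexShape.up ℤ) p q' m
            (show p + q' = m by lia)) := by
    rw [HomologicalComplex.mapBifunctor.d_eq, Preadditive.comp_add,
      HomologicalComplex.mapBifunctor.ι_D₁, HomologicalComplex.mapBifunctor.ι_D₂,
      HomologicalComplex.mapBifunctor.d₁_eq _ _ _ _ (show (ComplexShape.up ℤ).Rel p p' from hp) _ _
        (show p' + q = m by lia),
      HomologicalComplex.mapBifunctor.d₂_eq _ _ _ _ _ (show (ComplexShape.up ℤ).Rel q q' from hq) _
        (show p + q' = m by lia)]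
    simp [ComplexShape.ε₁_def, ComplexShape.ε₂_def]
  exact congr($(h1).hom (TensorProduct.tmul R
    (M := (ModuleCat.restrictScalars (algebraMap R S)).obj (A.X p)) a x))

theorem relTensor_induction {r : (tensorRelCplx A Q).X n → Prop} (h0 : r 0)
    (ht : ∀ p q (h : p + q = n) (a : A.X p) (x : Q.X q), r (relTmul h a x))
    (hadd : ∀ x y, r x → r y → r (x + y)) (x : (tensorRelCplx A Q).X n) : r x := by
  refine bifunctor_induction (fun i j h t => ?_) hadd x h0
  refine TensorProduct.induction_on (motive := fun t => r
    ((HomologicalComplex.ιMapBifunctor A Q (tensorBifunctor (R := R))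
      (ComplexShape.up ℤ) i j n h).hom t)) t ?_ (fun x y => ht i j h x y) ?_
  · exact (map_zero (HomologicalComplex.ιMapBifunctor A Q (tensorBifunctor (R := R))
      (ComplexShape.up ℤ) i j n h).hom).symm ▸ h0
  · intro x y hx hy
    exact (map_add (HomologicalComplex.ιMapBifunctor A Q (tensorBifunctor (R := R))
      (ComplexShape.up ℤ) i j n h).hom x y).symm ▸ hadd _ _ hx hy

/-- The additive map out of `A ⊗_R Q` induced by balanced biadditive maps. -/
def relTensorLift {M : Type*} [AddCommGroup M]
    (f : ∀ p q : ℤ, p + q = n → A.X p →+ Q.X q →+ M)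
    (hf : ∀ p q h (r : R) a x, f p q h (algebraMap R S r • a) x = f p q h a (r • x)) :
    (tensorRelCplx A Q).X n →+ M :=
  bifunctorLift fun p q h => TensorProduct.liftAddHom
    (M := (ModuleCat.restrictScalars (algebraMap R S)).obj (A.X p)) (f p q h) (hf p q h)

@[simp]
theorem relTensorLift_relTmul {M : Type*} [AddCommGroup M]
    (f : ∀ p q : ℤ, p + q = n → A.X p →+ Q.X q →+ M)
    (hf : ∀ p q h (r : R) a x, f p q h (algebraMap R S r • a) x = f p q h a (r • x))
    (a : A.X p) (x : Q.X q) : relTensorLift f hf (relTmul h a x) = f p q h a x :=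
  (bifunctorLift_ι _ p q h _).trans (TensorProduct.liftAddHom_tmul
    (M := (ModuleCat.restrictScalars (algebraMap R S)).obj (A.X p)) _ _ _ _)

end RelativeTensorElements

/-! ### Signs -/

section Signs

theorem map_units_zsmul {F M N : Type*} [AddCommGroup M] [AddCommGroup N] [FunLike F M N]
    [AddMonoidHomClass F M N] (f : F) (e : ℤˣ) (x : M) : f (e • x) = e • f x :=
  map_zsmul f (e : ℤ) x

/-- Once the factors of a product of signs are sorted by commutativity, equal ones are adjacent;
this cancels such a pair inside a longer product. -/
theorem negOnePow_mul_cancel_left (n : ℤ) (e : ℤˣ) : n.negOnePow * (n.negOnePow * e) = e := by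
  rw [← mul_assoc, Int.units_mul_self, one_mul]

end Signs

/-! ### Tensor-Hom adjunction and Hom evaluation -/

section Adjunctions

variable {R S : Type u} [CommRing R] [CommRing S] [Algebra R S] {n : ℤ}

section TensorHomFrom

variable (X P : Cplx S) (J : Cplx R)

variable {X P J} in
/-- The image of `z` under `Hom_R(X ⊗_S P, J) → Hom_S(P, Hom_R(X, J))`. -/
def curryElt (z : (homFromCplx (tensorCplx X P) J).X n) : (homCplx P (homFromCplx X J)).X n :=
  homMk fun q m hm =>
    { toFun := fun y => homFromMk
        (fun p r hr =>
          { toFun := fun x => (p * q).negOnePow •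
              homFromEval z (p + q) r (by lia) (tmul rfl x y)
            map_zero' := by simp
            map_add' := fun x x' => by simp [add_tmul] })
        (fun p r hr s x => by
          simpa [smul_tmul_eq, homFromEval_map_smul] using smul_comm _ _ _)
      map_add' := fun y y' => homFrom_ext fun p r hr x => by simp [tmul_add]
      map_smul' := fun s y => homFrom_ext fun p r hr x => by
        simp [smul_tmul_eq, tmul_smul_eq] }

/-- The degree `t` is a variable with an equation, so the formula applies to whichever expression
for the degree a differential has produced. -/
theorem curryElt_eval (z : (homFromCplx (tensorCplx X P) J).X n) {p q m r t : ℤ} (hm : q + n = m)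
    (hr : p + m = r) (ht : p + q = t) (x : X.X p) (y : P.X q) :
    homFromEval (homEval (curryElt z) q m hm y) p r hr x =
      (p * q).negOnePow • homFromEval z t r (by lia) (tmul ht x y) := by
  subst ht
  simp [curryElt]

/-- `curryElt` as a linear map. -/
def curryLinear (n : ℤ) :
    (homFromCplx (tensorCplx X P) J).X n →ₗ[S] (homCplx P (homFromCplx X J)).X n where
  toFun := curryElt
  map_add' z w := hom_ext fun q m hm y => homFrom_ext fun p r hr x => by
    simp [curryElt_eval _ _ _ _ hm hr rfl]
  map_smul' s z := hom_ext fun q m hm y => homFrom_ext fun p r hr x => by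
    simp [curryElt_eval _ _ _ _ hm hr rfl, smul_tmul_eq]

/-- The adjunction isomorphism `Hom_R(X ⊗_S P, J) → Hom_S(P, Hom_R(X, J))`,
`z ↦ (y ↦ (x ↦ (-1)^{|x||y|} z(x ⊗ y)))`. -/
def curryMap : homFromCplx (tensorCplx X P) J ⟶ homCplx P (homFromCplx X J) where
  f n := ModuleCat.ofHom (curryLinear X P J n)
  comm' n m hnm := by
    obtain rfl : n + 1 = m := hnm
    refine ModuleCat.hom_ext (LinearMap.ext fun z => hom_ext fun q m hm y =>
      homFrom_ext fun p r hr x => ?_)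
    change homFromEval (homEval ((homCplx P (homFromCplx X J)).d n (n + 1) (curryElt z)) q m hm y)
      p r hr x = homFromEval (homEval (curryElt ((homFromCplx (tensorCplx X P) J).d n (n + 1) z))
        q m hm y) p r hr x
    -- Both sides expand into the three terms `d(z(x ⊗ y))`, `z(dx ⊗ y)` and `z(x ⊗ dy)`; only their
    -- signs remain to be compared.
    rw [curryElt_eval X P J _ hm hr rfl x y,
      homFromEval_d rfl z (by lia) (p' := p + q + 1) rfl (sub_add_cancel r 1),
      tmul_d rfl (p' := p + 1) (q' := q + 1) rfl rfl rfl,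
      homEval_d rfl _ hm (p' := q + 1) (q' := q + n) rfl (by lia), homFromEval_add,
      homFromEval_d (n := q + n) (by lia) _ hr (p' := p + 1) rfl (sub_add_cancel r 1),
      curryElt_eval X P J z rfl _ rfl,
      curryElt_eval X P J z rfl _ (show p + 1 + q = p + q + 1 by lia)]
    subst hm
    simp only [map_add, map_units_zsmul, homFromEval_units_smul,
      curryElt_eval X P J z _ _ (show p + (q + 1) = p + q + 1 by lia)]
    -- Signs of sums are split into products, the factors sorted, and squares cancelled.
    simp only [smul_add, smul_smul, Int.negOnePow_add, add_mul, mul_add, one_mul, mul_one, mul_comm,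
      mul_left_comm, mul_assoc, Int.units_mul_self, negOnePow_mul_cancel_left]
    abel

@[simp]
theorem curryMap_eval (z : (homFromCplx (tensorCplx X P) J).X n) {p q m r : ℤ} (hm : q + n = m)
    (hr : p + m = r) (x : X.X p) (y : P.X q) :
    homFromEval (homEval ((curryMap X P J).f n z) q m hm y) p r hr x =
      (p * q).negOnePow • homFromEval z (p + q) r (by lia) (tmul rfl x y) :=
  curryElt_eval X P J z hm hr rfl x y

variable {X P J} in
/-- The biadditive map `(x, y) ↦ (-1)^{|x||y|} w(y)(x)`. -/
def uncurryHom (w : (homCplx P (homFromCplx X J)).X n) {t r : ℤ} (hr : t + n = r) {p q : ℤ}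
    (h : p + q = t) : X.X p →+ P.X q →+ J.X r where
  toFun x :=
    { toFun := fun y => (p * q).negOnePow • homFromEval (homEval w q (q + n) rfl y) p r (by lia) x
      map_zero' := by simp
      map_add' := fun y y' => by simp }
  map_zero' := by ext; simp
  map_add' x x' := by ext; simp

theorem uncurryHom_apply (w : (homCplx P (homFromCplx X J)).X n) {t r : ℤ} (hr : t + n = r)
    {p q : ℤ} (h : p + q = t) (x : X.X p) (y : P.X q) : uncurryHom w hr h x y =
      (p * q).negOnePow • homFromEval (homEval w q (q + n) rfl y) p r (by lia) x := rfl

variable {X P J} in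
/-- `uncurryHom` as an additive map on the tensor product. -/
def uncurryLift (w : (homCplx P (homFromCplx X J)).X n) (t r : ℤ) (hr : t + n = r) :
    (tensorCplx X P).X t →+ J.X r :=
  tensorLift (fun _ _ h => uncurryHom w hr h) fun p q h s x y => by simp [uncurryHom_apply]

theorem uncurryLift_tmul (w : (homCplx P (homFromCplx X J)).X n) {t r : ℤ} (hr : t + n = r)
    {p q : ℤ} (h : p + q = t) (x : X.X p) (y : P.X q) : uncurryLift w t r hr (tmul h x y) =
      (p * q).negOnePow • homFromEval (homEval w q (q + n) rfl y) p r (by lia) x :=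
  tensorLift_tmul h (fun _ _ h => uncurryHom w hr h) _ x y

theorem uncurryLift_smul (w : (homCplx P (homFromCplx X J)).X n) (t r : ℤ) (hr : t + n = r)
    (s : R) (v : (tensorCplx X P).X t) :
    uncurryLift w t r hr (algebraMap R S s • v) = s • uncurryLift w t r hr v := by
  induction v using tensor_induction with
  | h0 => simp only [smul_zero, map_zero]
  | hadd v v' hv hv' => simp only [smul_add, map_add, hv, hv']
  | ht p q h x y =>
    rw [← smul_tmul_eq, uncurryLift_tmul, uncurryLift_tmul, homFromEval_map_smul]
    exact smul_comm _ _ _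

/-- The inverse carries the same sign, which squares to one. No finiteness is needed: a family of
maps out of the direct sums forming `X ⊗ P` is a family indexed by all pairs of degrees, as on the
other side. -/
theorem curryMap_bijective : Function.Bijective ((curryMap X P J).f n) := by
  refine ⟨fun z w hzw => homFrom_ext fun t r hr v => ?_, fun w => ?_⟩
  · induction v using tensor_induction with
    | h0 => simp only [map_zero]
    | hadd v v' hv hv' => simp only [map_add, hv, hv']
    | ht p q h x y =>
    have := congr(homFromEval (homEval $hzw q (q + n) rfl y) p r (by lia) x)
    exact smul_left_cancel _ ((curryElt_eval X P J z rfl (by lia) h x y).symm.trans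
      (this.trans (curryElt_eval X P J w rfl (by lia) h x y)))
  · refine ⟨homFromMk (uncurryLift w) (uncurryLift_smul X P J w), hom_ext fun q m hm y =>
      homFrom_ext fun p r hr x => ?_⟩
    subst hm
    rw [curryMap_eval, homFromEval_homFromMk, uncurryLift_tmul, smul_smul, Int.units_mul_self,
      one_smul]

instance isIso_curryMap : IsIso (curryMap X P J) := by
  have (n : ℤ) : IsIso ((curryMap X P J).f n) :=
    (ConcreteCategory.isIso_iff_bijective _).2 (curryMap_bijective X P J)
  exact HomologicalComplex.Hom.isIso_of_components _

end TensorHomFrom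

section Evaluation

variable (P Y : Cplx S) (J : Cplx R)

variable {P Y J} in
/-- The map `f ↦ (-1)^{|f||y|} z(f(y))`. -/
def evalElt {a q : ℤ} (h : a + q = n) (z : (homFromCplx Y J).X a) (y : P.X q) :
    (homFromCplx (homCplx P Y) J).X n :=
  homFromMk
    (fun m r hr =>
      { toFun := fun f => (m * q).negOnePow •
          homFromEval z (q + m) r (by lia) (homEval f q (q + m) rfl y)
        map_zero' := by simp
        map_add' := fun f f' => by simp })
    (fun m r hr s f => by
      simpa [homFromEval_map_smul] using smul_comm _ _ _)

theorem evalElt_eval {a q m r t : ℤ} (h : a + q = n) (z : (homFromCplx Y J).X a) (y : P.X q)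
    (hr : m + n = r) (ht : q + m = t) (f : (homCplx P Y).X m) :
    homFromEval (evalElt h z y) m r hr f =
      (m * q).negOnePow • homFromEval z t r (by lia) (homEval f q t ht y) := by
  subst ht
  simp [evalElt]

/-- `evalElt` as a biadditive map. -/
def evalHom {a q : ℤ} (h : a + q = n) :
    (homFromCplx Y J).X a →+ P.X q →+ (homFromCplx (homCplx P Y) J).X n where
  toFun z :=
    { toFun := fun y => evalElt h z y
      map_zero' := homFrom_ext fun m r hr f => by simp [evalElt_eval P Y J _ _ _ _ rfl]
      map_add' := fun y y' => homFrom_ext fun m r hr f => by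
        simp [evalElt_eval P Y J _ _ _ _ rfl] }
  map_zero' := by
    ext y
    exact homFrom_ext fun m r hr f => by simp [evalElt_eval P Y J _ _ _ _ rfl]
  map_add' z z' := by
    ext y
    exact homFrom_ext fun m r hr f => by simp [evalElt_eval P Y J _ _ _ _ rfl]

theorem evalHom_apply {a q : ℤ} (h : a + q = n) (z : (homFromCplx Y J).X a) (y : P.X q) :
    evalHom P Y J h z y = evalElt h z y := rfl

/-- `evalHom` as an additive map on the tensor product. -/
def evalLift (n : ℤ) : (tensorCplx (homFromCplx Y J) P).X n →+
    (homFromCplx (homCplx P Y) J).X n :=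
  tensorLift (fun _ _ h => evalHom P Y J h) fun a q h s z y => homFrom_ext fun m r hr f => by
    simp [evalHom_apply, evalElt_eval P Y J _ _ _ _ rfl]

theorem evalLift_tmul {a q : ℤ} (h : a + q = n) (z : (homFromCplx Y J).X a) (y : P.X q) :
    evalLift P Y J n (tmul h z y) = evalElt h z y := by
  rw [evalLift, tensorLift_tmul, evalHom_apply]

/-- `evalLift` as a linear map. -/
def evalLinear (n : ℤ) : (tensorCplx (homFromCplx Y J) P).X n →ₗ[S]
    (homFromCplx (homCplx P Y) J).X n where
  __ := evalLift P Y J n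
  map_smul' s v := by
    change evalLift P Y J n (s • v) = s • evalLift P Y J n v
    induction v using tensor_induction with
    | h0 => simp only [smul_zero, map_zero]
    | hadd v v' hv hv' => simp only [smul_add, map_add, hv, hv']
    | ht p q h x y =>
    rw [← tmul_smul_eq, evalLift_tmul, evalLift_tmul]
    exact homFrom_ext fun m r hr f => by simp [evalElt_eval P Y J _ _ _ _ rfl]

theorem evalLinear_tmul {a q : ℤ} (h : a + q = n) (z : (homFromCplx Y J).X a) (y : P.X q) :
    evalLinear P Y J n (tmul h z y) = evalElt h z y :=
  evalLift_tmul P Y J h z y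

/-- The Hom evaluation morphism `Hom_R(Y, J) ⊗_S P → Hom_R(Hom_S(P, Y), J)`,
`z ⊗ y ↦ (f ↦ (-1)^{|f||y|} z(f(y)))`. -/
def evalMap : tensorCplx (homFromCplx Y J) P ⟶ homFromCplx (homCplx P Y) J where
  f n := ModuleCat.ofHom (evalLinear P Y J n)
  comm' n n' hnm := by
    obtain rfl : n + 1 = n' := hnm
    refine ModuleCat.hom_ext (LinearMap.ext fun v => ?_)
    change (homFromCplx (homCplx P Y) J).d n (n + 1) (evalLinear P Y J n v) =
      evalLinear P Y J (n + 1) ((tensorCplx (homFromCplx Y J) P).d n (n + 1) v)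
    induction v using tensor_induction with
    | h0 => simp only [map_zero]
    | hadd v v' hv hv' => simp only [map_add, hv, hv']
    | ht a q h z y =>
    -- The total degree of `z ⊗ y` is eliminated in favour of `a` and `q`, so that all signs are
    -- expressed in the same variables.
    have hn : n.negOnePow = a.negOnePow * q.negOnePow := by rw [← h, Int.negOnePow_add]
    rw [tmul_d h (p' := a + 1) (q' := q + 1) rfl rfl rfl, map_add, map_units_zsmul,
      evalLinear_tmul, evalLinear_tmul, evalLinear_tmul]
    refine homFrom_ext fun m r hr f => ?_
    -- The surviving terms on both sides are `d(z(f y))`, `z(d(f y))` and `z(f(dy))`.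
    rw [homFromEval_d rfl _ hr (p' := m + 1) rfl (sub_add_cancel r 1), homFromEval_add,
      homFromEval_units_smul, evalElt_eval P Y J _ z y _ rfl,
      evalElt_eval P Y J _ _ y _ (show q + m = q + m from rfl),
      evalElt_eval P Y J _ z _ _ (show q + 1 + m = q + m + 1 by lia),
      evalElt_eval P Y J _ z y _ (show q + (m + 1) = q + m + 1 by lia),
      homFromEval_d rfl z _ (p' := q + m + 1) rfl (sub_add_cancel r 1),
      homEval_d rfl f _ (p' := q + 1) (q' := q + m) rfl rfl]
    simp only [map_add, map_units_zsmul]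
    simp only [smul_add, smul_smul, Int.negOnePow_add, hn, add_mul, mul_add, one_mul, mul_one, mul_comm,
      mul_left_comm, mul_assoc, Int.units_mul_self, negOnePow_mul_cancel_left]
    abel

@[simp]
theorem evalMap_tmul {a q : ℤ} (h : a + q = n) (z : (homFromCplx Y J).X a) (y : P.X q)
    {m r : ℤ} (hr : m + n = r) (f : (homCplx P Y).X m) :
    homFromEval ((evalMap P Y J).f n (tmul h z y)) m r hr f =
      (m * q).negOnePow • homFromEval z (q + m) r (by lia) (homEval f q (q + m) rfl y) :=
  congr(homFromEval $(evalLinear_tmul P Y J h z y) m r hr f).trans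
    (evalElt_eval P Y J h z y hr rfl f)

end Evaluation

end Adjunctions

/-! ### Interchange of `Hom_R(L, -)` and `Hom_S(P, -)` -/

section Swap

variable {R S : Type u} [CommRing R] [CommRing S] [Algebra R S] {n : ℤ} (L : Cplx R)
  (P Y : Cplx S)

variable {L P Y} in
/-- The map `y ↦ (l ↦ (-1)^{|l||y|} g(l)(y))`. -/
def swapElt (g : (homToCplx L (homCplx P Y)).X n) : (homCplx P (homToCplx L Y)).X n :=
  homMk fun q m hm =>
    { toFun := fun y => homToMk
        (fun l r hr =>
          { toFun := fun x => (l * q).negOnePow •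
              homEval (homToEval g l (l + n) rfl x) q r (by lia) y
            map_zero' := by simp
            map_add' := fun x x' => by simp })
        (fun l r hr s x => by
          simpa [homToEval_map_smul] using smul_comm _ _ _)
      map_add' := fun y y' => homTo_ext fun l r hr x => by simp
      map_smul' := fun s y => homTo_ext fun l r hr x => by
        simpa using smul_comm _ _ _ }

theorem swapElt_eval (g : (homToCplx L (homCplx P Y)).X n) {l q m r t : ℤ} (hm : q + n = m)
    (hr : l + m = r) (ht : l + n = t) (x : L.X l) (y : P.X q) :
    homToEval (homEval (swapElt g) q m hm y) l r hr x =
      (l * q).negOnePow • homEval (homToEval g l t ht x) q r (by lia) y := by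
  subst ht
  simp [swapElt]

/-- `swapElt` as a linear map. -/
def swapLinear (n : ℤ) :
    (homToCplx L (homCplx P Y)).X n →ₗ[S] (homCplx P (homToCplx L Y)).X n where
  toFun := swapElt
  map_add' z w := hom_ext fun q m hm y => homTo_ext fun p r hr x => by
    simp [swapElt_eval _ _ _ _ hm hr rfl]
  map_smul' s z := hom_ext fun q m hm y => homTo_ext fun p r hr x => by
    simpa [swapElt_eval _ _ _ _ hm hr rfl] using smul_comm _ _ _

/-- The isomorphism `Hom_R(L, Hom_S(P, Y)) → Hom_S(P, Hom_R(L, Y))`,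
`g ↦ (y ↦ (l ↦ (-1)^{|l||y|} g(l)(y)))`. -/
def swapMap : homToCplx L (homCplx P Y) ⟶ homCplx P (homToCplx L Y) where
  f n := ModuleCat.ofHom (swapLinear L P Y n)
  comm' n n' hnm := by
    obtain rfl : n + 1 = n' := hnm
    refine ModuleCat.hom_ext (LinearMap.ext fun z => hom_ext fun q m hm y =>
      homTo_ext fun p r hr x => ?_)
    change homToEval (homEval ((homCplx P (homToCplx L Y)).d n (n + 1) (swapElt z)) q m hm y)
      p r hr x = homToEval (homEval (swapElt ((homToCplx L (homCplx P Y)).d n (n + 1) z))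
        q m hm y) p r hr x
    -- The three terms to be matched are the differential applied to `z(x)(y)`, and `z` evaluated at
    -- `(dx, y)` and at `(x, dy)`.
    rw [swapElt_eval L P Y _ hm hr rfl x y,
      homToEval_d rfl z rfl (p' := p + 1) (q' := p + n) rfl (by lia), homEval_add,
      homEval_units_smul, homEval_d (m := p + (n + 1)) (n := p + n) (by lia) _ _ (p' := q + 1) rfl
        (sub_add_cancel r 1),
      homEval_d rfl _ hm (p' := q + 1) (q' := q + n) rfl (by lia), homToEval_add,
      homToEval_d (n := q + n) (by lia) _ hr (p' := p + 1) rfl (sub_add_cancel r 1),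
      homToEval_units_smul, swapElt_eval L P Y z rfl _ rfl,
      swapElt_eval L P Y z rfl _ (show p + 1 + n = p + (n + 1) by lia),
      swapElt_eval L P Y z _ _ rfl]
    subst hm
    simp only [map_add, map_units_zsmul]
    simp only [smul_add, smul_smul, Int.negOnePow_add, add_mul, mul_add, one_mul, mul_one,
      mul_comm, mul_left_comm, mul_assoc, Int.units_mul_self, negOnePow_mul_cancel_left]
    abel

@[simp]
theorem swapMap_eval (g : (homToCplx L (homCplx P Y)).X n) {l q m r : ℤ} (hm : q + n = m)
    (hr : l + m = r) (x : L.X l) (y : P.X q) :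
    homToEval (homEval ((swapMap L P Y).f n g) q m hm y) l r hr x =
      (l * q).negOnePow • homEval (homToEval g l (l + n) rfl x) q r (by lia) y :=
  swapElt_eval L P Y g hm hr rfl x y

variable {L P Y} in
/-- The inverse of `swapElt`. -/
def unswapElt (w : (homCplx P (homToCplx L Y)).X n) : (homToCplx L (homCplx P Y)).X n :=
  homToMk
    (fun l m hm =>
      { toFun := fun x => homMk fun q r hr =>
          { toFun := fun y => (l * q).negOnePow •
              homToEval (homEval w q (q + n) rfl y) l r (by lia) x
            map_add' := fun y y' => by simp
            map_smul' := fun s y => by simpa using smul_comm _ _ _ }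
        map_zero' := hom_ext fun q r hr y => by simp
        map_add' := fun x x' => hom_ext fun q r hr y => by simp })
    (fun l m hm s x => hom_ext fun q r hr y => by
      simpa [homToEval_map_smul] using smul_comm _ _ _)

theorem unswapElt_eval (w : (homCplx P (homToCplx L Y)).X n) {l q m r : ℤ} (hm : l + n = m)
    (hr : q + m = r) (x : L.X l) (y : P.X q) :
    homEval (homToEval (unswapElt w) l m hm x) q r hr y =
      (l * q).negOnePow • homToEval (homEval w q (q + n) rfl y) l r (by lia) x := by
  simp [unswapElt]

theorem swapMap_bijective : Function.Bijective ((swapMap L P Y).f n) := by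
  refine ⟨fun z w hzw => homTo_ext fun l m hm x => hom_ext fun q r hr y => ?_, fun w =>
    ⟨unswapElt w, hom_ext fun q m hm y => homTo_ext fun l r hr x => ?_⟩⟩
  · have := congr(homToEval (homEval $hzw q (q + n) rfl y) l r (by lia) x)
    exact smul_left_cancel _ ((swapElt_eval L P Y z rfl (by lia) hm x y).symm.trans
      (this.trans (swapElt_eval L P Y w rfl (by lia) hm x y)))
  · subst hm
    rw [swapMap_eval, unswapElt_eval, smul_smul, Int.units_mul_self, one_smul]

instance isIso_swapMap : IsIso (swapMap L P Y) := by
  have (n : ℤ) : IsIso ((swapMap L P Y).f n) :=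
    (ConcreteCategory.isIso_iff_bijective _).2 (swapMap_bijective L P Y)
  exact HomologicalComplex.Hom.isIso_of_components _

end Swap

/-! ### Tensor evaluation `Hom_R(L, X) ⊗ P → Hom_R(L, X ⊗ P)` -/

section TensorEvaluation

variable {R S : Type u} [CommRing R] [CommRing S] [Algebra R S] {n : ℤ} (L : Cplx R)
  (P X : Cplx S)

variable {L P X} in
/-- The map `l ↦ (-1)^{|l||y|} f(l) ⊗ y`. -/
def tensorEvalElt {a q : ℤ} (h : a + q = n) (f : (homToCplx L X).X a) (y : P.X q) :
    (homToCplx L (tensorCplx X P)).X n :=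
  homToMk
    (fun l r hr =>
      { toFun := fun x => (l * q).negOnePow •
          tmul (show l + a + q = r by lia) (homToEval f l (l + a) rfl x) y
        map_zero' := by simp
        map_add' := fun f f' => by simp [add_tmul] })
    (fun l r hr s x => by
      simpa [homToEval_map_smul, smul_tmul_eq] using smul_comm _ _ _)

theorem tensorEvalElt_eval {a q l r t : ℤ} (h : a + q = n) (f : (homToCplx L X).X a) (y : P.X q)
    (hr : l + n = r) (ht : l + a = t) (x : L.X l) :
    homToEval (tensorEvalElt h f y) l r hr x =
      (l * q).negOnePow • tmul (show t + q = r by lia) (homToEval f l t ht x) y := by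
  subst ht
  simp [tensorEvalElt]

/-- `tensorEvalElt` as a biadditive map. -/
def tensorEvalHom {a q : ℤ} (h : a + q = n) :
    (homToCplx L X).X a →+ P.X q →+ (homToCplx L (tensorCplx X P)).X n where
  toFun z :=
    { toFun := fun y => tensorEvalElt h z y
      map_zero' := homTo_ext fun m r hr f => by simp [tensorEvalElt_eval L P X _ _ _ _ rfl]
      map_add' := fun y y' => homTo_ext fun m r hr f => by
        simp [tensorEvalElt_eval L P X _ _ _ _ rfl, tmul_add] }
  map_zero' := by
    ext y
    exact homTo_ext fun m r hr f => by simp [tensorEvalElt_eval L P X _ _ _ _ rfl]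
  map_add' z z' := by
    ext y
    exact homTo_ext fun m r hr f => by simp [tensorEvalElt_eval L P X _ _ _ _ rfl, add_tmul]

theorem tensorEvalHom_apply {a q : ℤ} (h : a + q = n) (z : (homToCplx L X).X a) (y : P.X q) :
    tensorEvalHom L P X h z y = tensorEvalElt h z y := rfl

/-- `tensorEvalHom` as an additive map on the tensor product. -/
def tensorEvalLift (n : ℤ) : (tensorCplx (homToCplx L X) P).X n →+
    (homToCplx L (tensorCplx X P)).X n :=
  tensorLift (fun _ _ h => tensorEvalHom L P X h) fun a q h s z y => homTo_ext fun m r hr f => by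
    simp [tensorEvalHom_apply, tensorEvalElt_eval L P X _ _ _ _ rfl, smul_tmul_eq, tmul_smul_eq]

theorem tensorEvalLift_tmul {a q : ℤ} (h : a + q = n) (z : (homToCplx L X).X a) (y : P.X q) :
    tensorEvalLift L P X n (tmul h z y) = tensorEvalElt h z y :=
  tensorLift_tmul h (fun _ _ h => tensorEvalHom L P X h) _ z y

/-- `tensorEvalLift` as a linear map. -/
def tensorEvalLinear (n : ℤ) : (tensorCplx (homToCplx L X) P).X n →ₗ[S]
    (homToCplx L (tensorCplx X P)).X n where
  __ := tensorEvalLift L P X n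
  map_smul' s v := by
    change tensorEvalLift L P X n (s • v) = s • tensorEvalLift L P X n v
    induction v using tensor_induction with
    | h0 => simp only [smul_zero, map_zero]
    | hadd v v' hv hv' => simp only [smul_add, map_add, hv, hv']
    | ht p q h x y =>
    rw [← tmul_smul_eq, tensorEvalLift_tmul, tensorEvalLift_tmul]
    exact homTo_ext fun m r hr f => by
      simpa [tensorEvalElt_eval L P X _ _ _ _ rfl, tmul_smul_eq] using smul_comm _ _ _

theorem tensorEvalLinear_tmul {a q : ℤ} (h : a + q = n) (z : (homToCplx L X).X a) (y : P.X q) :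
    tensorEvalLinear L P X n (tmul h z y) = tensorEvalElt h z y :=
  tensorEvalLift_tmul L P X h z y

/-- The tensor evaluation morphism `Hom_R(L, X) ⊗_S P → Hom_R(L, X ⊗_S P)`,
`f ⊗ y ↦ (l ↦ (-1)^{|l||y|} f(l) ⊗ y)`. -/
def tensorEvalMap : tensorCplx (homToCplx L X) P ⟶ homToCplx L (tensorCplx X P) where
  f n := ModuleCat.ofHom (tensorEvalLinear L P X n)
  comm' n n' hnm := by
    obtain rfl : n + 1 = n' := hnm
    refine ModuleCat.hom_ext (LinearMap.ext fun v => ?_)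
    change (homToCplx L (tensorCplx X P)).d n (n + 1) (tensorEvalLinear L P X n v) =
      tensorEvalLinear L P X (n + 1) ((tensorCplx (homToCplx L X) P).d n (n + 1) v)
    induction v using tensor_induction with
    | h0 => simp only [map_zero]
    | hadd v v' hv hv' => simp only [map_add, hv, hv']
    | ht a q h z y =>
    have hn : n.negOnePow = a.negOnePow * q.negOnePow := by rw [← h, Int.negOnePow_add]
    rw [tmul_d h (p' := a + 1) (q' := q + 1) rfl rfl rfl, map_add, map_units_zsmul,
      tensorEvalLinear_tmul, tensorEvalLinear_tmul, tensorEvalLinear_tmul]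
    refine homTo_ext fun l r hr x => ?_
    rw [homToEval_d rfl _ hr (p' := l + 1) rfl (sub_add_cancel r 1), homToEval_add,
      homToEval_units_smul, tensorEvalElt_eval L P X _ z y _ rfl,
      tensorEvalElt_eval L P X _ z _ _ (show l + a = l + a from rfl),
      tensorEvalElt_eval L P X _ _ y _ (show l + (a + 1) = l + a + 1 by lia),
      tensorEvalElt_eval L P X _ z y _ (show l + 1 + a = l + a + 1 by lia),
      homToEval_d rfl z _ (p' := l + 1) (q' := l + a) rfl rfl, map_units_zsmul,
      tmul_d _ (p' := l + a + 1) (q' := q + 1) rfl rfl (sub_add_cancel r 1), add_tmul,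
      units_smul_tmul]
    simp only [smul_add, smul_smul, Int.negOnePow_add, hn, add_mul, mul_add, one_mul, mul_one,
      mul_comm, mul_left_comm, mul_assoc, Int.units_mul_self, negOnePow_mul_cancel_left]
    abel

@[simp]
theorem tensorEvalMap_tmul {a q : ℤ} (h : a + q = n) (z : (homToCplx L X).X a) (y : P.X q)
    {l r : ℤ} (hr : l + n = r) (x : L.X l) :
    homToEval ((tensorEvalMap L P X).f n (tmul h z y)) l r hr x =
      (l * q).negOnePow • tmul (show l + a + q = r by lia) (homToEval z l (l + a) rfl x) y :=
  congr(homToEval $(tensorEvalLinear_tmul L P X h z y) l r hr x).trans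
    (tensorEvalElt_eval L P X h z y hr rfl x)

end TensorEvaluation

/-! ### K-injectivity of `Hom_R(Q, J)` -/

section SwapFrom

variable {R S : Type u} [CommRing R] [CommRing S] [Algebra R S] {n : ℤ} (X Q : Cplx S)
  (J : Cplx R)

variable {X Q J} in
/-- The map `y ↦ (x ↦ (-1)^{|x||y|} w(x)(y))`. -/
def flipElt (w : (homCplx X (homFromCplx Q J)).X n) : (homCplx Q (homFromCplx X J)).X n :=
  homMk fun q m hm =>
    { toFun := fun y => homFromMk
        (fun p r hr =>
          { toFun := fun x => (p * q).negOnePow •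
              homFromEval (homEval w p (p + n) rfl x) q r (by lia) y
            map_zero' := by simp
            map_add' := fun x x' => by simp })
        (fun p r hr s x => by
          simpa [homFromEval_map_smul] using smul_comm _ _ _)
      map_add' := fun y y' => homFrom_ext fun p r hr x => by simp
      map_smul' := fun s y => homFrom_ext fun p r hr x => by simp }

theorem flipElt_eval (w : (homCplx X (homFromCplx Q J)).X n) {p q m r t : ℤ} (hm : q + n = m)
    (hr : p + m = r) (ht : p + n = t) (x : X.X p) (y : Q.X q) :
    homFromEval (homEval (flipElt w) q m hm y) p r hr x =
      (p * q).negOnePow • homFromEval (homEval w p t ht x) q r (by lia) y := by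
  subst ht
  simp [flipElt]

theorem flipElt_flipElt (w : (homCplx X (homFromCplx Q J)).X n) : flipElt (flipElt w) = w :=
  hom_ext fun p m hm x => homFrom_ext fun q r hr y => by
    rw [flipElt_eval Q X J _ hm hr rfl, flipElt_eval X Q J _ _ _ hm, mul_comm q p, smul_smul,
      Int.units_mul_self, one_smul]

/-- Together with `flipElt_flipElt` this identifies `Hom_S(X, Hom_R(Q, J))` and `Hom_S(Q, Hom_R(X,
J))` as complexes, which is what lets K-projectivity of `Q` and K-injectivity of `J` act together.
-/
theorem flipElt_d (z : (homCplx X (homFromCplx Q J)).X n) :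
    (homCplx Q (homFromCplx X J)).d n (n + 1) (flipElt z) =
      flipElt ((homCplx X (homFromCplx Q J)).d n (n + 1) z) := by
    refine hom_ext fun q m hm y => homFrom_ext fun p r hr x => ?_
    rw [flipElt_eval X Q J _ hm hr rfl x y,
      homEval_d rfl z rfl (p' := p + 1) (q' := p + n) rfl (by lia), homFromEval_add,
      homFromEval_units_smul, homFromEval_d (m := p + (n + 1)) (n := p + n) (by lia) _ _
        (p' := q + 1) rfl (sub_add_cancel r 1),
      homEval_d rfl _ hm (p' := q + 1) (q' := q + n) rfl (by lia), homFromEval_add,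
      homFromEval_d (n := q + n) (by lia) _ hr (p' := p + 1) rfl (sub_add_cancel r 1),
      homFromEval_units_smul, flipElt_eval X Q J z rfl _ rfl,
      flipElt_eval X Q J z rfl _ (show p + 1 + n = p + (n + 1) by lia),
      flipElt_eval X Q J z _ _ rfl]
    subst hm
    simp only [map_add, map_units_zsmul]
    simp only [smul_add, smul_smul, Int.negOnePow_add, add_mul, mul_add, one_mul, mul_one,
      mul_comm, mul_left_comm, mul_assoc, Int.units_mul_self, negOnePow_mul_cancel_left]
    abel

/-- Acyclicity does not depend on the ring of scalars, and every cocycle from an acyclic complex to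
a K-injective one is a coboundary. -/
theorem exactAt_homFromCplx (hX : X.Acyclic) [J.IsKInjective] (n : ℤ) :
    (homFromCplx X J).ExactAt n := by
  have hX' : (resCplx R X).Acyclic := fun m => by
    rw [exactAt_iff_forall (sub_add_cancel m 1) rfl]
    exact (exactAt_iff_forall (K := X) (sub_add_cancel m 1) rfl).1 (hX m)
  rw [exactAt_iff_forall (sub_add_cancel n 1) rfl]
  intro (z : Cochain (resCplx R X) J n) hz
  exact IsKInjective.eq_δ_of_cocycle (Cocycle.mk z (n + 1) rfl hz) hX' (n - 1)
    (sub_add_cancel n 1)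

/-- If `Q` is K-projective and `J` is K-injective, then `Hom_R(Q, J)` is K-injective. -/
theorem isKInjective_homFromCplx [Q.IsKProjective] [J.IsKInjective] :
    (homFromCplx Q J).IsKInjective where
  nonempty_homotopy_zero {X} f hX := by
    have hX' : (homFromCplx X J).Acyclic := fun n => exactAt_homFromCplx X J hX n
    -- A morphism out of the acyclic `X` is a cocycle of degree zero. Flipped, it becomes a cocycle
    -- from the K-projective `Q` to the acyclic complex `Hom_R(X, J)`, hence a coboundary; flipping
    -- back gives a null-homotopy.
    let w : (homCplx X (homFromCplx Q J)).X 0 := Cochain.ofHom f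
    have hw : (homCplx X (homFromCplx Q J)).d 0 (0 + 1) w = 0 := δ_ofHom f
    have hw' : (homCplx Q (homFromCplx X J)).d 0 (0 + 1) (flipElt w) = 0 := by
      rw [flipElt_d, hw]
      exact hom_ext fun q m hm y => homFrom_ext fun p r hr x => by
        simp [flipElt_eval X Q J _ hm hr rfl]
    obtain ⟨v, hv⟩ := exists_cochain_of_isKProjective hX' (neg_add_cancel 1) rfl _ hw'
    have h1 : (homCplx X (homFromCplx Q J)).d (-1) 0 (flipElt v) = w := by
      have := flipElt_d Q X J (n := -1) v
      refine this.trans ?_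
      refine (congr_arg flipElt hv).trans (flipElt_flipElt X Q J w)
    exact ⟨(Cochain.equivHomotopy f 0).symm
      ⟨flipElt v, by rw [Cochain.ofHom_zero, add_zero]; exact h1.symm⟩⟩

end SwapFrom

/-! ### Adjunction for the relative tensor product -/

section RelativeCurry

variable {R S : Type u} [CommRing R] [CommRing S] [Algebra R S] {n : ℤ} (A : Cplx S)
  (Q J : Cplx R)

variable {A Q J} in
/-- The map `a ↦ (x ↦ z(a ⊗ x))`. -/
def relCurryElt (z : (homFromCplx (tensorRelCplx A Q) J).X n) :
    (homFromCplx A (homFromCplx Q J)).X n :=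
  homFromMk
    (fun p m hm =>
      { toFun := fun a => homFromMk
          (fun q r hr =>
            { toFun := fun x => homFromEval z (p + q) r (by lia) (relTmul rfl a x)
              map_zero' := by simp
              map_add' := fun x x' => by simp [relTmul_add] })
          (fun q r hr s x => by
            simp [relTmul_smul, homFromEval_map_smul])
        map_zero' := homFrom_ext fun q r hr x => by simp
        map_add' := fun a a' => homFrom_ext fun q r hr x => by simp [add_relTmul] })
    (fun p m hm s a => homFrom_ext fun q r hr x => by
      simp [smul_relTmul, relTmul_smul])

/-- There is no sign, in contrast to `curryElt_eval`: here `z`, `a`, `x` keep their order. -/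
theorem relCurryElt_eval (z : (homFromCplx (tensorRelCplx A Q) J).X n) {p q m r t : ℤ}
    (hm : p + n = m) (hr : q + m = r) (ht : p + q = t) (a : A.X p) (x : Q.X q) :
    homFromEval (homFromEval (relCurryElt z) p m hm a) q r hr x =
      homFromEval z t r (by lia) (relTmul ht a x) := by
  subst ht
  simp [relCurryElt]

/-- `relCurryElt` as a linear map. -/
def relCurryLinear (n : ℤ) : (homFromCplx (tensorRelCplx A Q) J).X n →ₗ[S]
    (homFromCplx A (homFromCplx Q J)).X n where
  toFun := relCurryElt
  map_add' z w := homFrom_ext fun p m hm a => homFrom_ext fun q r hr x => by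
    simp [relCurryElt_eval _ _ _ _ hm hr rfl]
  map_smul' s z := homFrom_ext fun p m hm a => homFrom_ext fun q r hr x => by
    simp [relCurryElt_eval _ _ _ _ hm hr rfl, smul_relTmul]

/-- The adjunction isomorphism `Hom_R(A ⊗_R Q, J) → Hom_R(A, Hom_R(Q, J))`. -/
def relCurryMap : homFromCplx (tensorRelCplx A Q) J ⟶ homFromCplx A (homFromCplx Q J) where
  f n := ModuleCat.ofHom (relCurryLinear A Q J n)
  comm' n n' hnm := by
    obtain rfl : n + 1 = n' := hnm
    refine ModuleCat.hom_ext (LinearMap.ext fun z => homFrom_ext fun p m hm a =>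
      homFrom_ext fun q r hr x => ?_)
    change homFromEval (homFromEval ((homFromCplx A (homFromCplx Q J)).d n (n + 1)
      (relCurryElt z)) p m hm a) q r hr x = homFromEval (homFromEval
        (relCurryElt ((homFromCplx (tensorRelCplx A Q) J).d n (n + 1) z)) p m hm a) q r hr x
    rw [relCurryElt_eval A Q J _ hm hr rfl a x,
      homFromEval_d rfl z (by lia) (p' := p + q + 1) rfl (sub_add_cancel r 1),
      relTmul_d rfl (p' := p + 1) (q' := q + 1) rfl rfl rfl,
      homFromEval_d rfl _ hm (p' := p + 1) (q' := p + n) rfl (by lia), homFromEval_add,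
      homFromEval_d (n := p + n) (by lia) _ hr (p' := q + 1) rfl (sub_add_cancel r 1),
      homFromEval_units_smul, relCurryElt_eval A Q J z rfl _ rfl,
      relCurryElt_eval A Q J z rfl _ (show p + (q + 1) = p + q + 1 by lia),
      relCurryElt_eval A Q J z _ _ (show p + 1 + q = p + q + 1 by lia)]
    subst hm
    simp only [map_add, map_units_zsmul]
    simp only [smul_add, smul_smul, Int.negOnePow_add, add_mul, mul_add, one_mul, mul_one,
      mul_comm, mul_left_comm, mul_assoc, Int.units_mul_self, negOnePow_mul_cancel_left]
    abel

variable {A Q J} in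
/-- The biadditive map `(a, x) ↦ w(a)(x)`. -/
def relUncurryHom (w : (homFromCplx A (homFromCplx Q J)).X n) {t r : ℤ} (hr : t + n = r)
    {p q : ℤ} (h : p + q = t) : A.X p →+ Q.X q →+ J.X r where
  toFun a := homFromEval (homFromEval w p (p + n) rfl a) q r (by lia)
  map_zero' := by ext; simp
  map_add' x x' := by ext; simp

theorem relUncurryHom_apply (w : (homFromCplx A (homFromCplx Q J)).X n) {t r : ℤ}
    (hr : t + n = r) {p q : ℤ} (h : p + q = t) (a : A.X p) (x : Q.X q) :
    relUncurryHom w hr h a x = homFromEval (homFromEval w p (p + n) rfl a) q r (by lia) x := rfl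

variable {A Q J} in
/-- `relUncurryHom` as an additive map on the tensor product. -/
def relUncurryLift (w : (homFromCplx A (homFromCplx Q J)).X n) (t r : ℤ) (hr : t + n = r) :
    (tensorRelCplx A Q).X t →+ J.X r :=
  relTensorLift (fun _ _ h => relUncurryHom w hr h) fun p q h s a x => by
    rw [relUncurryHom_apply, homFromEval_map_smul, homFromEval_smul]
    rfl

theorem relUncurryLift_relTmul (w : (homFromCplx A (homFromCplx Q J)).X n) {t r : ℤ}
    (hr : t + n = r) {p q : ℤ} (h : p + q = t) (a : A.X p) (x : Q.X q) :
    relUncurryLift w t r hr (relTmul h a x) =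
      homFromEval (homFromEval w p (p + n) rfl a) q r (by lia) x :=
  relTensorLift_relTmul h (fun _ _ h => relUncurryHom w hr h) _ a x

theorem relUncurryLift_smul (w : (homFromCplx A (homFromCplx Q J)).X n) (t r : ℤ)
    (hr : t + n = r) (s : R) (v : (tensorRelCplx A Q).X t) :
    relUncurryLift w t r hr (algebraMap R S s • v) = s • relUncurryLift w t r hr v := by
  induction v using relTensor_induction with
  | h0 => simp only [smul_zero, map_zero]
  | hadd v v' hv hv' => simp only [smul_add, map_add, hv, hv']
  | ht p q h a x =>
    rw [← relTmul_smul, relUncurryLift_relTmul, relUncurryLift_relTmul]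
    exact homFromEval_map_smul (S := R) _ _ _ _ s x

theorem relCurryMap_bijective : Function.Bijective ((relCurryMap A Q J).f n) := by
  refine ⟨fun z w hzw => homFrom_ext fun t r hr v => ?_, fun w => ?_⟩
  · induction v using relTensor_induction with
    | h0 => simp only [map_zero]
    | hadd v v' hv hv' => simp only [map_add, hv, hv']
    | ht p q h a x =>
    have := congr(homFromEval (homFromEval $hzw p (p + n) rfl a) q r (by lia) x)
    exact (relCurryElt_eval A Q J z rfl (by lia) h a x).symm.trans
      (this.trans (relCurryElt_eval A Q J w rfl (by lia) h a x))
  · refine ⟨homFromMk (relUncurryLift w) (relUncurryLift_smul A Q J w),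
      homFrom_ext fun p m hm a => homFrom_ext fun q r hr x => ?_⟩
    subst hm
    refine (relCurryElt_eval A Q J _ rfl hr rfl a x).trans ?_
    rw [homFromEval_homFromMk, relUncurryLift_relTmul]

instance isIso_relCurryMap : IsIso (relCurryMap A Q J) := by
  have (n : ℤ) : IsIso ((relCurryMap A Q J).f n) :=
    (ConcreteCategory.isIso_iff_bijective _).2 (relCurryMap_bijective A Q J)
  exact HomologicalComplex.Hom.isIso_of_components _

end RelativeCurry

/-! ### Compatibility of the canonical maps with units and counits -/

section Naturality

variable {R S : Type u} [CommRing R] [CommRing S] [Algebra R S]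

theorem cplx_hom_ext {K L : Cplx S} {f g : K ⟶ L} (h : ∀ n (x : K.X n), f.f n x = g.f n x) :
    f = g :=
  HomologicalComplex.hom_ext _ _ fun n => ModuleCat.hom_ext (LinearMap.ext (h n))

theorem tensor_hom_ext {X P K : Cplx S} {f g : tensorCplx X P ⟶ K}
    (h : ∀ n p q (hpq : p + q = n) (x : X.X p) (y : P.X q),
      f.f n (tmul hpq x y) = g.f n (tmul hpq x y)) :
    f = g :=
  cplx_hom_ext fun n v => by
    induction v using tensor_induction with
    | h0 => simp only [map_zero]
    | hadd v v' hv hv' => simp only [map_add, hv, hv']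
    | ht p q hpq x y => exact h n p q _ x y

theorem unitMap_naturality (P : Cplx S) {X X' : Cplx S} (f : X ⟶ X') :
    unitMap P X ≫ homMap P (tensorMap f (𝟙 P)) = f ≫ unitMap P X' :=
  cplx_hom_ext fun n x => hom_ext fun q m hm y => by simp

/-- Used to compare the units attached to two resolutions of the same complex. -/
theorem unitMap_dinaturality {P P' : Cplx S} (h : P ⟶ P') (X : Cplx S) :
    unitMap P X ≫ homMap P (tensorMap (𝟙 X) h) =
      unitMap P' X ≫ homPremap h (tensorCplx X P') :=
  cplx_hom_ext fun n x => hom_ext fun q m hm y => by simp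

theorem counitMap_naturality (P : Cplx S) {Y Y' : Cplx S} (f : Y ⟶ Y') :
    tensorMap (homMap P f) (𝟙 P) ≫ counitMap P Y' = counitMap P Y ≫ f :=
  tensor_hom_ext fun n p q hpq x y => by simp

theorem counitMap_dinaturality {P P' : Cplx S} (h : P ⟶ P') (Y : Cplx S) :
    tensorMap (homPremap h Y) (𝟙 P) ≫ counitMap P Y =
      tensorMap (𝟙 (homCplx P' Y)) h ≫ counitMap P' Y :=
  tensor_hom_ext fun n p q hpq x y => by simp

theorem curryMap_naturality_left {X X' : Cplx S} (f : X ⟶ X') (P : Cplx S) (J : Cplx R) :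
    homFromPremap (tensorMap f (𝟙 P)) J ≫ curryMap X P J =
      curryMap X' P J ≫ homMap P (homFromPremap f J) :=
  cplx_hom_ext fun n x => hom_ext fun q m hm y => homFrom_ext fun p r hr z => by simp

theorem curryMap_naturality_right (X : Cplx S) {P P' : Cplx S} (h : P ⟶ P') (J : Cplx R) :
    homFromPremap (tensorMap (𝟙 X) h) J ≫ curryMap X P J =
      curryMap X P' J ≫ homPremap h (homFromCplx X J) :=
  cplx_hom_ext fun n x => hom_ext fun q m hm y => homFrom_ext fun p r hr z => by simp

theorem evalMap_naturality (P : Cplx S) {Y Y' : Cplx S} (f : Y ⟶ Y') (J : Cplx R) :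
    tensorMap (homFromPremap f J) (𝟙 P) ≫ evalMap P Y J =
      evalMap P Y' J ≫ homFromPremap (homMap P f) J :=
  tensor_hom_ext fun n p q hpq x y => homFrom_ext fun m r hr f => by simp

theorem tensorEvalMap_naturality (L : Cplx R) (P : Cplx S) {X X' : Cplx S} (f : X ⟶ X') :
    tensorMap (homToMap L f) (𝟙 P) ≫ tensorEvalMap L P X' =
      tensorEvalMap L P X ≫ homToMap L (tensorMap f (𝟙 P)) :=
  tensor_hom_ext fun n p q hpq x y => homTo_ext fun m r hr f => by simp [map_units_zsmul]

/-- The counit of `Hom_R(X, J)` is dual to the unit of `X`. -/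
theorem evalMap_comp_homFromPremap_unitMap (X P : Cplx S) (J : Cplx R) :
    evalMap P (tensorCplx X P) J ≫ homFromPremap (unitMap P X) J =
      tensorMap (curryMap X P J) (𝟙 P) ≫ counitMap P (homFromCplx X J) :=
  tensor_hom_ext fun n p q hpq x y => homFrom_ext fun m r hr f => by
    simp
    -- After simplification the two sides differ only in how the same degree is written.
    have aux : ∀ s t (hs : m + q = s) (ht : m + q = t),
        homFromEval x s r (by lia) (tmul hs f y) = homFromEval x t r (by lia) (tmul ht f y) := by
      rintro _ _ rfl rfl; rfl
    exact aux _ _ _ _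

/-- The unit of `Hom_R(Y, J)` is dual to the counit of `Y`. -/
theorem unitMap_comp_homMap_evalMap (Y P : Cplx S) (J : Cplx R) :
    unitMap P (homFromCplx Y J) ≫ homMap P (evalMap P Y J) =
      homFromPremap (counitMap P Y) J ≫ curryMap (homCplx P Y) P J :=
  cplx_hom_ext fun n x => hom_ext fun q m hm y => homFrom_ext fun p r hr z => by
    simp
    have aux : ∀ s t (hs : q + p = s) (ht : q + p = t),
        homFromEval x s r (by lia) (homEval z q s hs y) =
          homFromEval x t r (by lia) (homEval z q t ht y) := by
      rintro _ _ rfl rfl; rfl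
    exact aux _ _ _ _

/-- When tensor evaluation is a quasi-isomorphism, this reduces the unit of `Hom_R(L, X)` to the
image under `Hom_R(L, -)` of the unit of `X`. -/
theorem unitMap_comp_homMap_tensorEvalMap (L : Cplx R) (X P : Cplx S) :
    unitMap P (homToCplx L X) ≫ homMap P (tensorEvalMap L P X) =
      homToMap L (unitMap P X) ≫ swapMap L P (tensorCplx X P) :=
  cplx_hom_ext fun n x => hom_ext fun q m hm y => homTo_ext fun p r hr z => by
    simp

/-- The analogue for counits; here tensor evaluation is needed at `Hom_S(P, Y)` rather than at `Y`.
-/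
theorem tensorMap_swapMap_comp_counitMap (L : Cplx R) (Y P : Cplx S) :
    tensorMap (swapMap L P Y) (𝟙 P) ≫ counitMap P (homToCplx L Y) =
      tensorEvalMap L P (homCplx P Y) ≫ homToMap L (counitMap P Y) :=
  tensor_hom_ext fun n p q hpq x y => homTo_ext fun m r hr f => by
    simp [map_units_zsmul]

end Naturality

/-! ### Coordinates with respect to bases of the components of `P` -/

section FreeCoordinates

variable {S : Type u} [CommRing S] {P : Cplx S} {ι : ℤ → Type u}
  (b : ∀ q, Module.Basis (ι q) S (P.X q)) {X Y : Cplx S} {n : ℤ}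

theorem eq_zero_of_isZero {M : ModuleCat.{u} S} (h : Limits.IsZero M) (x : M) : x = 0 :=
  have := ModuleCat.subsingleton_of_isZero h
  Subsingleton.elim x 0

/-- The coefficient of a basis element of `P` in an element of `X ⊗ P`. -/
def tensorCoeff {a q : ℤ} (h : a + q = n) (i : ι q) : (tensorCplx X P).X n →+ X.X a :=
  tensorLift (fun p q' h' =>
    if e : q' = q then
      { toFun := fun x =>
          { toFun := fun y => (b q).coord i ((P.XIsoOfEq e).hom y) •
              (X.XIsoOfEq (show p = a by lia)).hom x
            map_zero' := by simp
            map_add' := fun y y' => by simp [add_smul] }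
        map_zero' := by ext; simp
        map_add' := fun x x' => by ext; simp }
    else 0) fun p q' h' s x y => by
      split_ifs with e
      · simp [smul_smul, mul_comm]
      · rfl

theorem tensorCoeff_tmul {a q : ℤ} (h h' : a + q = n) (i : ι q) (x : X.X a) (y : P.X q) :
    tensorCoeff b h i (tmul h' x y) = (b q).coord i y • x := by
  rw [tensorCoeff, tensorLift_tmul, dif_pos rfl]
  simp [HomologicalComplex.XIsoOfEq]

theorem tensorCoeff_tmul_of_ne {a q a' q' : ℤ} (h : a + q = n) (h' : a' + q' = n) (i : ι q)
    (x : X.X a') (y : P.X q') (hq : q' ≠ q) : tensorCoeff b h i (tmul h' x y) = 0 := by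
  rw [tensorCoeff, tensorLift_tmul, dif_neg hq]
  rfl

/-- Only the degrees `q` with `X^(n-q)` nonzero contribute, so one finite window `W` serves for all
elements. -/
theorem tensor_eq_sum [∀ q, Fintype (ι q)] (W : Finset ℤ)
    (hW : ∀ q ∉ W, ∀ a, a + q = n → Limits.IsZero (X.X a)) (v : (tensorCplx X P).X n) :
    ∑ q ∈ W, ∑ i, tmul (sub_add_cancel n q) (tensorCoeff b (sub_add_cancel n q) i v) (b q i) =
      v := by
  induction v using tensor_induction with
  | h0 => simp
  | hadd v v' hv hv' =>
    simp only [map_add, add_tmul, Finset.sum_add_distrib]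
    rw [hv, hv']
  | ht a q h x y =>
    by_cases hq : q ∈ W
    · rw [Finset.sum_eq_single q]
      · obtain rfl : a = n - q := by lia
        simp only [tensorCoeff_tmul, smul_tmul_eq, ← tmul_smul_eq]
        rw [← tmul_sum]
        congr 1
        exact (b q).sum_repr y
      · intro q' _ hq'
        refine Finset.sum_eq_zero fun i _ => ?_
        rw [tensorCoeff_tmul_of_ne _ _ _ _ _ _ hq'.symm, zero_tmul]
      · exact fun h' => absurd hq h'
    · obtain rfl := eq_zero_of_isZero (hW q hq a h) x
      simp

/-- The element of `Hom(P, Y)` sending one basis element of `P` to a given element. -/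
def homSingle {q m t : ℤ} (ht : q + m = t) (i : ι q) (y : Y.X t) : (homCplx P Y).X m :=
  homMk fun p r hr =>
    if e : p = q then
      (Y.XIsoOfEq (show t = r by lia)).hom.hom ∘ₗ ((b q).coord i).smulRight y ∘ₗ
        (P.XIsoOfEq e).hom.hom
    else 0

theorem homEval_homSingle {q m t : ℤ} (ht ht' : q + m = t) (i : ι q) (y : Y.X t) (x : P.X q) :
    homEval (homSingle b ht i y) q t ht' x = (b q).coord i x • y := by
  rw [homSingle, homEval_homMk, dif_pos rfl]
  simp [HomologicalComplex.XIsoOfEq]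

theorem homEval_homSingle_of_ne {q m t p r : ℤ} (ht : q + m = t) (hr : p + m = r) (i : ι q)
    (y : Y.X t) (x : P.X p) (hp : p ≠ q) : homEval (homSingle b ht i y) p r hr x = 0 := by
  rw [homSingle, homEval_homMk, dif_neg hp]
  rfl

/-- `homSingle` as a linear map. -/
def homSingleLinear {q m t : ℤ} (ht : q + m = t) (i : ι q) : Y.X t →ₗ[S] (homCplx P Y).X m where
  toFun y := homSingle b ht i y
  map_add' y y' := hom_ext fun p r hr x => by
    by_cases e : p = q
    · obtain rfl := e
      obtain rfl : t = r := by lia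
      simp only [homEval_homSingle, homEval_add, smul_add]
    · simp only [homEval_homSingle_of_ne _ _ _ _ _ _ e, homEval_add, add_zero]
  map_smul' s y := hom_ext fun p r hr x => by
    by_cases e : p = q
    · obtain rfl := e
      obtain rfl : t = r := by lia
      simp only [homEval_homSingle, homEval_smul, RingHom.id_apply]
      rw [smul_comm]
    · simp only [homEval_homSingle_of_ne _ _ _ _ _ _ e, homEval_smul, RingHom.id_apply, smul_zero]

/-- In general an element of `Hom(P, Y)` has infinitely many components. The vanishing of `Y`
outside the window makes it a finite sum of elementary homomorphisms, through which additive maps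
can be pulled. -/
theorem homElt_eq_sum [∀ q, Fintype (ι q)] (W : Finset ℤ) {m : ℤ}
    (hW : ∀ q ∉ W, ∀ t, q + m = t → Limits.IsZero (Y.X t)) (f : (homCplx P Y).X m) :
    ∑ q ∈ W, ∑ i, homSingleLinear b rfl i (homEval f q (q + m) rfl (b q i)) = f := by
  -- Evaluation is bundled as an additive map of the homomorphism so that it passes through the
  -- double sum.
  let ev (p r : ℤ) (hr : p + m = r) (x : P.X p) : (homCplx P Y).X m →+ Y.X r :=
    { toFun := fun z => homEval z p r hr x
      map_zero' := rfl
      map_add' := fun _ _ => rfl }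
  refine hom_ext fun p r hr x => ?_
  subst hr
  change ev p (p + m) rfl x _ = _
  rw [map_sum]
  simp only [map_sum]
  by_cases hp : p ∈ W
  · rw [Finset.sum_eq_single p]
    · refine (Finset.sum_congr rfl fun i _ =>
        homEval_homSingle b rfl rfl i (homEval f p (p + m) rfl (b p i)) x).trans ?_
      conv_rhs => rw [← (b p).sum_repr x, map_sum]
      simp only [map_smul]
      rfl
    · exact fun q _ hq => Finset.sum_eq_zero fun i _ =>
        homEval_homSingle_of_ne b rfl _ _ _ _ hq.symm
    · exact fun h => absurd hp h
  · exact (eq_zero_of_isZero (hW p hp _ rfl) _).trans (eq_zero_of_isZero (hW p hp _ rfl) _).symm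

end FreeCoordinates

/-! ### Hom complexes between bounded complexes -/

section StrictBounds

theorem StrictlyBounded.exists_window {R S : Type u} [CommRing R] [CommRing S] {X : Cplx S} {Y : Cplx R} (hX : StrictlyBounded X)
    (hY : StrictlyBounded Y) : ∃ N : ℕ, ∀ n : ℤ, (n < -N ∨ N < n) →
      Limits.IsZero (X.X n) ∧ Limits.IsZero (Y.X n) := by
  obtain ⟨a, b, h⟩ := hX
  obtain ⟨c, d, h'⟩ := hY
  exact ⟨a.natAbs + b.natAbs + c.natAbs + d.natAbs, fun n hn => ⟨h n (by lia), h' n (by lia)⟩⟩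

theorem isZero_of_forall {S : Type u} [CommRing S] {M : ModuleCat.{u} S} (h : ∀ x : M, x = 0) : Limits.IsZero M :=
  have : Subsingleton M := ⟨fun x y => (h x).trans (h y).symm⟩
  ModuleCat.isZero_of_subsingleton M

variable {R S : Type u} [CommRing R] [CommRing S] [Algebra R S]

theorem StrictlyBounded.homFromCplx {X : Cplx S} {J : Cplx R} (hX : StrictlyBounded X)
    (hJ : StrictlyBounded J) : StrictlyBounded (homFromCplx X J) := by
  obtain ⟨N, hN⟩ := hX.exists_window hJ
  -- If `|n| > 2N`, then `p` and `p + n` cannot both lie in `[-N, N]`.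
  refine ⟨-(2 * N), 2 * N, fun n hn => isZero_of_forall fun z => homFrom_ext fun p q h x => ?_⟩
  by_cases hp : p < -N ∨ N < p
  · rw [eq_zero_of_isZero (hN p hp).1 x, map_zero, map_zero]
  · exact (eq_zero_of_isZero (hN q (by lia)).2 _).trans
      (eq_zero_of_isZero (hN q (by lia)).2 _).symm

theorem StrictlyBounded.homToCplx {L : Cplx R} {X : Cplx S} (hX : StrictlyBounded X)
    (hL : StrictlyBounded L) : StrictlyBounded (homToCplx L X) := by
  obtain ⟨N, hN⟩ := hX.exists_window hL
  refine ⟨-(2 * N), 2 * N, fun n hn => isZero_of_forall fun z => homTo_ext fun p q h x => ?_⟩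
  by_cases hp : p < -N ∨ N < p
  · rw [eq_zero_of_isZero (hN p hp).2 x, map_zero, map_zero]
  · exact (eq_zero_of_isZero (hN q (by lia)).1 _).trans
      (eq_zero_of_isZero (hN q (by lia)).1 _).symm

end StrictBounds

/-! ### Evaluation maps for degreewise finite free `P` -/

section FiniteFree

variable {R S : Type u} [CommRing R] [CommRing S] [Algebra R S] {P : Cplx S} {ι : ℤ → Type u}
  (b : ∀ q, Module.Basis (ι q) S (P.X q)) {n : ℤ}

theorem smul_eq_units_smul_of_sq {M : Type*} [AddCommGroup M] (e : ℤˣ) (x : M) :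
    e • e • x = x := by
  rw [smul_smul, Int.units_mul_self, one_smul]

/-- The coefficients of `v` are recovered from its image by testing on elementary homomorphisms.
This gives injectivity of `evalMap` and dictates the preimage in `evalMapCoeff`. -/
theorem homFromEval_tensorCoeff {Y : Cplx S} {J : Cplx R}
    (v : (tensorCplx (homFromCplx Y J) P).X n) {a q p r m : ℤ} (h : a + q = n) (hr : p + a = r)
    (hm : q + m = p) (i : ι q) (y : Y.X p) :
    homFromEval (tensorCoeff b h i v) p r hr y = (m * q).negOnePow •
      homFromEval ((evalMap P Y J).f n v) m r (by lia) (homSingle b hm i y) := by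
  induction v using tensor_induction with
  | h0 => simp
  | hadd v v' hv hv' => simp only [map_add, homFromEval_add, hv, hv', smul_add]
  | ht a' q' h' z x =>
    by_cases e : q' = q
    · obtain rfl := e
      obtain rfl : a' = a := by lia
      subst hm
      rw [tensorCoeff_tmul, evalMap_tmul, smul_eq_units_smul_of_sq, homEval_homSingle,
        homFromEval_smul]
    · rw [tensorCoeff_tmul_of_ne _ _ _ _ _ _ e, evalMap_tmul, homEval_homSingle_of_ne _ _ _ _ _ _ e]
      simp

/-- The coefficients of the preimage of an element under `evalMap`. -/
def evalMapCoeff {Y : Cplx S} {J : Cplx R} (w : (homFromCplx (homCplx P Y) J).X n) {a q : ℤ}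
    (h : a + q = n) (i : ι q) : (homFromCplx Y J).X a :=
  homFromMk
    (fun p r hr =>
      { toFun := fun y => ((p - q) * q).negOnePow •
          homFromEval w (p - q) r (by lia) (homSingleLinear b (add_sub_cancel q p) i y)
        map_zero' := by simp
        map_add' := fun y y' => by simp })
    (fun p r hr s y => by
      simpa [homFromEval_map_smul] using smul_comm _ _ _)

theorem homFromEval_evalMapCoeff {Y : Cplx S} {J : Cplx R}
    (w : (homFromCplx (homCplx P Y) J).X n) {a q p r m : ℤ}
    (h : a + q = n) (hr : p + a = r) (hm : q + m = p) (i : ι q) (y : Y.X p) :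
    homFromEval (evalMapCoeff b w h i) p r hr y =
      (m * q).negOnePow • homFromEval w m r (by lia) (homSingleLinear b hm i y) := by
  obtain rfl : m = p - q := by lia
  simp [evalMapCoeff]

theorem homFromEval_sum {κ : Type*} {Y : Cplx S} {J : Cplx R} (s : Finset κ)
    (z : κ → (homFromCplx Y J).X n) {p q : ℤ} (h : p + n = q) (y : Y.X p) :
    homFromEval (∑ k ∈ s, z k) p q h y = ∑ k ∈ s, homFromEval (z k) p q h y :=
  map_sum (AddMonoidHom.mk' (fun z : (homFromCplx Y J).X n => homFromEval z p q h y)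
    fun _ _ => rfl) _ _

theorem homToEval_sum {κ : Type*} {L : Cplx R} {X : Cplx S} (s : Finset κ)
    (z : κ → (homToCplx L X).X n) {p q : ℤ} (h : p + n = q) (y : L.X p) :
    homToEval (∑ k ∈ s, z k) p q h y = ∑ k ∈ s, homToEval (z k) p q h y :=
  map_sum (AddMonoidHom.mk' (fun z : (homToCplx L X).X n => homToEval z p q h y)
    fun _ _ => rfl) _ _

/-- With finite bases, `- ⊗ P^q` and `Hom(P^q, -)` are finite sums of copies of the identity. The
bounds on `Y` and `J` leave finitely many `q` in each degree, so that the products over `q` are sums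
too. -/
theorem evalMap_bijective {ι : ℤ → Type u} (b : ∀ q, Module.Basis (ι q) S (P.X q))
    [∀ q, Finite (ι q)] {Y : Cplx S} {J : Cplx R} (hY : StrictlyBounded Y)
    (hJ : StrictlyBounded J) : Function.Bijective ((evalMap P Y J).f n) := by
  have (q : ℤ) : Fintype (ι q) := Fintype.ofFinite _
  obtain ⟨N, hN⟩ := hY.exists_window hJ
  -- Relevant `q` satisfy `|n - q| ≤ 2N`, since `n - q` is the degree of an element of `Hom_R(Y, J)`
  -- and both complexes live in `[-N, N]`.
  refine ⟨(injective_iff_map_eq_zero ((evalMap P Y J).f n).hom).2 fun v hv => ?_, fun w =>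
    ⟨∑ q ∈ Finset.Icc (n - 2 * N) (n + 2 * N), ∑ i, tmul (sub_add_cancel n q)
      (evalMapCoeff b w (sub_add_cancel n q) i) (b q i), ?_⟩⟩
  · rw [← tensor_eq_sum b (Finset.Icc (n - 2 * N) (n + 2 * N)) _ v]
    · refine Finset.sum_eq_zero fun q _ => Finset.sum_eq_zero fun i _ => ?_
      have : tensorCoeff b (sub_add_cancel n q) i v = 0 := homFrom_ext fun p r hr y => by
        rw [homFromEval_tensorCoeff b v _ hr (add_sub_cancel q p)]
        have h0 : (evalMap P Y J).f n v = 0 := hv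
        rw [h0]
        simp
      rw [this, zero_tmul]
    · intro q hq a ha
      refine isZero_of_forall fun z => homFrom_ext fun p r h x => ?_
      rw [Finset.mem_Icc] at hq
      by_cases hp : p < -N ∨ N < p
      · rw [eq_zero_of_isZero (hN p hp).1 x, map_zero, map_zero]
      · exact (eq_zero_of_isZero (hN r (by lia)).2 _).trans
          (eq_zero_of_isZero (hN r (by lia)).2 _).symm
  · refine homFrom_ext fun m r hr f => ?_
    by_cases hr' : r < -N ∨ N < r
    · exact (eq_zero_of_isZero (hN r hr').2 _).trans (eq_zero_of_isZero (hN r hr').2 _).symm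
    simp only [map_sum, homFromEval_sum, evalMap_tmul]
    conv_rhs => rw [← homElt_eq_sum b (Finset.Icc (n - 2 * N) (n + 2 * N)) (fun q hq t ht =>
      (hN t (by rw [Finset.mem_Icc] at hq; lia)).1) f]
    simp only [map_sum]
    refine Finset.sum_congr rfl fun q _ => Finset.sum_congr rfl fun i _ => ?_
    rw [homFromEval_evalMapCoeff b w _ _ rfl, smul_eq_units_smul_of_sq]

/-- Up to sign, taking coefficients commutes with evaluation at elements of `L`. Injectivity of
`tensorEvalMap` and the form of its inverse follow. -/
theorem tensorCoeff_homToEval {L : Cplx R} {X : Cplx S}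
    (v : (tensorCplx (homToCplx L X) P).X n) {a q l r t : ℤ} (h : a + q = n) (hr : l + n = r)
    (ht : l + a = t) (i : ι q) (x : L.X l) :
    homToEval (tensorCoeff b h i v) l t ht x = (l * q).negOnePow •
      tensorCoeff b (show t + q = r by lia) i
        (homToEval ((tensorEvalMap L P X).f n v) l r hr x) := by
  induction v using tensor_induction with
  | h0 => simp
  | hadd v v' hv hv' => simp only [map_add, homToEval_add, hv, hv', smul_add]
  | ht a' q' h' z y =>
    rw [tensorEvalMap_tmul, map_units_zsmul]
    by_cases e : q' = q
    · obtain rfl := e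
      obtain rfl : a' = a := by lia
      subst ht
      rw [smul_eq_units_smul_of_sq, tensorCoeff_tmul, tensorCoeff_tmul, homToEval_smul]
    · rw [tensorCoeff_tmul_of_ne _ _ _ _ _ _ e, tensorCoeff_tmul_of_ne _ _ _ _ _ _ e]
      simp

theorem tensorCoeff_smul {X : Cplx S} {a q : ℤ} (h : a + q = n) (i : ι q) (s : S)
    (v : (tensorCplx X P).X n) : tensorCoeff b h i (s • v) = s • tensorCoeff b h i v := by
  induction v using tensor_induction with
  | h0 => simp
  | hadd v v' hv hv' => simp only [smul_add, map_add, hv, hv']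
  | ht a' q' h' x y =>
    rw [← tmul_smul_eq]
    by_cases e : q' = q
    · obtain rfl := e
      obtain rfl : a' = a := by lia
      rw [tensorCoeff_tmul, tensorCoeff_tmul, map_smul, smul_assoc]
    · rw [tensorCoeff_tmul_of_ne _ _ _ _ _ _ e, tensorCoeff_tmul_of_ne _ _ _ _ _ _ e, smul_zero]

/-- The coefficients of the preimage of an element under `tensorEvalMap`. -/
def tensorEvalMapCoeff {L : Cplx R} {X : Cplx S} (w : (homToCplx L (tensorCplx X P)).X n)
    {a q : ℤ} (h : a + q = n) (i : ι q) : (homToCplx L X).X a :=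
  homToMk
    (fun l t ht =>
      { toFun := fun x => (l * q).negOnePow •
          tensorCoeff b (show t + q = l + n by lia) i (homToEval w l (l + n) rfl x)
        map_zero' := by simp
        map_add' := fun y y' => by simp })
    (fun l t ht s x => by
      simpa [homToEval_map_smul, tensorCoeff_smul] using smul_comm _ _ _)

theorem homToEval_tensorEvalMapCoeff {L : Cplx R} {X : Cplx S}
    (w : (homToCplx L (tensorCplx X P)).X n) {a q l t r : ℤ} (h : a + q = n) (ht : l + a = t)
    (hr : l + n = r) (i : ι q) (x : L.X l) :
    homToEval (tensorEvalMapCoeff b w h i) l t ht x = (l * q).negOnePow •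
      tensorCoeff b (show t + q = r by lia) i (homToEval w l r hr x) := by
  subst hr
  simp [tensorEvalMapCoeff]

theorem tensorEvalMap_bijective {ι : ℤ → Type u} (b : ∀ q, Module.Basis (ι q) S (P.X q))
    [∀ q, Finite (ι q)] {L : Cplx R} {X : Cplx S}
    (hX : StrictlyBounded X) (hL : StrictlyBounded L) :
    Function.Bijective ((tensorEvalMap L P X).f n) := by
  have (q : ℤ) : Fintype (ι q) := Fintype.ofFinite _
  obtain ⟨N, hN⟩ := hX.exists_window hL
  refine ⟨(injective_iff_map_eq_zero ((tensorEvalMap L P X).f n).hom).2 fun v hv => ?_, fun w =>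
    ⟨∑ q ∈ Finset.Icc (n - 2 * N) (n + 2 * N), ∑ i, tmul (sub_add_cancel n q)
      (tensorEvalMapCoeff b w (sub_add_cancel n q) i) (b q i), ?_⟩⟩
  · rw [← tensor_eq_sum b (Finset.Icc (n - 2 * N) (n + 2 * N)) _ v]
    · refine Finset.sum_eq_zero fun q _ => Finset.sum_eq_zero fun i _ => ?_
      have : tensorCoeff b (sub_add_cancel n q) i v = 0 := homTo_ext fun p r hr y => by
        rw [tensorCoeff_homToEval b v _ rfl hr]
        have h0 : (tensorEvalMap L P X).f n v = 0 := hv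
        rw [h0]
        simp
      rw [this, zero_tmul]
    · intro q hq a ha
      refine isZero_of_forall fun z => homTo_ext fun p r h x => ?_
      rw [Finset.mem_Icc] at hq
      by_cases hp : p < -N ∨ N < p
      · rw [eq_zero_of_isZero (hN p hp).2 x, map_zero, map_zero]
      · exact (eq_zero_of_isZero (hN r (by lia)).1 _).trans
          (eq_zero_of_isZero (hN r (by lia)).1 _).symm
  · refine homTo_ext fun l r hr x => ?_
    by_cases hl : l < -N ∨ N < l
    · rw [eq_zero_of_isZero (hN l hl).2 x, map_zero, map_zero]
    simp only [map_sum, homToEval_sum, tensorEvalMap_tmul]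
    conv_rhs => rw [← tensor_eq_sum b (Finset.Icc (n - 2 * N) (n + 2 * N)) (fun q hq t ht =>
      (hN t (by rw [Finset.mem_Icc] at hq; lia)).1) (homToEval w l r hr x)]
    refine Finset.sum_congr rfl fun q _ => Finset.sum_congr rfl fun i _ => ?_
    rw [homToEval_tensorEvalMapCoeff b w _ _ hr, units_smul_tmul, smul_eq_units_smul_of_sq]
    -- The two tensors agree except for the expression of the degree of the coefficient.
    have aux : ∀ s s' (hs : s + q = r) (hs' : s' + q = r),
        tmul hs (tensorCoeff b hs i (homToEval w l r hr x)) (b q i) =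
          tmul hs' (tensorCoeff b hs' i (homToEval w l r hr x)) (b q i) := by
      intro s s' hs hs'
      obtain rfl : s = s' := by lia
      rfl
    exact aux _ _ _ _

/-- A complex of finitely generated free modules. -/
def FiniteFree (P : Cplx S) : Prop := ∀ q, Module.Free S (P.X q) ∧ Module.Finite S (P.X q)

theorem quasiIso_evalMap_of_strictlyBounded {P : Cplx S} (hP : FiniteFree P) {Y : Cplx S}
    {J : Cplx R} (hY : StrictlyBounded Y) (hJ : StrictlyBounded J) :
    QuasiIso (evalMap P Y J) := by
  have := fun q => (hP q).1
  have := fun q => (hP q).2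
  exact quasiIso_of_bijective _ fun n =>
    evalMap_bijective (fun q => Module.Free.chooseBasis S (P.X q)) hY hJ

theorem quasiIso_tensorEvalMap_of_strictlyBounded {P : Cplx S} (hP : FiniteFree P) {L : Cplx R}
    {X : Cplx S} (hX : StrictlyBounded X) (hL : StrictlyBounded L) :
    QuasiIso (tensorEvalMap L P X) := by
  have := fun q => (hP q).1
  have := fun q => (hP q).2
  exact quasiIso_of_bijective _ fun n =>
    tensorEvalMap_bijective (fun q => Module.Free.chooseBasis S (P.X q)) hX hL

end FiniteFree

/-! ### Character duality -/

section Characters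

variable (R : Type u) {S : Type u} [CommRing R] [CommRing S] [Algebra R S]

theorem injective_of_flat (M : Type u) [AddCommGroup M] [Module R M] [Module.Flat R M] :
    Module.Injective R (CharacterModule M) :=
  Module.Flat.iff_characterModule_injective.1 inferInstance

theorem injective_object (M : ModuleCat.{u} R) [Module.Injective R M] : Injective M :=
  Module.injective_object_of_injective_module (R := R) (M := M)

/-- The character module of `R` as a complex in degree zero. -/
def charCplx : Cplx R :=
  (HomologicalComplex.single (ModuleCat.{u} R) (ComplexShape.up ℤ) 0).obj
    (ModuleCat.of R (CharacterModule R))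

theorem isZero_charCplx (n : ℤ) (hn : n ≠ 0) : Limits.IsZero ((charCplx R).X n) :=
  HomologicalComplex.isZero_single_obj_X _ _ _ _ hn

theorem strictlyBounded_charCplx : StrictlyBounded (charCplx R) :=
  ⟨0, 0, fun n hn => isZero_charCplx R n (by lia)⟩

theorem injective_charCplx (n : ℤ) : Injective ((charCplx R).X n) := by
  by_cases h : n = 0
  · subst h
    have := injective_of_flat R R
    have := injective_object R (ModuleCat.of R (CharacterModule R))
    exact Injective.of_iso (HomologicalComplex.singleObjXSelf (ComplexShape.up ℤ) 0
      (ModuleCat.of R (CharacterModule R))).symm this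
  · exact (Limits.IsZero.injective (isZero_charCplx R n h))

instance isKInjective_charCplx : (charCplx R).IsKInjective := by
  have : (charCplx R).IsStrictlyGE 0 :=
    (CochainComplex.isStrictlyGE_iff _ _).2 fun n hn => isZero_charCplx R n hn.ne
  have := injective_charCplx R
  exact CochainComplex.isKInjective_of_injective _ 0

/-- The nonzero component of `charCplx`. -/
def charCplxEquiv : (charCplx R).X 0 ≃ₗ[R] CharacterModule R :=
  (HomologicalComplex.singleObjXSelf (ComplexShape.up ℤ) 0
      (ModuleCat.of R (CharacterModule R))).toLinearEquiv

/-- A character from an additive function. -/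
def mkCharacter {M : Type u} [AddCommGroup M] (f : M → AddCircle (1 : ℚ))
    (hf : ∀ x y, f (x + y) = f x + f y) : CharacterModule M :=
  AddMonoidHom.mk' f hf

theorem mkCharacter_apply {M : Type u} [AddCommGroup M] (f : M → AddCircle (1 : ℚ))
    (hf : ∀ x y, f (x + y) = f x + f y) (x : M) : mkCharacter f hf x = f x := rfl

theorem character_add_apply {M : Type u} [AddCommGroup M] (c c' : CharacterModule M) (x : M) :
    (c + c') x = c x + c' x := rfl

theorem character_units_smul_apply {M : Type u} [AddCommGroup M] (e : ℤˣ) (c : CharacterModule M)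
    (x : M) : (e • c) x = e • c x := by
  obtain rfl | rfl := Int.units_eq_one_or e
  · rw [one_smul, one_smul]
  · rw [Units.neg_smul, Units.neg_smul, one_smul, one_smul]
    rfl

variable (S) in
/-- The homomorphism to the character module of `R` defined by a character. -/
def characterCurry {M : Type u} [AddCommGroup M] [Module S M] (c : CharacterModule M) :
    M →+ CharacterModule R :=
  AddMonoidHom.mk' (fun x => mkCharacter (fun r => c (algebraMap R S r • x)) fun r r' => by
    rw [map_add, add_smul, map_add]) fun x y => CharacterModule.ext _ fun r => by
      rw [character_add_apply]
      simp only [mkCharacter_apply, smul_add, map_add]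

theorem characterCurry_apply {M : Type u} [AddCommGroup M] [Module S M] (c : CharacterModule M)
    (x : M) (r : R) : characterCurry R S c x r = c (algebraMap R S r • x) := rfl

theorem characterCurry_smul {M : Type u} [AddCommGroup M] [Module S M] (c : CharacterModule M)
    (x : M) (r : R) : characterCurry R S c (algebraMap R S r • x) = r • characterCurry R S c x :=
  CharacterModule.ext _ fun r' => by
    rw [characterCurry_apply, CharacterModule.smul_apply, characterCurry_apply, smul_smul,
      ← map_mul, smul_eq_mul, mul_comm]

variable {R} {X : Cplx S} {n m : ℤ}

/-- The element of `Hom_R(X, charCplx R)` defined by a character. -/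
def ofCharacter (h : n + m = 0) (c : CharacterModule (X.X n)) : (homFromCplx X (charCplx R)).X m :=
  homFromMk
    (fun p q hpq =>
      if e : p = n then
        { toFun := fun x => ((charCplx R).XIsoOfEq (show 0 = q by lia)).hom
            ((charCplxEquiv R).symm (characterCurry R S c ((X.XIsoOfEq e).hom x)))
          map_zero' := by simp only [map_zero]
          map_add' := fun x y => by
            simp only [map_add] }
      else 0)
    (fun p q hpq r x => by
      split_ifs with e
      · change ((charCplx R).XIsoOfEq (show 0 = q by lia)).hom
            ((charCplxEquiv R).symm (characterCurry R S c ((X.XIsoOfEq e).hom _))) =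
          r • ((charCplx R).XIsoOfEq (show 0 = q by lia)).hom
            ((charCplxEquiv R).symm (characterCurry R S c ((X.XIsoOfEq e).hom x)))
        rw [map_smul, characterCurry_smul, map_smul, map_smul]
      · exact (smul_zero r).symm)

theorem homFromEval_ofCharacter (h h' : n + m = 0) (c : CharacterModule (X.X n)) (x : X.X n)
    (r : R) :
    charCplxEquiv R (homFromEval (ofCharacter h c) n 0 h' x) r = c (algebraMap R S r • x) := by
  rw [ofCharacter, homFromEval_homFromMk, dif_pos rfl]
  change charCplxEquiv R ((charCplxEquiv R).symm (characterCurry R S c x)) r = _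
  rw [LinearEquiv.apply_symm_apply]
  rfl

variable (R X) in
/-- Homomorphisms to the character module of `R` correspond to characters. -/
def characterEquiv (h : n + m = 0) :
    (homFromCplx X (charCplx R)).X m ≃ₗ[S] CharacterModule (X.X n) where
  toFun z := mkCharacter (fun x => charCplxEquiv R (homFromEval z n 0 h x) (1 : R)) fun x y => by
    rw [map_add, map_add]
    rfl
  map_add' z w := CharacterModule.ext _ fun x => by
    change charCplxEquiv R (homFromEval (z + w) n 0 h x) (1 : R) = _
    rw [homFromEval_add, map_add]
    rfl
  map_smul' s z := CharacterModule.ext _ fun x => by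
    change charCplxEquiv R (homFromEval (s • z) n 0 h x) (1 : R) = _
    rw [homFromEval_smul]
    rfl
  invFun := ofCharacter h
  left_inv z := homFrom_ext fun p q hpq x => by
    by_cases e : p = n
    · obtain rfl := e
      obtain rfl : 0 = q := by lia
      refine (charCplxEquiv R).injective (CharacterModule.ext _ fun r => ?_)
      rw [homFromEval_ofCharacter]
      change charCplxEquiv R (homFromEval z p 0 h _) (1 : R) = _
      rw [homFromEval_map_smul, map_smul, CharacterModule.smul_apply, smul_eq_mul, mul_one]
    · exact (eq_zero_of_isZero (isZero_charCplx R q (by lia)) _).trans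
        (eq_zero_of_isZero (isZero_charCplx R q (by lia)) _).symm
  right_inv c := CharacterModule.ext _ fun x =>
    (homFromEval_ofCharacter h h c x 1).trans (by rw [map_one, one_smul])

theorem characterEquiv_apply (h : n + m = 0) (z : (homFromCplx X (charCplx R)).X m) (x : X.X n) :
    characterEquiv R X h z x = charCplxEquiv R (homFromEval z n 0 h x) (1 : R) := rfl

/-- The target is concentrated in degree zero, so only the term precomposing with the differential
of `X` survives: up to sign the differential is the transpose. -/
theorem characterEquiv_d {n' m' : ℤ} (h : n + m = 0) (hm : m + 1 = m') (hn : n' + 1 = n)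
    (z : (homFromCplx X (charCplx R)).X m) (x : X.X n') :
    characterEquiv R X (show n' + m' = 0 by lia) ((homFromCplx X (charCplx R)).d m m' z) x =
      m'.negOnePow • characterEquiv R X h z (X.d n' n x) := by
  rw [characterEquiv_apply, characterEquiv_apply, homFromEval_d hm z _ hn (sub_add_cancel 0 1),
    eq_zero_of_isZero (isZero_charCplx R (0 - 1) (by lia)) (homFromEval z n' (0 - 1) _ x),
    map_zero, zero_add, map_units_zsmul]
  exact character_units_smul_apply _ _ _

theorem characterEquiv_premap {Y : Cplx S} (f : X ⟶ Y) (h : n + m = 0)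
    (z : (homFromCplx Y (charCplx R)).X m) (x : X.X n) :
    characterEquiv R X h ((homFromPremap f (charCplx R)).f m z) x =
      characterEquiv R Y h z (f.f n x) := by
  rw [characterEquiv_apply, characterEquiv_apply, homFromEval_homFromPremap]

/-- Characters separate the points of the quotient of `M` by `N`. -/
theorem exists_character {M : Type u} [AddCommGroup M] (N : AddSubgroup M) {y : M} (hy : y ∉ N) :
    ∃ c : CharacterModule M, (∀ x ∈ N, c x = 0) ∧ c y ≠ 0 := by
  obtain ⟨c, hc⟩ := CharacterModule.exists_character_apply_ne_zero_of_ne_zero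
    (a := QuotientAddGroup.mk' N y) (fun h => hy ((QuotientAddGroup.eq_zero_iff y).1 h))
  refine ⟨AddMonoidHom.comp c (QuotientAddGroup.mk' N), fun x hx => ?_, hc⟩
  exact (congr_arg c ((QuotientAddGroup.eq_zero_iff x).2 hx)).trans (map_zero c)

/-- The character factors through the range of `f` and extends to `N`, because `ℚ/ℤ` is injective.
-/
theorem exists_character_comp {M N : Type u} [AddCommGroup M] [AddCommGroup N] (f : M →+ N)
    (c : CharacterModule M) (hc : ∀ x, f x = 0 → c x = 0) :
    ∃ c' : CharacterModule N, ∀ x, c' (f x) = c x := by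
  obtain ⟨c', hc'⟩ := CharacterModule.dual_surjective_of_injective
    f.range.subtype.toIntLinearMap Subtype.val_injective
    ((QuotientAddGroup.lift f.ker c hc).comp
      (QuotientAddGroup.quotientKerEquivRange f).symm.toAddMonoidHom)
  refine ⟨c', fun x => (congr($hc' (f.rangeRestrict x))).trans ?_⟩
  change QuotientAddGroup.lift f.ker c hc ((QuotientAddGroup.quotientKerEquivRange f).symm _) = _
  have : f.rangeRestrict x = QuotientAddGroup.quotientKerEquivRange f (QuotientAddGroup.mk x) := rfl
  rw [this, AddEquiv.symm_apply_apply]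
  rfl

/-- A cocycle of `Hom_R(X, charCplx R)` from a character vanishing on boundaries. -/
theorem characterEquiv_symm_d {n' m' : ℤ} (h : n + m = 0) (hm : m + 1 = m') (hn : n' + 1 = n)
    (c : CharacterModule (X.X n)) (hc : ∀ x, c (X.d n' n x) = 0) :
    (homFromCplx X (charCplx R)).d m m' ((characterEquiv R X h).symm c) = 0 :=
  (characterEquiv R X (show n' + m' = 0 by lia)).injective (CharacterModule.ext _ fun x => by
    rw [characterEquiv_d h hm hn, LinearEquiv.apply_symm_apply, hc, smul_zero, map_zero]
    rfl)

theorem characterEquiv_apply_d {n' m' : ℤ} (h : n + m = 0) (hm : m + 1 = m') (hn : n' + 1 = n)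
    {z : (homFromCplx X (charCplx R)).X m} (hz : (homFromCplx X (charCplx R)).d m m' z = 0)
    (x : X.X n') : characterEquiv R X h z (X.d n' n x) = 0 := by
  have h1 := characterEquiv_d h hm hn z x
  rw [hz, map_zero] at h1
  exact (smul_eq_zero_iff_eq (m'.negOnePow)).1 h1.symm

/-- A character vanishing on cocycles defines a boundary of `Hom_R(X, charCplx R)`. -/
theorem exists_d_eq_characterEquiv_symm {n' m' : ℤ} (h : n + m = 0) (hm : m' + 1 = m)
    (hn : n + 1 = n') (c : CharacterModule (X.X n)) (hc : ∀ x, X.d n n' x = 0 → c x = 0) :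
    ∃ w, (homFromCplx X (charCplx R)).d m' m w = (characterEquiv R X h).symm c := by
  obtain ⟨c', hc'⟩ := exists_character_comp (X.d n n').hom.toAddMonoidHom c hc
  refine ⟨m.negOnePow • (characterEquiv R X (show n' + m' = 0 by lia)).symm c',
    (characterEquiv R X h).injective (CharacterModule.ext _ fun x => ?_)⟩
  rw [map_units_zsmul, map_units_zsmul, LinearEquiv.apply_symm_apply]
  refine (character_units_smul_apply _ _ x).trans ?_
  rw [characterEquiv_d (show n' + m' = 0 by lia) hm hn, LinearEquiv.apply_symm_apply, smul_eq_units_smul_of_sq]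
  exact hc' x

-- Characters detect homology: injectivity of `f` in degree `n` comes from surjectivity of its dual
-- in degree `-n`, and surjectivity from injectivity.
variable (R) in
theorem quasiIso_of_quasiIso_homFromPremap {Y : Cplx S} (f : X ⟶ Y)
    [hf : QuasiIso (homFromPremap f (charCplx R))] : QuasiIso f := by
  refine quasiIso_of_forall f (fun l n k hl hk x hx ⟨y, hy⟩ => ?_) fun l n k hl hk y hy => ?_
  · by_contra hcon
    -- A character `c` killing boundaries but not `x` is a cocycle, hence of the form `z ∘ f` plus a
    -- coboundary. The first term kills `x` because `f x` is a boundary and `z` a cocycle, the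
    -- second because `dx = 0`.
    obtain ⟨c, hc, hcx⟩ := exists_character (X.d l n).hom.range.toAddSubgroup (y := x) hcon
    have hnm : n + -n = 0 := by lia
    obtain ⟨z, w, hz, hzw⟩ := ((quasiIsoAt_iff_forall _ (show -n - 1 + 1 = -n by lia)
      (show -n + 1 = -n + 1 from rfl)).1 (hf.quasiIsoAt (-n))).2 ((characterEquiv R X hnm).symm c)
      (characterEquiv_symm_d hnm rfl hl c fun x => hc _ ⟨x, rfl⟩)
    have h1 := congr(characterEquiv R X hnm $hzw x)
    rw [LinearEquiv.apply_symm_apply, map_add, character_add_apply, characterEquiv_premap, ← hy,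
      characterEquiv_apply_d hnm rfl hl hz, characterEquiv_d (show k + (-n - 1) = 0 by lia) (by lia)
      hk, hx, map_zero, smul_zero, zero_add] at h1
    exact hcx h1.symm
  · let N : AddSubgroup (Y.X n) :=
      ((X.d n k).hom.ker.map (f.f n).hom ⊔ (Y.d l n).hom.range).toAddSubgroup
    by_cases hyN : y ∈ N
    · obtain ⟨_, ⟨x, hx, rfl⟩, _, ⟨v, rfl⟩, rfl⟩ := Submodule.mem_sup.1 hyN
      exact ⟨x, v, hx, rfl⟩
    · exfalso
      obtain ⟨c, hc, hcy⟩ := exists_character N hyN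
      have hnm : n + -n = 0 := by lia
      have hd : ∀ v, c (Y.d l n v) = 0 := fun v =>
        hc _ (Submodule.mem_sup_right (show _ ∈ (Y.d l n).hom.range from ⟨v, rfl⟩))
      obtain ⟨w, hw⟩ := ((quasiIsoAt_iff_forall _ (show -n - 1 + 1 = -n by lia)
        (show -n + 1 = -n + 1 from rfl)).1 (hf.quasiIsoAt (-n))).1 ((characterEquiv R Y hnm).symm c)
        (characterEquiv_symm_d hnm rfl hl c hd) (by
          have h0 : ∀ x, X.d n k x = 0 →
              CharacterModule.dual (R := S) (f.f n).hom c x = 0 := fun x hx =>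
            hc _ (Submodule.mem_sup_left
              (show _ ∈ (X.d n k).hom.ker.map (f.f n).hom from ⟨x, hx, rfl⟩))
          obtain ⟨w, hw⟩ := exists_d_eq_characterEquiv_symm (R := R) hnm
            (show -n - 1 + 1 = -n by lia) hk _ h0
          refine ⟨w, hw.trans ((characterEquiv R X hnm).injective
            (CharacterModule.ext _ fun x => ?_))⟩
          rw [characterEquiv_premap, LinearEquiv.apply_symm_apply, LinearEquiv.apply_symm_apply]
          rfl)
      have h1 := congr(characterEquiv R Y hnm $hw y)
      rw [LinearEquiv.apply_symm_apply, characterEquiv_d (show k + (-n - 1) = 0 by lia) (by lia)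
        hk, hy, map_zero, smul_zero] at h1
      exact hcy h1.symm

variable (R) in
theorem exactAt_homFromCplx_charCplx_iff (h : n + m = 0) :
    (homFromCplx X (charCplx R)).ExactAt m ↔ X.ExactAt n := by
  rw [exactAt_iff_forall (sub_add_cancel m 1) rfl, exactAt_iff_forall (sub_add_cancel n 1) rfl]
  refine ⟨fun H x hx => ?_, fun H z hz => ?_⟩
  · by_contra hcon
    obtain ⟨c, hc, hcx⟩ := exists_character (X.d (n - 1) n).hom.range.toAddSubgroup (y := x) hcon
    obtain ⟨w, hw⟩ := H _ (characterEquiv_symm_d h rfl (sub_add_cancel n 1) c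
      fun x => hc _ ⟨x, rfl⟩)
    have h1 := congr(characterEquiv R X h $hw x)
    rw [LinearEquiv.apply_symm_apply, characterEquiv_d (show n + 1 + (m - 1) = 0 by lia) (by lia)
      rfl, hx, map_zero, smul_zero] at h1
    exact hcx h1.symm
  · obtain ⟨w, hw⟩ := exists_d_eq_characterEquiv_symm (R := R) h (sub_add_cancel m 1) rfl
      (characterEquiv R X h z) fun x hx => by
        obtain ⟨y, rfl⟩ := H x hx
        exact characterEquiv_apply_d h rfl (sub_add_cancel n 1) hz y
    exact ⟨w, hw.trans (LinearEquiv.symm_apply_apply _ _)⟩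

variable (R) in
theorem homologyBounded_homFromCplx_charCplx_iff :
    HomologyBounded (homFromCplx X (charCplx R)) ↔ HomologyBounded X := by
  refine ⟨fun ⟨a, b, h⟩ => ⟨-b, -a, fun n hn => ?_⟩, fun ⟨a, b, h⟩ => ⟨-b, -a, fun n hn => ?_⟩⟩
  · exact (exactAt_homFromCplx_charCplx_iff R (show n + -n = 0 by lia)).1 (h _ (by lia))
  · exact (exactAt_homFromCplx_charCplx_iff R (show -n + n = 0 by lia)).2 (h _ (by lia))

/-- Each component is the character module of a flat module, which is injective. -/
theorem injective_homFromCplx_charCplx (L : Cplx R) (hL : ∀ n, Module.Flat R (L.X n)) (n : ℤ) :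
    Module.Injective R ((homFromCplx L (charCplx R)).X n) := by
  have := injective_of_flat R (L.X (-n))
  rw [← Module.Baer.iff_injective] at this ⊢
  exact (Module.Baer.congr (characterEquiv R L (show -n + n = 0 by lia))).2 this

/-- K-projective complexes are K-flat: by adjunction the character dual of `f ⊗ P` is `Hom(P, -)`
applied to the dual of `f`, and characters detect quasi-isomorphisms. -/
theorem quasiIso_tensorMap_left {X' : Cplx S} (f : X ⟶ X') [QuasiIso f] (P : Cplx S)
    [P.IsKProjective] : QuasiIso (tensorMap f (𝟙 P)) := by
  have := quasiIso_homFromPremap f (charCplx S)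
  have := quasiIso_homMap P (homFromPremap f (charCplx S))
  have : QuasiIso (homFromPremap (tensorMap f (𝟙 P)) (charCplx S) ≫
      curryMap X P (charCplx S)) := by
    rw [curryMap_naturality_left]
    infer_instance
  have := quasiIso_of_comp_right (homFromPremap (tensorMap f (𝟙 P)) (charCplx S))
    (curryMap X P (charCplx S))
  exact quasiIso_of_quasiIso_homFromPremap S _

theorem quasiIso_tensorMap_right (X : Cplx S) {P P' : Cplx S} (h : P ⟶ P') [QuasiIso h]
    [P.IsKProjective] [P'.IsKProjective] : QuasiIso (tensorMap (𝟙 X) h) := by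
  have := quasiIso_homPremap h (homFromCplx X (charCplx S))
  have : QuasiIso (homFromPremap (tensorMap (𝟙 X) h) (charCplx S) ≫
      curryMap X P (charCplx S)) := by
    rw [curryMap_naturality_right]
    infer_instance
  have := quasiIso_of_comp_right (homFromPremap (tensorMap (𝟙 X) h) (charCplx S))
    (curryMap X P (charCplx S))
  exact quasiIso_of_quasiIso_homFromPremap S _

end Characters

/-! ### Resolutions by finitely generated free modules -/

section FiniteFreeResolution

variable {S : Type u} [CommRing S]

theorem exists_generating_cocycles (C : Cplx S) (n : ℤ) [h : Module.Finite S (C.homology n)] {l m : ℤ}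
    (hl : l + 1 = n) (hm : n + 1 = m) :
    ∃ (r : ℕ) (g : (Fin r → S) →ₗ[S] C.X n), (∀ p, C.d n m (g p) = 0) ∧
      ∀ z, C.d n m z = 0 → ∃ p y, g p + C.d l n y = z := by
  obtain rfl : (ComplexShape.up ℤ).prev n = l := by simp; lia
  obtain rfl : (ComplexShape.up ℤ).next n = m := by simp; lia
  have h' : Module.Finite S ((C.sc n).g.hom.ker ⧸ LinearMap.range (C.sc n).moduleCatToCycles) :=
    h.equiv (C.sc n).moduleCatHomologyIso.toLinearEquiv
  obtain ⟨r, f, hf⟩ := Module.Finite.exists_fin' S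
    ((C.sc n).g.hom.ker ⧸ LinearMap.range (C.sc n).moduleCatToCycles)
  obtain ⟨g, hg⟩ := Module.projective_lifting_property
    (LinearMap.range (C.sc n).moduleCatToCycles).mkQ f (Submodule.mkQ_surjective _)
  refine ⟨r, (C.sc n).g.hom.ker.subtype ∘ₗ g, fun p => (g p).2, fun z hz => ?_⟩
  obtain ⟨p, hp⟩ := hf (Submodule.Quotient.mk ⟨z, hz⟩)
  rw [← hg] at hp
  obtain ⟨y, hy⟩ := (Submodule.Quotient.eq _).1 hp
  let c : C.X n := (g p).1
  let w : C.X ((ComplexShape.up ℤ).prev n) := y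
  -- Equality in the quotient makes `c - z` a boundary, whence the minus sign in the witness `-w`.
  have h1 : C.d _ n w = c - z := congr_arg Subtype.val hy
  refine ⟨p, -w, ?_⟩
  change c + C.d _ n (-w) = z
  rw [map_neg, h1, neg_sub, add_sub_cancel]

variable (C : Cplx S)

/-- A step in the construction of a resolution of `C` by finite free modules. -/
structure ResolutionStage (n : ℤ) where
  /-- the rank -/
  rank : ℕ
  /-- the augmentation -/
  toComplex : (Fin rank → S) →ₗ[S] C.X n
  /-- the cocycles -/
  cocycles : Submodule S (Fin rank → S)
  surjective : ∀ l m, l + 1 = n → n + 1 = m → ∀ z, C.d n m z = 0 →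
    ∃ p ∈ cocycles, ∃ y, toComplex p + C.d l n y = z

variable {C}

/-- The compatibility of consecutive stages. -/
structure IsResolutionStep {n m : ℤ} (s : ResolutionStage C n) (t : ResolutionStage C m)
    (δ : (Fin s.rank → S) →ₗ[S] (Fin t.rank → S)) : Prop where
  ker_eq : δ.ker = s.cocycles
  comm : ∀ p, t.toComplex (δ p) = C.d n m (s.toComplex p)
  mem : ∀ p, δ p ∈ t.cocycles
  exact : ∀ p ∈ t.cocycles, ∀ y, t.toComplex p = C.d n m y → ∃ q, δ q = p

/-- The new module is `S^a ⊕ S^b`. The summand `S^a` is killed by `δ` and maps onto generators of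
the homology of `C` in degree `n`; the summand `S^b` kills the cocycles of the next stage that
become boundaries in `C`. -/
theorem exists_resolutionStep [IsNoetherianRing S] (hC : HomologyFinite C) {n m : ℤ}
    (h : n + 1 = m) (t : ResolutionStage C m) :
    ∃ (s : ResolutionStage C n) (δ : (Fin s.rank → S) →ₗ[S] (Fin t.rank → S)),
      IsResolutionStep s t δ := by
  have := hC n
  obtain ⟨a, g, hg, hg'⟩ := exists_generating_cocycles C n (sub_add_cancel n 1) h
  -- These are the cocycles one degree up whose image in `C` is a boundary. They are finitely
  -- generated because `S` is noetherian.
  let B : Submodule S (Fin t.rank → S) :=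
    t.cocycles ⊓ (C.d n m).hom.range.comap t.toComplex
  obtain ⟨b, f, hf⟩ := Module.Finite.exists_fin' S B
  -- The augmentation on `S^b` is a choice of elements of `C` bounding the images of the generators
  -- of `B`.
  obtain ⟨c, hc⟩ := Module.projective_lifting_property (C.d n m).hom.rangeRestrict
    (((t.toComplex ∘ₗ B.subtype).codRestrict (C.d n m).hom.range fun x => x.2.2) ∘ₗ f)
    (LinearMap.surjective_rangeRestrict _)
  have hc' : ∀ p, C.d n m (c p) = t.toComplex (f p) := fun p =>
    congr_arg Subtype.val (congr($hc p))
  let e : (Fin (a + b) → S) ≃ₗ[S] (Fin a → S) × (Fin b → S) :=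
    (LinearEquiv.funCongrLeft S S finSumFinEquiv) ≪≫ₗ LinearEquiv.sumArrowLequivProdArrow _ _ S S
  let δ : (Fin (a + b) → S) →ₗ[S] (Fin t.rank → S) :=
    B.subtype ∘ₗ f ∘ₗ LinearMap.snd S _ _ ∘ₗ e.toLinearMap
  let φ : (Fin (a + b) → S) →ₗ[S] C.X n := (g.coprod c) ∘ₗ e.toLinearMap
  have hφ : ∀ p, t.toComplex (δ p) = C.d n m (φ p) := fun p => by
    change t.toComplex (f (e p).2) = C.d n m (g (e p).1 + c (e p).2)
    rw [map_add, hg, hc', zero_add]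
  refine ⟨⟨a + b, φ, δ.ker, fun l m' hl hm z hz => ?_⟩, δ, rfl, hφ, fun p => (f _).2.1,
    fun p hp y hy => ?_⟩
  · obtain rfl : m = m' := by lia
    obtain rfl : n - 1 = l := by lia
    obtain ⟨p, y, hy⟩ := hg' z hz
    refine ⟨e.symm (p, 0), ?_, y, ?_⟩
    · change ((f (e (e.symm (p, 0))).2 : B) : Fin t.rank → S) = 0
      rw [e.apply_symm_apply, map_zero]
      rfl
    · change g (e (e.symm (p, 0))).1 + c (e (e.symm (p, 0))).2 + _ = _
      rw [e.apply_symm_apply, map_zero, add_zero, hy]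
  · obtain ⟨q, hq⟩ := hf ⟨p, hp, y, hy.symm⟩
    refine ⟨e.symm (0, q), ?_⟩
    change ((f (e (e.symm (0, q))).2 : B) : Fin t.rank → S) = p
    rw [e.apply_symm_apply, hq]

variable (C) in
/-- The zero stage in a degree where `C` is exact. -/
def zeroStage (n : ℤ) (hn : C.ExactAt n) : ResolutionStage C n where
  rank := 0
  toComplex := 0
  cocycles := ⊤
  surjective l m hl hm z hz := by
    obtain ⟨y, hy⟩ := (exactAt_iff_forall hl hm).1 hn z hz
    exact ⟨0, trivial, y, by rw [hy]; exact zero_add z⟩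

theorem isResolutionStep_zeroStage {n m : ℤ} (hn : C.ExactAt n) (hm : C.ExactAt m) :
    IsResolutionStep (zeroStage C n hn) (zeroStage C m hm) 0 where
  ker_eq := LinearMap.ker_zero
  comm p := (map_zero (C.d n m).hom).symm
  mem p := trivial
  exact p _ y hy := ⟨0, by
    have : Subsingleton (Fin (zeroStage C m hm).rank → S) :=
      inferInstanceAs (Subsingleton (Fin 0 → S))
    exact Subsingleton.elim _ _⟩

variable [IsNoetherianRing S] (hC : HomologyFinite C) (b : ℤ) (hb : ∀ n, b < n → C.ExactAt n)

/-- The stages of a resolution by finite free modules. -/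
def resolutionStage (n : ℤ) : ResolutionStage C n :=
  if h : b < n then zeroStage C n (hb n h)
  else (exists_resolutionStep hC rfl (resolutionStage (n + 1))).choose
-- The recursion moves upward until the degree exceeds `b`, where `C` is exact and the stages are
-- zero.
termination_by (b + 1 - n).toNat

theorem exists_isResolutionStep (n : ℤ) :
    ∃ δ, IsResolutionStep (resolutionStage hC b hb n) (resolutionStage hC b hb (n + 1)) δ := by
  by_cases h : b < n
  · rw [resolutionStage.eq_def, dif_pos h, resolutionStage.eq_def, dif_pos (by lia)]
    exact ⟨_, isResolutionStep_zeroStage _ _⟩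
  · rw [resolutionStage.eq_def, dif_neg h]
    exact (exists_resolutionStep hC rfl (resolutionStage hC b hb (n + 1))).choose_spec

/-- Splicing the stages gives a complex of free modules vanishing above `b`, hence K-projective. In
each degree, surjectivity on homology is the field `surjective` of the stage, and injectivity is the
field `exact` of the step ending there. -/
theorem exists_finiteFree_resolution (hC : HomologyFinite C) (hC' : HomologyBounded C) :
    ∃ P : KProjRes C, FiniteFree P.P := by
  obtain ⟨_, b, hab⟩ := hC'
  have hb : ∀ n, b < n → C.ExactAt n := fun n hn => hab n (Or.inr hn)
  let s := resolutionStage hC b hb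
  choose δ hδ using exists_isResolutionStep hC b hb
  let P : Cplx S := CochainComplex.of (fun n => ModuleCat.of S (Fin (s n).rank → S))
    (fun n => ModuleCat.ofHom (δ n)) fun n => ModuleCat.hom_ext (LinearMap.ext fun x => by
      have h1 := (hδ n).mem x
      rw [← (hδ (n + 1)).ker_eq] at h1
      exact h1)
  have hPd (n : ℤ) (x : P.X n) : P.d n (n + 1) x = δ n x :=
    congr($(CochainComplex.of_d (fun n => ModuleCat.of S (Fin (s n).rank → S))
      (fun n => ModuleCat.ofHom (δ n)) n).hom x)
  let π : P ⟶ C :=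
    { f := fun n => ModuleCat.ofHom (s n).toComplex
      comm' := fun n m hnm => by
        obtain rfl : n + 1 = m := hnm
        refine ModuleCat.hom_ext (LinearMap.ext fun x => ?_)
        change C.d n (n + 1) ((s n).toComplex x) = (s (n + 1)).toComplex (P.d n (n + 1) x)
        rw [hPd]
        exact ((hδ n).comm x).symm }
  have hπ : QuasiIso π := quasiIso_of_forall π
    (fun l n m hl hm x hx ⟨y, hy⟩ => by
      subst hl hm
      rw [hPd] at hx
      obtain ⟨q, hq⟩ := (hδ l).exact x ((hδ (l + 1)).ker_eq ▸ hx) y hy.symm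
      exact ⟨q, (hPd l q).trans hq⟩)
    (fun l n m hl hm z hz => by
      subst hl hm
      obtain ⟨p, hp, y, hy⟩ := (s (l + 1)).surjective l _ rfl rfl z hz
      refine ⟨p, y, ?_, hy⟩
      rw [hPd]
      rw [← (hδ (l + 1)).ker_eq] at hp
      exact hp)
  have hfree : FiniteFree P := fun n =>
    ⟨inferInstanceAs (Module.Free S (Fin (s n).rank → S)),
      inferInstanceAs (Module.Finite S (Fin (s n).rank → S))⟩
  have hproj (n : ℤ) : Projective (P.X n) :=
    ModuleCat.projective_of_free (Pi.basisFun S (Fin (s n).rank))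
  have : P.IsStrictlyLE b := (CochainComplex.isStrictlyLE_iff _ _).2 fun n hn => by
    refine isZero_of_forall fun x => ?_
    change Fin (resolutionStage hC b hb n).rank → S at x
    have h0 : (resolutionStage hC b hb n).rank = 0 := by
      rw [resolutionStage.eq_def, dif_pos hn]
      rfl
    have : Subsingleton (P.X n) := by
      change Subsingleton (Fin (resolutionStage hC b hb n).rank → S)
      rw [h0]
      infer_instance
    exact Subsingleton.elim (α := P.X n) _ _
  exact ⟨⟨P, π, CochainComplex.isKProjective_of_projective P b, hπ⟩, hfree⟩

end FiniteFreeResolution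

/-! ### Independence of the resolution and invariance under quasi-isomorphism -/

section Independence

variable {R S : Type u} [CommRing R] [CommRing S] [Algebra R S] {P P' X X' : Cplx S}

theorem HomologyBounded.iff_of_quasiIso (f : X ⟶ X') [QuasiIso f] :
    HomologyBounded X ↔ HomologyBounded X' :=
  ⟨.of_quasiIso f, .of_quasiIso' f⟩

theorem quasiIso_iff_of_comp_eq {K L K' L' : Cplx S} {f : K ⟶ L} {g : L ⟶ L'} {f' : K ⟶ K'}
    {g' : K' ⟶ L'} (h : f ≫ g = f' ≫ g') [QuasiIso g] [QuasiIso f'] :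
    QuasiIso f ↔ QuasiIso g' := by
  rw [← quasiIso_iff_comp_right f g, h, quasiIso_iff_comp_left]

theorem quasiIso_iff_of_comp_eq' {K L K' L' : Cplx S} {f : K ⟶ L} {g : L ⟶ L'} {f' : K ⟶ K'}
    {g' : K' ⟶ L'} (h : f ≫ g = f' ≫ g') [QuasiIso f] [QuasiIso g'] :
    QuasiIso g ↔ QuasiIso f' := by
  rw [← quasiIso_iff_comp_left f g, h, quasiIso_iff_comp_right]

/-- The conditions defining the Auslander class, for one resolution. -/
def InAuslanderA (P X : Cplx S) : Prop :=
  HomologyBounded X ∧ HomologyBounded (tensorCplx X P) ∧ QuasiIso (unitMap P X)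

/-- The conditions defining the Bass class, for one resolution. -/
def InAuslanderB (P Y : Cplx S) : Prop :=
  HomologyBounded Y ∧ HomologyBounded (homCplx P Y) ∧ QuasiIso (counitMap P Y)

/-- In the dinaturality square of the unit all arrows but the two units are quasi-isomorphisms, by
K-projectivity. -/
theorem inAuslanderA_iff_of_quasiIso_left [P.IsKProjective] [P'.IsKProjective] (h : P ⟶ P')
    [QuasiIso h] : InAuslanderA P X ↔ InAuslanderA P' X := by
  have := quasiIso_tensorMap_right X h
  have := quasiIso_homMap P (tensorMap (𝟙 X) h)
  have := quasiIso_homPremap h (tensorCplx X P')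
  rw [InAuslanderA, InAuslanderA, HomologyBounded.iff_of_quasiIso (tensorMap (𝟙 X) h)]
  have h1 := unitMap_dinaturality h X
  rw [← quasiIso_iff_comp_right (unitMap P X) (homMap P (tensorMap (𝟙 X) h)), h1,
    quasiIso_iff_comp_right]

theorem inAuslanderB_iff_of_quasiIso_left [P.IsKProjective] [P'.IsKProjective] (h : P ⟶ P')
    [QuasiIso h] : InAuslanderB P X ↔ InAuslanderB P' X := by
  have := quasiIso_homPremap h X
  have := quasiIso_tensorMap_left (homPremap h X) P
  have := quasiIso_tensorMap_right (homCplx P' X) h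
  rw [InAuslanderB, InAuslanderB, ← HomologyBounded.iff_of_quasiIso (homPremap h X)]
  have h1 := counitMap_dinaturality h X
  rw [← quasiIso_iff_comp_left (tensorMap (homPremap h X) (𝟙 P)) (counitMap P X), h1,
    quasiIso_iff_comp_left]

theorem inAuslanderA_iff_of_quasiIso [P.IsKProjective] (f : X ⟶ X') [QuasiIso f] :
    InAuslanderA P X ↔ InAuslanderA P X' := by
  have := quasiIso_tensorMap_left f P
  have := quasiIso_homMap P (tensorMap f (𝟙 P))
  rw [InAuslanderA, InAuslanderA, HomologyBounded.iff_of_quasiIso f,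
    HomologyBounded.iff_of_quasiIso (tensorMap f (𝟙 P)),
    quasiIso_iff_of_comp_eq (unitMap_naturality P f)]

theorem inAuslanderB_iff_of_quasiIso [P.IsKProjective] (f : X ⟶ X') [QuasiIso f] :
    InAuslanderB P X ↔ InAuslanderB P X' := by
  have := quasiIso_homMap P f
  have := quasiIso_tensorMap_left (homMap P f) P
  rw [InAuslanderB, InAuslanderB, HomologyBounded.iff_of_quasiIso f,
    HomologyBounded.iff_of_quasiIso (homMap P f),
    ← quasiIso_iff_of_comp_eq (counitMap_naturality P f).symm]

/-- The isomorphism in the derived category starts from a K-projective complex, so it is represented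
by an actual morphism of complexes. -/
theorem DerivedIso.exists_quasiIso_of_isKProjective {X Y : Cplx S} (h : DerivedIso X Y)
    (Q : KProjRes Y) : ∃ f : Q.P ⟶ X, QuasiIso f := by
  let := HasDerivedCategory.standard (ModuleCat.{u} S)
  obtain ⟨e⟩ := h
  have := Q.kProjective
  have := Q.quasiIso
  exact AuslanderAscent.exists_quasiIso_of_isKProjective
    (asIso (DerivedCategory.Q.map Q.π) ≪≫ e.symm)

theorem DerivedIso.exists_quasiIso_of_isKInjective {X Y : Cplx S} (h : DerivedIso X Y)
    (J : KInjRes Y) : ∃ f : X ⟶ J.I, QuasiIso f := by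
  let := HasDerivedCategory.standard (ModuleCat.{u} S)
  obtain ⟨e⟩ := h
  have := J.kInjective
  have := J.quasiIso
  exact AuslanderAscent.exists_quasiIso_of_isKInjective
    (e ≪≫ asIso (DerivedCategory.Q.map J.ι))

theorem KProjRes.derivedIso {C : Cplx S} (P : KProjRes C) : DerivedIso P.P C := by
  let := HasDerivedCategory.standard (ModuleCat.{u} S)
  have := P.quasiIso
  exact ⟨asIso (DerivedCategory.Q.map P.π)⟩

/-- Any two K-projective resolutions of `C` are linked by a quasi-isomorphism, so the condition may
be tested on a single one, in particular on a finite free one. -/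
theorem auslanderA_iff {C : Cplx S} (P : KProjRes C) : AuslanderA C X ↔ InAuslanderA P.P X := by
  refine ⟨fun h => ⟨h.1, h.2 P⟩, fun h => ⟨h.1, fun P' => ?_⟩⟩
  obtain ⟨f, hf⟩ := P'.derivedIso.exists_quasiIso_of_isKProjective P
  have := P.kProjective
  have := P'.kProjective
  exact ((inAuslanderA_iff_of_quasiIso_left f).1 h).2

theorem auslanderB_iff {C : Cplx S} (P : KProjRes C) : AuslanderB C X ↔ InAuslanderB P.P X := by
  refine ⟨fun h => ⟨h.1, h.2 P⟩, fun h => ⟨h.1, fun P' => ?_⟩⟩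
  obtain ⟨f, hf⟩ := P'.derivedIso.exists_quasiIso_of_isKProjective P
  have := P.kProjective
  have := P'.kProjective
  exact ((inAuslanderB_iff_of_quasiIso_left f).1 h).2

end Independence

/-! ### From bounded complexes to complexes with bounded homology -/

section BoundedHomology

variable {R S : Type u} [CommRing R] [CommRing S] [Algebra R S] {P X X' : Cplx S} {J L : Cplx R}

theorem HomologyBounded.homFromCplx (hX : HomologyBounded X) [J.IsKInjective]
    (hJ : StrictlyBounded J) : HomologyBounded (homFromCplx X J) := by
  obtain ⟨M, N, f, g, _, _, hN⟩ := hX.exists_strictlyBounded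
  have := quasiIso_homFromPremap f J
  have := quasiIso_homFromPremap g J
  exact .of_quasiIso' (homFromPremap f J) (.of_quasiIso (homFromPremap g J)
    (hN.homFromCplx hJ).homologyBounded)

theorem HomologyBounded.homToCplx (hX : HomologyBounded X) [L.IsKProjective]
    (hL : StrictlyBounded L) : HomologyBounded (homToCplx L X) := by
  obtain ⟨M, N, f, g, _, _, hN⟩ := hX.exists_strictlyBounded
  have := quasiIso_homToMap L f
  have := quasiIso_homToMap L g
  exact .of_quasiIso (homToMap L f) (.of_quasiIso' (homToMap L g)
    (hN.homToCplx hL).homologyBounded)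

theorem quasiIso_evalMap_iff [P.IsKProjective] [J.IsKInjective] (f : X ⟶ X') [QuasiIso f] :
    QuasiIso (evalMap P X J) ↔ QuasiIso (evalMap P X' J) := by
  have := quasiIso_homFromPremap f J
  have := quasiIso_tensorMap_left (homFromPremap f J) P
  have := quasiIso_homMap P f
  have := quasiIso_homFromPremap (homMap P f) J
  exact quasiIso_iff_of_comp_eq' (evalMap_naturality P f J)

theorem quasiIso_tensorEvalMap_iff [P.IsKProjective] [L.IsKProjective] (f : X ⟶ X') [QuasiIso f] :
    QuasiIso (tensorEvalMap L P X) ↔ QuasiIso (tensorEvalMap L P X') := by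
  have := quasiIso_homToMap L f
  have := quasiIso_tensorMap_left (homToMap L f) P
  have := quasiIso_tensorMap_left f P
  have := quasiIso_homToMap L (tensorMap f (𝟙 P))
  exact (quasiIso_iff_of_comp_eq (tensorEvalMap_naturality L P f).symm)

/-- Truncation links `X` to a bounded complex, where `evalMap` is bijective; naturality carries the
conclusion back, as source and target both preserve quasi-isomorphisms. -/
theorem quasiIso_evalMap (hP : FiniteFree P) [P.IsKProjective] [J.IsKInjective]
    (hJ : StrictlyBounded J) (hX : HomologyBounded X) : QuasiIso (evalMap P X J) := by
  obtain ⟨M, N, f, g, _, _, hN⟩ := hX.exists_strictlyBounded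
  rw [← quasiIso_evalMap_iff f, quasiIso_evalMap_iff g]
  exact quasiIso_evalMap_of_strictlyBounded hP hN hJ

theorem quasiIso_tensorEvalMap (hP : FiniteFree P) [P.IsKProjective] [L.IsKProjective]
    (hL : StrictlyBounded L) (hX : HomologyBounded X) : QuasiIso (tensorEvalMap L P X) := by
  obtain ⟨M, N, f, g, _, _, hN⟩ := hX.exists_strictlyBounded
  rw [← quasiIso_tensorEvalMap_iff f, quasiIso_tensorEvalMap_iff g]
  exact quasiIso_tensorEvalMap_of_strictlyBounded hP hN hL

end BoundedHomology

/-! ### Transfer of the two classes under Hom functors -/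

section Duality

variable {R S : Type u} [CommRing R] [CommRing S] [Algebra R S] {P X : Cplx S} {J L : Cplx R}

/-- The counit of the dual and the dual of the unit differ by `curryMap` and by `evalMap` at `X ⊗
P`. The latter is why the bound is put on the homology of `X ⊗ P`. -/
theorem quasiIso_counitMap_homFromCplx_iff (hP : FiniteFree P) [P.IsKProjective] [J.IsKInjective]
    (hJ : StrictlyBounded J) (hX : HomologyBounded (tensorCplx X P)) :
    QuasiIso (counitMap P (homFromCplx X J)) ↔ QuasiIso (homFromPremap (unitMap P X) J) := by
  have := quasiIso_evalMap hP hJ hX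
  have := quasiIso_tensorMap_left (curryMap X P J) P
  rw [← quasiIso_iff_comp_left (evalMap P (tensorCplx X P) J),
    evalMap_comp_homFromPremap_unitMap, quasiIso_iff_comp_left]

theorem quasiIso_unitMap_homFromCplx_iff (hP : FiniteFree P) [P.IsKProjective] [J.IsKInjective]
    (hJ : StrictlyBounded J) (hX : HomologyBounded X) :
    QuasiIso (unitMap P (homFromCplx X J)) ↔ QuasiIso (homFromPremap (counitMap P X) J) := by
  have := quasiIso_evalMap hP hJ hX
  have := quasiIso_homMap P (evalMap P X J)
  rw [← quasiIso_iff_comp_right (unitMap P (homFromCplx X J)) (homMap P (evalMap P X J)),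
    unitMap_comp_homMap_evalMap, quasiIso_iff_comp_right]

theorem InAuslanderA.homFromCplx (h : InAuslanderA P X) (hP : FiniteFree P) [P.IsKProjective]
    [J.IsKInjective] (hJ : StrictlyBounded J) : InAuslanderB P (homFromCplx X J) := by
  refine ⟨h.1.homFromCplx hJ, .of_quasiIso (curryMap X P J) (h.2.1.homFromCplx hJ),
    (quasiIso_counitMap_homFromCplx_iff hP hJ h.2.1).2 ?_⟩
  have := h.2.2
  exact quasiIso_homFromPremap _ _

theorem InAuslanderB.homFromCplx (h : InAuslanderB P X) (hP : FiniteFree P) [P.IsKProjective]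
    [J.IsKInjective] (hJ : StrictlyBounded J) : InAuslanderA P (homFromCplx X J) := by
  have := quasiIso_evalMap hP hJ h.1
  refine ⟨h.1.homFromCplx hJ, .of_quasiIso' (evalMap P X J) (h.2.1.homFromCplx hJ),
    (quasiIso_unitMap_homFromCplx_iff hP hJ h.1).2 ?_⟩
  have := h.2.2
  exact quasiIso_homFromPremap _ _

-- The duality argument run backwards: for the character complex, the dual detects both bounded
-- homology and quasi-isomorphisms.
variable (R) in
theorem InAuslanderA.of_homFromCplx (h : InAuslanderB P (AuslanderAscent.homFromCplx X (charCplx R)))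
    (hP : FiniteFree P) [P.IsKProjective] : InAuslanderA P X := by
  -- This bound has to come first, since Hom evaluation is a quasi-isomorphism only under it;
  -- `curryMap` supplies it unconditionally.
  have hb : HomologyBounded (tensorCplx X P) :=
    (homologyBounded_homFromCplx_charCplx_iff R).1 (.of_quasiIso' (curryMap X P (charCplx R)) h.2.1)
  have := (quasiIso_counitMap_homFromCplx_iff hP (strictlyBounded_charCplx R) hb).1 h.2.2
  exact ⟨(homologyBounded_homFromCplx_charCplx_iff R).1 h.1, hb,
    quasiIso_of_quasiIso_homFromPremap R _⟩

variable (R) in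
theorem InAuslanderB.of_homFromCplx (h : InAuslanderA P (AuslanderAscent.homFromCplx X (charCplx R)))
    (hP : FiniteFree P) [P.IsKProjective] : InAuslanderB P X := by
  have hX : HomologyBounded X := (homologyBounded_homFromCplx_charCplx_iff R).1 h.1
  have := quasiIso_evalMap hP (strictlyBounded_charCplx R) hX
  have := (quasiIso_unitMap_homFromCplx_iff hP (strictlyBounded_charCplx R) hX).1 h.2.2
  exact ⟨hX, (homologyBounded_homFromCplx_charCplx_iff R).1
    (.of_quasiIso (evalMap P X (charCplx R)) h.2.1), quasiIso_of_quasiIso_homFromPremap R _⟩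

theorem InAuslanderA.homToCplx (h : InAuslanderA P X) (hP : FiniteFree P) [P.IsKProjective]
    [L.IsKProjective] (hL : StrictlyBounded L) : InAuslanderA P (homToCplx L X) := by
  have := quasiIso_tensorEvalMap hP hL h.1
  have := quasiIso_homMap P (tensorEvalMap L P X)
  have := h.2.2
  have := quasiIso_homToMap L (unitMap P X)
  refine ⟨h.1.homToCplx hL, .of_quasiIso' (tensorEvalMap L P X) (h.2.1.homToCplx hL), ?_⟩
  rw [← quasiIso_iff_comp_right (unitMap P (AuslanderAscent.homToCplx L X))
    (homMap P (tensorEvalMap L P X)), unitMap_comp_homMap_tensorEvalMap]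
  infer_instance

theorem InAuslanderB.homToCplx (h : InAuslanderB P X) (hP : FiniteFree P) [P.IsKProjective]
    [L.IsKProjective] (hL : StrictlyBounded L) : InAuslanderB P (homToCplx L X) := by
  have := quasiIso_tensorEvalMap hP hL h.2.1
  have := quasiIso_tensorMap_left (swapMap L P X) P
  have := h.2.2
  have := quasiIso_homToMap L (counitMap P X)
  refine ⟨h.1.homToCplx hL, .of_quasiIso (swapMap L P X) (h.2.1.homToCplx hL), ?_⟩
  rw [← quasiIso_iff_comp_left (tensorMap (swapMap L P X) (𝟙 P)),
    tensorMap_swapMap_comp_counitMap]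
  infer_instance

end Duality

/-! ### Complexes of finite flat, projective or injective dimension -/

section FiniteDimension

variable {R : Type u} [CommRing R]

theorem isKProjective_of_strictlyBounded {L : Cplx R} (hL : StrictlyBounded L)
    (h : ∀ n, Module.Projective R (L.X n)) : L.IsKProjective := by
  obtain ⟨a, b, hab⟩ := hL
  have (n : ℤ) : Projective (L.X n) := (IsProjective.iff_projective _).1 (h n)
  have : L.IsStrictlyLE b :=
    (CochainComplex.isStrictlyLE_iff _ _).2 fun n hn => hab n (Or.inr hn)
  exact CochainComplex.isKProjective_of_projective L b

theorem isKInjective_of_strictlyBounded {L : Cplx R} (hL : StrictlyBounded L)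
    (h : ∀ n, Module.Injective R (L.X n)) : L.IsKInjective := by
  obtain ⟨a, b, hab⟩ := hL
  have (n : ℤ) : Injective (L.X n) := injective_object R (L.X n)
  have : L.IsStrictlyGE a :=
    (CochainComplex.isStrictlyGE_iff _ _).2 fun n hn => hab n (Or.inl hn)
  exact CochainComplex.isKInjective_of_injective L a

variable {S : Type u} [CommRing S] [Algebra R S] {P A : Cplx S}

/-- The bounded complex `L` of injectives is itself K-injective and maps quasi-isomorphically to the
given resolution, so the bounded case suffices. -/
theorem InAuslanderA.homFromCplx_of_finiteInjDim (h : InAuslanderA P A) (hP : FiniteFree P)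
    [P.IsKProjective] {I : Cplx R} (hI : FiniteInjDim I) (J : KInjRes I) :
    InAuslanderB P (AuslanderAscent.homFromCplx A J.I) := by
  obtain ⟨L, hL, hL', e⟩ := hI
  obtain ⟨f, hf⟩ := e.exists_quasiIso_of_isKInjective J
  have := isKInjective_of_strictlyBounded hL hL'
  have := J.kInjective
  have := quasiIso_homFromMap A f
  exact (inAuslanderB_iff_of_quasiIso (homFromMap A f)).1 (h.homFromCplx hP hL)

theorem InAuslanderB.homFromCplx_of_finiteInjDim (h : InAuslanderB P A) (hP : FiniteFree P)
    [P.IsKProjective] {I : Cplx R} (hI : FiniteInjDim I) (J : KInjRes I) :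
    InAuslanderA P (AuslanderAscent.homFromCplx A J.I) := by
  obtain ⟨L, hL, hL', e⟩ := hI
  obtain ⟨f, hf⟩ := e.exists_quasiIso_of_isKInjective J
  have := isKInjective_of_strictlyBounded hL hL'
  have := J.kInjective
  have := quasiIso_homFromMap A f
  exact (inAuslanderA_iff_of_quasiIso (homFromMap A f)).1 (h.homFromCplx hP hL)

theorem InAuslanderA.homToCplx_of_finiteProjDim (h : InAuslanderA P A) (hP : FiniteFree P)
    [P.IsKProjective] {F : Cplx R} (hF : FiniteProjDim F) (Q : KProjRes F) :
    InAuslanderA P (AuslanderAscent.homToCplx Q.P A) := by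
  obtain ⟨L, hL, hL', e⟩ := hF
  obtain ⟨f, hf⟩ := e.exists_quasiIso_of_isKProjective Q
  have := isKProjective_of_strictlyBounded hL hL'
  have := Q.kProjective
  have := quasiIso_homToPremap f A
  exact (inAuslanderA_iff_of_quasiIso (homToPremap f A)).1 (h.homToCplx hP hL)

theorem InAuslanderB.homToCplx_of_finiteProjDim (h : InAuslanderB P A) (hP : FiniteFree P)
    [P.IsKProjective] {F : Cplx R} (hF : FiniteProjDim F) (Q : KProjRes F) :
    InAuslanderB P (AuslanderAscent.homToCplx Q.P A) := by
  obtain ⟨L, hL, hL', e⟩ := hF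
  obtain ⟨f, hf⟩ := e.exists_quasiIso_of_isKProjective Q
  have := isKProjective_of_strictlyBounded hL hL'
  have := Q.kProjective
  have := quasiIso_homToPremap f A
  exact (inAuslanderB_iff_of_quasiIso (homToPremap f A)).1 (h.homToCplx hP hL)

/-- The character dual of `A ⊗_R Q` is `Hom_R(A, L)` up to quasi-isomorphism, for a bounded complex
`L` of injective modules, if `Q` has finite flat dimension. -/
theorem exists_quasiIso_homFromCplx_tensorRelCplx (A : Cplx S) {F : Cplx R}
    (hF : FiniteFlatDim F) (Q : KProjRes F) :
    ∃ (L : Cplx R) (f : AuslanderAscent.homFromCplx A L ⟶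
      AuslanderAscent.homFromCplx (tensorRelCplx A Q.P) (charCplx R)),
      QuasiIso f ∧ StrictlyBounded L ∧ L.IsKInjective := by
  obtain ⟨L, hL, hL', e⟩ := hF
  obtain ⟨f, hf⟩ := e.exists_quasiIso_of_isKProjective Q
  have hLb := hL.homFromCplx (strictlyBounded_charCplx R)
  have hLi := isKInjective_of_strictlyBounded hLb (injective_homFromCplx_charCplx L hL')
  have := Q.kProjective
  -- The duals of `L` and of `Q.P` are then quasi-isomorphic K-injective complexes, hence homotopy
  -- equivalent, so `Hom_R(A, -)` preserves the comparison without conditions on `A`.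
  have := isKInjective_homFromCplx Q.P (charCplx R)
  have := quasiIso_homFromPremap f (charCplx R)
  have := quasiIso_homFromMap A (homFromPremap f (charCplx R))
  exact ⟨_, homFromMap A (homFromPremap f (charCplx R)) ≫ inv (relCurryMap A Q.P (charCplx R)),
    inferInstance, hLb, hLi⟩

/-- The character dual of the tensor product is quasi-isomorphic to `Hom_R(A, L)` with `L` bounded
and K-injective. It lies in the Bass class by duality, and the tensor product is recovered from its
character dual. -/
theorem InAuslanderA.tensorRelCplx_of_finiteFlatDim (h : InAuslanderA P A) (hP : FiniteFree P)
    [P.IsKProjective] {F : Cplx R} (hF : FiniteFlatDim F) (Q : KProjRes F) :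
    InAuslanderA P (tensorRelCplx A Q.P) := by
  obtain ⟨L, f, _, hL, _⟩ := exists_quasiIso_homFromCplx_tensorRelCplx A hF Q
  exact .of_homFromCplx R ((inAuslanderB_iff_of_quasiIso f).1 (h.homFromCplx hP hL)) hP

theorem InAuslanderB.tensorRelCplx_of_finiteFlatDim (h : InAuslanderB P A) (hP : FiniteFree P)
    [P.IsKProjective] {F : Cplx R} (hF : FiniteFlatDim F) (Q : KProjRes F) :
    InAuslanderB P (tensorRelCplx A Q.P) := by
  obtain ⟨L, f, _, hL, _⟩ := exists_quasiIso_homFromCplx_tensorRelCplx A hF Q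
  exact .of_homFromCplx R ((inAuslanderA_iff_of_quasiIso f).1 (h.homFromCplx hP hL)) hP

end FiniteDimension

end

end AuslanderAscent

/-- In each part the resolution `Q` computes the derived functor: `tensorRelCplx A Q.P` is
`A ⊗^L_R F`, `homToCplx Q.P A` is `RHom_R(P, A)` and `homFromCplx A J.I` is `RHom_R(A, I)`, as
complexes of `S`-modules. -/
theorem proposition2p1 {R S : Type u} [CommRing R] [CommRing S] [Algebra R S] [IsNoetherianRing S]
    (C : AuslanderAscent.Cplx S) (hC : AuslanderAscent.IsSemidualizing C) :
    (∀ (A : AuslanderAscent.Cplx S) (F : AuslanderAscent.Cplx R),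
      AuslanderAscent.AuslanderA C A → AuslanderAscent.FiniteFlatDim F →
        ∀ Q : AuslanderAscent.KProjRes F,
          AuslanderAscent.AuslanderA C (AuslanderAscent.tensorRelCplx A Q.P)) ∧
    (∀ (B : AuslanderAscent.Cplx S) (F : AuslanderAscent.Cplx R),
      AuslanderAscent.AuslanderB C B → AuslanderAscent.FiniteFlatDim F →
        ∀ Q : AuslanderAscent.KProjRes F,
          AuslanderAscent.AuslanderB C (AuslanderAscent.tensorRelCplx B Q.P)) ∧
    (∀ (P : AuslanderAscent.Cplx R) (A : AuslanderAscent.Cplx S),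
      AuslanderAscent.FiniteProjDim P → AuslanderAscent.AuslanderA C A →
        ∀ Q : AuslanderAscent.KProjRes P,
          AuslanderAscent.AuslanderA C (AuslanderAscent.homToCplx Q.P A)) ∧
    (∀ (P : AuslanderAscent.Cplx R) (B : AuslanderAscent.Cplx S),
      AuslanderAscent.FiniteProjDim P → AuslanderAscent.AuslanderB C B →
        ∀ Q : AuslanderAscent.KProjRes P,
          AuslanderAscent.AuslanderB C (AuslanderAscent.homToCplx Q.P B)) ∧
    (∀ (A : AuslanderAscent.Cplx S) (I : AuslanderAscent.Cplx R),
      AuslanderAscent.AuslanderA C A → AuslanderAscent.FiniteInjDim I →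
        ∀ J : AuslanderAscent.KInjRes I,
          AuslanderAscent.AuslanderB C (AuslanderAscent.homFromCplx A J.I)) ∧
    (∀ (B : AuslanderAscent.Cplx S) (I : AuslanderAscent.Cplx R),
      AuslanderAscent.AuslanderB C B → AuslanderAscent.FiniteInjDim I →
        ∀ J : AuslanderAscent.KInjRes I,
          AuslanderAscent.AuslanderA C (AuslanderAscent.homFromCplx B J.I)) := by
  -- One finite free resolution of `C` serves all six parts; in the next steps membership in both
  -- classes is rewritten in terms of it.
  obtain ⟨P, hP⟩ := AuslanderAscent.exists_finiteFree_resolution hC.finite hC.bounded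
  have := P.kProjective
  simp only [AuslanderAscent.auslanderA_iff P, AuslanderAscent.auslanderB_iff P]
  exact ⟨fun _ _ h hF Q => h.tensorRelCplx_of_finiteFlatDim hP hF Q,
    fun _ _ h hF Q => h.tensorRelCplx_of_finiteFlatDim hP hF Q,
    fun _ _ hF h Q => h.homToCplx_of_finiteProjDim hP hF Q,
    fun _ _ hF h Q => h.homToCplx_of_finiteProjDim hP hF Q,
    fun _ _ h hI J => h.homFromCplx_of_finiteInjDim hP hI J,
    fun _ _ h hI J => h.homFromCplx_of_finiteInjDim hP hI J⟩
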